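/- Partitions are identified with their Young diagrams; $\lambda'$ denotes the conjugate of $\lambda$, and $\lambda$ is self-conjugate if $\lambda'=\lambda$. The beta-set of a partition $\lambda=(\lambda_1\ge\lambda_2\ge\cdots)$ is $\mathcal B(\lambda)=\{\lambda_r-r : r\ge 1\}\subset\mathbb Z$, and for $b\in\mathbb Z$ we write $\overline b=-1-b$. A rim $s$-hook of $\lambda$ is a connected set of $s$ nodes $(r,c)$ of $\lambda$ with $(r+1,c+1)\notin\lambda$ whose removal leaves a Young diagram; an $s$-core is a partition with no rim $s$-hooks, and the $s$-core of $\lambda$ is the partition reached by removing rim $s$-hooks from $\lambda$ until none remain. An $(s,t)$-core is a partition which is both an $s$-core and a $t$-core. Fix coprime integers $s,t>1$. Let $\kappa_{s,t}$ be the unique largest $(s,t)$-core. For $(s,t)$-cores $\sigma,\tau$ and an integer $n\ge 0$, let $\mathcal P_{\sigma,\tau}(n)$ be the set of partitions of $n$ with $s$-core $\sigma$ and $t$-core $\tau$. Write $\sigma\stackrel{s,t}{\rightharpoondown}\tau$ if there is $b\in\mathcal B(\tau)\setminus\mathcal B(\sigma)$ with $\overline b-b\equiv t\pmod{2s}$ and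 $\mathcal B(\sigma)=(\mathcal B(\tau)\setminus\{b\})\cup\{\overline b\}$. Write $\sigma\stackrel{s,t}{\leftrightharpoons}\tau$ if there are distinct $b,c\in\mathcal B(\tau)\setminus\mathcal B(\sigma)$ with $\overline b-b\equiv t\pmod{2s}$, $\overline c-c\equiv -s\pmod{2t}$ and $\mathcal B(\sigma)=(\mathcal B(\tau)\setminus\{b,c\})\cup\{\overline b,\overline c\}$; in this case let $\sigma\star\tau$ be the partition with $\mathcal B(\sigma\star\tau)=(\mathcal B(\tau)\setminus\{c\})\cup\{\overline c\}$. **Theorem.** Suppose $\sigma,\tau$ are $(s,t)$-cores and $n\ge 0$ is an integer. Then $\mathcal P_{\sigma,\tau}(n)$ contains a unique self-conjugate partition if and only if $\sigma'=\sigma$, $\tau'=\tau$ and one of the following conditions holds. - C1. $\sigma=\tau$ and $n=|\sigma|$. - C2. $t$ is odd, $\sigma\stackrel{s,t}{\rightharpoondown}\tau$ and $n=|\tau|+t$. - C3. $s$ is odd, $\tau\stackrel{t,s}{\rightharpoondown}\sigma$ and $n=|\sigma|+s$. - C4. $s$ and $t$ are both odd, $\sigma\stackrel{s,t}{\leftrightharpoons}\tau$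 and $n=|\sigma\star\tau|+s+t$. - C5. $s$ and $t$ are both odd, $\sigma=\tau=\kappa_{s,t}$ and $n=|\kappa_{s,t}|+st$. -/

import Mathlib

/-!
Partitions are Mathlib's Young diagrams (English convention, rows and columns indexed from `0`);
`μ.card` is the size of `μ`, `μ.rowLen r` its `(r + 1)`-st part, `μ.transpose` its conjugate.
-/

namespace CorePartitions

/-- The beta-set `{λ_r - r : r = 1, 2, …}` of a partition. -/
def betaSet (μ : YoungDiagram) : Set ℤ :=
  {x : ℤ | ∃ r : ℕ, x = (μ.rowLen r : ℤ) - ((r : ℤ) + 1)}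

/-- `μ` is self-conjugate. -/
def IsSelfConjugate (μ : YoungDiagram) : Prop :=
  μ.transpose = μ

/-- The rim of `μ`: the nodes `(r, c)` of `μ` such that `(r + 1, c + 1)` is not a node. -/
def rim (μ : YoungDiagram) : Set (ℕ × ℕ) :=
  {x | x ∈ μ ∧ (x.1 + 1, x.2 + 1) ∉ μ}

/-- `ν` is obtained from `μ` by removing a rim `s`-hook: the nodes removed form a connected set
of `s` nodes in the rim of `μ`. Connectedness is taken in the grid graph, in which two
nodes are adjacent when they share an edge (the Hasse diagram of the product order). -/
def RemovesRimHook (s : ℕ) (μ ν : YoungDiagram) : Prop :=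
  ν ≤ μ ∧
  (↑(μ.cells \ ν.cells) : Set (ℕ × ℕ)) ⊆ rim μ ∧
  ((SimpleGraph.hasse (ℕ × ℕ)).induce (↑(μ.cells \ ν.cells) : Set (ℕ × ℕ))).Connected ∧
  (μ.cells \ ν.cells).card = s

/-- `μ` is an `s`-core: it has no rim `s`-hooks. -/
def IsCore (s : ℕ) (μ : YoungDiagram) : Prop :=
  ∀ ν : YoungDiagram, ¬ RemovesRimHook s μ ν

/-- `σ` is the `s`-core of `μ`: it is reached from `μ` by successively removing rim `s`-hooks
until none remain. -/
def HasCore (s : ℕ) (μ σ : YoungDiagram) : Prop :=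
  Relation.ReflTransGen (RemovesRimHook s) μ σ ∧ IsCore s σ

/-- `μ` is an `(s, t)`-core. -/
def IsSimultaneousCore (s t : ℕ) (μ : YoungDiagram) : Prop :=
  IsCore s μ ∧ IsCore t μ

/-- `κ` is the unique largest `(s, t)`-core. -/
def IsLargestSimultaneousCore (s t : ℕ) (κ : YoungDiagram) : Prop :=
  IsSimultaneousCore s t κ ∧
    ∀ ρ : YoungDiagram, IsSimultaneousCore s t ρ → ρ ≠ κ → ρ.card < κ.card

/-- The set of partitions of `n` with `s`-core `σ` and `t`-core `τ`. -/
def partitionsWithCores (s t n : ℕ) (σ τ : YoungDiagram) : Set YoungDiagram :=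
  {μ | μ.card = n ∧ HasCore s μ σ ∧ HasCore t μ τ}

/-- The reflection `b ↦ -1 - b` of the integers. -/
def bar (b : ℤ) : ℤ := -1 - b

/-- The relation `σ ⇀ τ` with respect to the ordered pair `(s, t)`. -/
def SingleSwap (s t : ℕ) (σ τ : YoungDiagram) : Prop :=
  ∃ b : ℤ, b ∈ betaSet τ \ betaSet σ ∧
    bar b - b ≡ (t : ℤ) [ZMOD 2 * (s : ℤ)] ∧
    betaSet σ = (betaSet τ \ {b}) ∪ {bar b}

/-- The integers `b`, `c` witness the relation `σ ⇌ τ` with respect to `(s, t)`. -/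
def DoubleSwapAt (s t : ℕ) (σ τ : YoungDiagram) (b c : ℤ) : Prop :=
  b ≠ c ∧ b ∈ betaSet τ \ betaSet σ ∧ c ∈ betaSet τ \ betaSet σ ∧
    bar b - b ≡ (t : ℤ) [ZMOD 2 * (s : ℤ)] ∧
    bar c - c ≡ -(s : ℤ) [ZMOD 2 * (t : ℤ)] ∧
    betaSet σ = (betaSet τ \ {b, c}) ∪ {bar b, bar c}

/-- The relation `σ ⇌ τ` with respect to the ordered pair `(s, t)`. -/
def DoubleSwap (s t : ℕ) (σ τ : YoungDiagram) : Prop :=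
  ∃ b c : ℤ, DoubleSwapAt s t σ τ b c

/-- `υ` is the partition `σ ⋆ τ`, which is defined when `σ ⇌ τ` with respect to `(s, t)`: its
beta-set is obtained from that of `τ` by replacing `c` with `bar c`. -/
def IsStar (s t : ℕ) (σ τ υ : YoungDiagram) : Prop :=
  ∃ b c : ℤ, DoubleSwapAt s t σ τ b c ∧ betaSet υ = (betaSet τ \ {c}) ∪ {bar c}

end CorePartitions

namespace CorePartitions

/-! Everything happens on beta-sets, seen as beads on the integers. Removing a rim s-hook moves a
bead from b to b - s. So an s-core is a set stable under subtracting s (`Closed`), and two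
partitions have the same s-core exactly when every s-periodic weight has relative sum zero between
their beta-sets (`Equicharged`, `hasCore_iff`). Conjugation is reflection by `bar` followed by
complementation, so self-conjugacy is `Anti`. The question becomes when the conditions of
`IsSolution` determine a single set A.

Necessity. Suppose A contains two opposite corners of a rectangle with sides s * p and t * q and
misses the other two. Exchanging the corners, together with their mirror images, preserves all
charges and the size. Uniqueness therefore forbids such rectangles unless corners coincide or are
mirror images (`rect_of_unique`). On the other hand the s-core of A is also a t-core, so each class
modulo s has at least as many descents by t (x in A, x + t not in A) as ascents (x not in A, x + t
in A); this is `pair_shift_nonneg`. An ascent thus comes with a descent, and the two span a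
rectangle. This confines ascents by s * t to the centre of symmetry (`Rigid.eq_of_ascent`). If there
are none, ascents by t are tied to the centre too (`Rigid.ascent_classification`), and A is an
(s,t)-core with the central pair at distance t, at distance s, both or neither exchanged: C1 to C4.
If there is one, undoing it leaves a set whose columns are all translates of the central one, and
this set is the beta-set of the largest core: C5.

Sufficiency. Explicit solutions come from exchanging central pairs in a core. Uniqueness is an
extremality argument: a core has least size among sets with its charges, which settles C1 to C3. For
C5 and C4 one takes a weight whose relative sum is known from the charges and the size, and for
which all terms have one sign, possibly after a periodic correction. The known sum then leaves no
freedom (`backward_kappa`, `SwapConfig.solution_unique`). In C4 the weight is 2 * x + 1 corrected by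
`potential`.

That the set with equal columns really is the largest core follows from writing the size of a core
as a quadratic form in its column heights (`IsKappa.size_lt`). -/

open Classical in
/-- The integer-valued indicator function of a set of integers. -/
noncomputable def ind (A : Set ℤ) (x : ℤ) : ℤ := if x ∈ A then 1 else 0

lemma ind_of_mem {A : Set ℤ} {x : ℤ} (h : x ∈ A) : ind A x = 1 := if_pos h

lemma ind_of_notMem {A : Set ℤ} {x : ℤ} (h : x ∉ A) : ind A x = 0 := if_neg h

lemma ind_nonneg (A : Set ℤ) (x : ℤ) : 0 ≤ ind A x := by
  unfold ind; split_ifs <;> simp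

lemma ind_le_one (A : Set ℤ) (x : ℤ) : ind A x ≤ 1 := by
  unfold ind; split_ifs <;> simp

lemma ind_congr {A B : Set ℤ} {x y : ℤ} (h : x ∈ A ↔ y ∈ B) : ind A x = ind B y := by
  by_cases hx : x ∈ A
  · rw [ind_of_mem hx, ind_of_mem (h.1 hx)]
  · rw [ind_of_notMem hx, ind_of_notMem fun hy => hx (h.2 hy)]

lemma ind_eq_iff {A B : Set ℤ} {x y : ℤ} : ind A x = ind B y ↔ (x ∈ A ↔ y ∈ B) := by
  unfold ind; split_ifs with h1 h2 h2 <;> simp [h1, h2]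

/-! ### Maya sets and relative sums of weights. -/

/-- A set of integers containing all sufficiently small integers and no sufficiently large one. -/
def Maya (A : Set ℤ) : Prop := ∃ N : ℤ, (∀ x < -N, x ∈ A) ∧ ∀ x, N ≤ x → x ∉ A

/-- The set of negative integers, which is the beta-set of the empty partition. -/
def vac : Set ℤ := {x | x < 0}

lemma maya_vac : Maya vac := ⟨0, fun x hx => by simpa [vac] using hx, fun x hx => by
  simpa [vac] using hx⟩

/-- The sum of the weight `w` over `A` relative to its sum over `B`. -/
noncomputable def pair (A B : Set ℤ) (w : ℤ → ℤ) : ℤ := ∑ᶠ x, (ind A x - ind B x) * w x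

lemma pair_support_finite {A B : Set ℤ} (hA : Maya A) (hB : Maya B) (w : ℤ → ℤ) :
    (Function.support fun x => (ind A x - ind B x) * w x).Finite := by
  obtain ⟨M, hM1, hM2⟩ := hA
  obtain ⟨N, hN1, hN2⟩ := hB
  refine (Set.finite_Icc (-(max M N)) (max M N)).subset ?_
  intro x hx
  by_contra hc
  apply hx
  simp only [Set.mem_Icc, not_and_or, not_le] at hc
  have h1 := le_max_left M N
  have h2 := le_max_right M N
  rcases hc with hc | hc
  · simp [ind_of_mem (hM1 x (by omega)), ind_of_mem (hN1 x (by omega))]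
  · simp [ind_of_notMem (hM2 x (by omega)), ind_of_notMem (hN2 x (by omega))]

lemma pair_trans {A B C : Set ℤ} (hA : Maya A) (hB : Maya B) (hC : Maya C) (w : ℤ → ℤ) :
    pair A C w = pair A B w + pair B C w := by
  unfold pair
  rw [← finsum_add_distrib (pair_support_finite hA hB w) (pair_support_finite hB hC w)]
  exact finsum_congr fun x => by ring

lemma pair_symm (A B : Set ℤ) (w : ℤ → ℤ) : pair A B w = -pair B A w := by
  unfold pair
  rw [← finsum_neg_distrib]
  exact finsum_congr fun x => by ring

lemma pair_self (A : Set ℤ) (w : ℤ → ℤ) : pair A A w = 0 := by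
  simp [pair]

lemma pair_add {A B : Set ℤ} (hA : Maya A) (hB : Maya B) (w w' : ℤ → ℤ) :
    pair A B (fun x => w x + w' x) = pair A B w + pair A B w' := by
  unfold pair
  rw [← finsum_add_distrib (pair_support_finite hA hB w) (pair_support_finite hA hB w')]
  exact finsum_congr fun x => by ring

lemma pair_mul {A B : Set ℤ} (hA : Maya A) (hB : Maya B) (c : ℤ) (w : ℤ → ℤ) :
    pair A B (fun x => c * w x) = c * pair A B w := by
  unfold pair
  rw [mul_finsum' _ _ (pair_support_finite hA hB w)]
  exact finsum_congr fun x => by ring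

lemma pair_sub {A B : Set ℤ} (hA : Maya A) (hB : Maya B) (w w' : ℤ → ℤ) :
    pair A B (fun x => w x - w' x) = pair A B w - pair A B w' := by
  unfold pair
  rw [← finsum_sub_distrib (pair_support_finite hA hB w) (pair_support_finite hA hB w')]
  exact finsum_congr fun x => by ring

lemma pair_congr {A B : Set ℤ} {w w' : ℤ → ℤ} (h : ∀ x, ¬(x ∈ A ↔ x ∈ B) → w x = w' x) :
    pair A B w = pair A B w' := by
  refine finsum_congr fun x => ?_
  by_cases hx : x ∈ A ↔ x ∈ B
  · rw [ind_congr hx]; simp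
  · rw [h x hx]

lemma pair_nonneg {A B : Set ℤ} {w : ℤ → ℤ} (h : ∀ x, 0 ≤ (ind A x - ind B x) * w x) :
    0 ≤ pair A B w := finsum_nonneg h

lemma term_le_pair {A B : Set ℤ} (hA : Maya A) (hB : Maya B) {w : ℤ → ℤ}
    (h : ∀ x, 0 ≤ (ind A x - ind B x) * w x) (x : ℤ) :
    (ind A x - ind B x) * w x ≤ pair A B w :=
  single_le_finsum x (pair_support_finite hA hB w) h

lemma pair_eq_sum {A B : Set ℤ} {w : ℤ → ℤ} (F : Finset ℤ)
    (h : ∀ x, x ∉ F → (ind A x - ind B x) * w x = 0) :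
    pair A B w = ∑ x ∈ F, (ind A x - ind B x) * w x := by
  refine finsum_eq_sum_of_support_subset _ fun x hx => ?_
  by_contra hc
  exact hx (h x hc)

lemma sum_le_pair {A B : Set ℤ} (hA : Maya A) (hB : Maya B) {w : ℤ → ℤ}
    (h : ∀ x, 0 ≤ (ind A x - ind B x) * w x) (F : Finset ℤ) :
    ∑ x ∈ F, (ind A x - ind B x) * w x ≤ pair A B w := by
  classical
  have hfin := pair_support_finite hA hB w
  rw [pair_eq_sum (F ∪ hfin.toFinset)]
  · exact Finset.sum_le_sum_of_subset_of_nonneg Finset.subset_union_left fun x _ _ => h x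
  · intro x hx
    by_contra hc
    exact hx (Finset.mem_union_right _ (hfin.mem_toFinset.2 hc))

/-- The set obtained from `A` by replacing `b` with `c`. -/
def move (A : Set ℤ) (b c : ℤ) : Set ℤ := (A \ {b}) ∪ {c}

lemma mem_move {A : Set ℤ} {b c x : ℤ} : x ∈ move A b c ↔ (x ∈ A ∧ x ≠ b) ∨ x = c := Iff.rfl

lemma Maya.move {A : Set ℤ} (hA : Maya A) (b c : ℤ) : Maya (move A b c) := by
  obtain ⟨N, h1, h2⟩ := hA
  refine ⟨max N (max (|b| + 1) (|c| + 1)), fun x hx => ?_, fun x hx => ?_⟩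
  · have := neg_abs_le b
    exact Or.inl ⟨h1 x (by omega), by simp only [Set.mem_singleton_iff]; omega⟩
  · have := le_abs_self c
    rintro (h | h)
    · exact h2 x (by omega) h.1
    · simp only [Set.mem_singleton_iff] at h; omega

lemma pair_move {A : Set ℤ} {b c : ℤ} (hb : b ∈ A) (hc : c ∉ A) (w : ℤ → ℤ) :
    pair (move A b c) A w = w c - w b := by
  have hbc : b ≠ c := fun h => hc (h ▸ hb)
  rw [pair_eq_sum {b, c}, Finset.sum_pair hbc, ind_of_mem hb, ind_of_notMem hc,
    ind_of_mem (mem_move.2 (Or.inr rfl)), ind_of_notMem]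
  · ring
  · rw [mem_move]; tauto
  · intro x hx
    simp only [Finset.mem_insert, Finset.mem_singleton, not_or] at hx
    rw [ind_congr (B := A) (y := x)]
    · simp
    · rw [mem_move]; tauto

lemma move_move {A : Set ℤ} {b c : ℤ} (hb : b ∈ A) (hc : c ∉ A) :
    move (move A b c) c b = A := by
  ext x
  simp only [mem_move]
  by_cases h1 : x = b <;> by_cases h2 : x = c <;> simp_all

/-! ### Charges, closed sets, size and the reflection. -/

/-- `A` and `B` have the same charge on every residue class modulo `s`. -/
def Equicharged (s : ℤ) (A B : Set ℤ) : Prop :=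
  ∀ w : ℤ → ℤ, (∀ x, w (x + s) = w x) → pair A B w = 0

lemma Equicharged.symm {s : ℤ} {A B : Set ℤ} (h : Equicharged s A B) : Equicharged s B A :=
  fun w hw => by rw [pair_symm, h w hw, neg_zero]

lemma Equicharged.refl (s : ℤ) (A : Set ℤ) : Equicharged s A A := fun _ _ => pair_self _ _

lemma Equicharged.trans {s : ℤ} {A B C : Set ℤ} (hA : Maya A) (hB : Maya B) (hC : Maya C)
    (h : Equicharged s A B) (h' : Equicharged s B C) : Equicharged s A C :=
  fun w hw => by rw [pair_trans hA hB hC, h w hw, h' w hw, add_zero]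

lemma periodic_mul {s : ℤ} {w : ℤ → ℤ} (hw : ∀ x, w (x + s) = w x) (k x : ℤ) :
    w (x + s * k) = w x := by
  have : Function.Periodic w s := hw
  rw [mul_comm]
  exact this.int_mul k x

lemma equicharged_move {s : ℤ} {A : Set ℤ} {b c : ℤ} (hb : b ∈ A) (hc : c ∉ A)
    (h : s ∣ c - b) : Equicharged s (move A b c) A := by
  intro w hw
  obtain ⟨k, hk⟩ := h
  rw [pair_move hb hc, show c = b + s * k by omega, periodic_mul hw, sub_self]

/-- `A` is stable under subtracting `s`. -/
def Closed (s : ℤ) (A : Set ℤ) : Prop := ∀ x, x + s ∈ A → x ∈ A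

lemma Closed.mul {s : ℤ} {A : Set ℤ} (h : Closed s A) (x : ℤ) {k : ℤ} (hk : 0 ≤ k)
    (hx : x + s * k ∈ A) : x ∈ A := by
  obtain ⟨n, rfl⟩ := Int.eq_ofNat_of_zero_le hk
  clear hk
  induction n with
  | zero => simpa using hx
  | succ n ih =>
    apply ih
    apply h
    push_cast at hx ⊢
    rwa [show x + s * n + s = x + s * (n + 1) by ring]

open Classical in
/-- The indicator of the residue class of `r` modulo `s`. -/
noncomputable def classInd (s r x : ℤ) : ℤ := if s ∣ x - r then 1 else 0

lemma classInd_periodic (s r x : ℤ) : classInd s r (x + s) = classInd s r x := by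
  unfold classInd
  have : s ∣ x + s - r ↔ s ∣ x - r := by
    rw [show x + s - r = x - r + s by ring]; exact dvd_add_self_right
  simp only [this]

lemma classInd_of_dvd {s r x : ℤ} (h : s ∣ x - r) : classInd s r x = 1 := if_pos h

lemma classInd_of_not_dvd {s r x : ℤ} (h : ¬ s ∣ x - r) : classInd s r x = 0 := if_neg h

/-- In a residue class closed sets are initial segments, hence nested. A point of A outside B would
make the class of A strictly larger and its relative charge positive. Consequently a core is
determined by its charges. -/
lemma Closed.subset_of_equicharged {s : ℤ} {A B : Set ℤ} (hA : Maya A)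
    (hB : Maya B) (cA : Closed s A) (cB : Closed s B) (h : Equicharged s A B) : A ⊆ B := by
  intro x hx
  by_contra hxB
  have hterm : ∀ y, 0 ≤ (ind A y - ind B y) * classInd s x y := by
    intro y
    by_cases hy : s ∣ y - x
    · rw [classInd_of_dvd hy, mul_one, sub_nonneg]
      by_cases hyB : y ∈ B
      · suffices y ∈ A by rw [ind_of_mem this]; exact ind_le_one _ _
        obtain ⟨k, hk⟩ := hy
        rcases le_or_gt 0 k with hk0 | hk0
        · exact absurd (cB.mul x hk0 (by rwa [show x + s * k = y by omega])) hxB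
        · refine cA.mul y (k := -k) (by omega) ?_
          rwa [show y + s * -k = x by rw [mul_neg]; omega]
      · rw [ind_of_notMem hyB]; exact ind_nonneg _ _
    · rw [classInd_of_not_dvd hy, mul_zero]
  have h1 := term_le_pair hA hB hterm x
  rw [h _ (classInd_periodic s x), ind_of_mem hx, ind_of_notMem hxB,
    classInd_of_dvd (by simp)] at h1
  norm_num at h1

lemma Closed.eq_of_equicharged {s : ℤ} {A B : Set ℤ} (hA : Maya A) (hB : Maya B)
    (cA : Closed s A) (cB : Closed s B) (h : Equicharged s A B) : A = B :=
  Set.Subset.antisymm (cA.subset_of_equicharged hA hB cB h)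
    (cB.subset_of_equicharged hB hA cA h.symm)

/-- The weight of `A` relative to the negative integers: the size of the partition with
beta-set `A`. -/
noncomputable def size (A : Set ℤ) : ℤ := pair A vac id

lemma size_move {A : Set ℤ} (hA : Maya A) {b c : ℤ} (hb : b ∈ A) (hc : c ∉ A) :
    size (move A b c) = size A + (c - b) := by
  unfold size
  rw [pair_trans (hA.move b c) hA maya_vac, pair_move hb hc]
  simp only [id]; ring

/-- `A` is exchanged with its complement by the reflection `bar`. -/
def Anti (A : Set ℤ) : Prop := ∀ x, bar x ∈ A ↔ x ∉ A

lemma bar_bar (x : ℤ) : bar (bar x) = x := by unfold bar; ring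

lemma anti_vac : Anti vac := by
  intro x; simp only [vac, bar, Set.mem_ofPred_eq]; omega

/-- The reflection `bar` as a permutation of the integers. -/
def barEquiv : ℤ ≃ ℤ := ⟨bar, bar, bar_bar, bar_bar⟩

lemma pair_comp_bar {A B : Set ℤ} (hA : Anti A) (hB : Anti B) (w : ℤ → ℤ) :
    pair A B (fun x => w (bar x)) = - pair A B w := by
  unfold pair
  rw [← finsum_neg_distrib, ← finsum_comp_equiv barEquiv]
  refine finsum_congr fun x => ?_
  have key : ∀ C : Set ℤ, Anti C → ind C (bar x) = 1 - ind C x := by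
    intro C hC
    by_cases h : x ∈ C
    · rw [ind_of_mem h, ind_of_notMem fun h' => (hC x).1 h' h]; ring
    · rw [ind_of_notMem h, ind_of_mem ((hC x).2 h)]; ring
  change (ind A (bar x) - ind B (bar x)) * w (bar (bar x)) = _
  rw [key A hA, key B hB, bar_bar]; ring

lemma Anti.move {A : Set ℤ} (hA : Anti A) {b : ℤ} (hb : b ∈ A) : Anti (move A b (bar b)) := by
  intro x
  have h1 : bar b ∉ A := fun h => (hA b).1 h hb
  have h2 : bar x = b ↔ x = bar b := by unfold bar; omega
  have h3 : bar x = bar b ↔ x = b := by unfold bar; omega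
  rw [mem_move, mem_move, hA x, Ne, h2, h3]
  by_cases h4 : x = b
  · subst h4
    have : x ≠ bar x := by unfold bar; omega
    simp [this]
  · by_cases h5 : x = bar b <;> simp_all

/-! ### Beta-sets of Young diagrams. -/

/-- The `r`-th element of the beta-set of `μ`, in decreasing order. -/
def beta (μ : YoungDiagram) (r : ℕ) : ℤ := (μ.rowLen r : ℤ) - ((r : ℤ) + 1)

lemma mem_betaSet {μ : YoungDiagram} {x : ℤ} : x ∈ betaSet μ ↔ ∃ r, x = beta μ r := Iff.rfl

lemma beta_mem (μ : YoungDiagram) (r : ℕ) : beta μ r ∈ betaSet μ := ⟨r, rfl⟩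

lemma beta_strictAnti (μ : YoungDiagram) : StrictAnti (beta μ) := by
  refine strictAnti_nat_of_succ_lt fun r => ?_
  have := μ.rowLen_anti r (r + 1) (by omega)
  unfold beta; push_cast; omega

lemma beta_inj {μ : YoungDiagram} {r r' : ℕ} : beta μ r = beta μ r' ↔ r = r' :=
  (beta_strictAnti μ).injective.eq_iff

lemma rowLen_eq_zero {μ : YoungDiagram} {r : ℕ} (h : μ.colLen 0 ≤ r) : μ.rowLen r = 0 := by
  by_contra hc
  have : (r, 0) ∈ μ := YoungDiagram.mem_iff_lt_rowLen.2 (Nat.pos_of_ne_zero hc)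
  rw [YoungDiagram.mem_iff_lt_colLen] at this
  omega

lemma beta_of_le {μ : YoungDiagram} {r : ℕ} (h : μ.colLen 0 ≤ r) : beta μ r = -((r : ℤ) + 1) := by
  simp [beta, rowLen_eq_zero h]

lemma mem_betaSet_of_lt {μ : YoungDiagram} {x : ℤ} (h : x < -(μ.colLen 0 : ℤ)) :
    x ∈ betaSet μ := by
  refine ⟨(-x - 1).toNat, ?_⟩
  rw [rowLen_eq_zero (by omega)]
  push_cast
  omega

lemma maya_betaSet (μ : YoungDiagram) : Maya (betaSet μ) := by
  refine ⟨max (μ.colLen 0) (μ.rowLen 0), fun x hx => mem_betaSet_of_lt (by omega), ?_⟩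
  rintro x hx ⟨r, rfl⟩
  have := μ.rowLen_anti 0 r (by omega)
  omega

/-- Bead number r of `μ` is matched with bead number r of the empty partition; beyond the first
`μ.colLen 0` rows the two coincide. This turns relative sums into sums over rows and yields size and
charge. -/
lemma pair_betaSet_vac (μ : YoungDiagram) (w : ℤ → ℤ) :
    pair (betaSet μ) vac w =
      ∑ r ∈ Finset.range (μ.colLen 0), (w (beta μ r) - w (-((r : ℤ) + 1))) := by
  classical
  set N := μ.colLen 0 with hN
  set F : Finset ℤ := (Finset.range N).image (beta μ) with hF
  set F' : Finset ℤ := (Finset.range N).image (fun r : ℕ => -((r : ℤ) + 1)) with hF'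
  have hA : ∀ x : ℤ, -(N : ℤ) ≤ x → (x ∈ betaSet μ ↔ x ∈ F) := by
    intro x hx
    simp only [hF, Finset.mem_image, Finset.mem_range, mem_betaSet]
    constructor
    · rintro ⟨r, rfl⟩
      refine ⟨r, ?_, rfl⟩
      by_contra hc
      rw [beta_of_le (by omega)] at hx
      omega
    · rintro ⟨r, _, rfl⟩; exact ⟨r, rfl⟩
  have hV : ∀ x : ℤ, -(N : ℤ) ≤ x → (x ∈ vac ↔ x ∈ F') := by
    intro x hx
    simp only [hF', Finset.mem_image, Finset.mem_range, vac, Set.mem_ofPred_eq]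
    constructor
    · intro h; exact ⟨(-x - 1).toNat, by omega, by omega⟩
    · rintro ⟨r, _, rfl⟩; omega
  have hsub : ∀ x ∈ F, -(N : ℤ) ≤ x := by
    intro x hx
    simp only [hF, Finset.mem_image, Finset.mem_range] at hx
    obtain ⟨r, hr, rfl⟩ := hx
    unfold beta; omega
  have hsub' : ∀ x ∈ F', -(N : ℤ) ≤ x := by
    intro x hx
    simp only [hF', Finset.mem_image, Finset.mem_range] at hx
    obtain ⟨r, hr, rfl⟩ := hx
    omega
  have hind : ∀ (C : Set ℤ) (G : Finset ℤ), (∀ x : ℤ, -(N : ℤ) ≤ x → (x ∈ C ↔ x ∈ G)) →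
      (∀ x ∈ G, -(N : ℤ) ≤ x) → G ⊆ F ∪ F' →
      ∑ x ∈ F ∪ F', ind C x * w x = ∑ x ∈ G, w x := by
    intro C G h1 h2 h3
    rw [← Finset.sum_subset h3]
    · exact Finset.sum_congr rfl fun x hx => by
        rw [ind_of_mem ((h1 x (h2 x hx)).2 hx), one_mul]
    · intro x hx hxG
      rw [ind_of_notMem, zero_mul]
      rcases Finset.mem_union.1 hx with h | h
      · exact fun h' => hxG ((h1 x (hsub x h)).1 h')
      · exact fun h' => hxG ((h1 x (hsub' x h)).1 h')
  rw [pair_eq_sum (F ∪ F')]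
  · simp only [sub_mul]
    rw [Finset.sum_sub_distrib, hind _ F hA hsub Finset.subset_union_left,
      hind _ F' hV hsub' Finset.subset_union_right, Finset.sum_sub_distrib, hF, hF',
      Finset.sum_image, Finset.sum_image]
    · intro a _ b _ h; simp only at h; omega
    · intro a _ b _ h; exact beta_inj.1 h
  · intro x hx
    simp only [Finset.mem_union, not_or] at hx
    by_cases h : -(N : ℤ) ≤ x
    · rw [ind_of_notMem fun h' => hx.1 ((hA x h).1 h'),
        ind_of_notMem fun h' => hx.2 ((hV x h).1 h')]
      simp
    · rw [ind_of_mem (mem_betaSet_of_lt (by omega)), ind_of_mem (show x ∈ vac from show x < 0 by omega)]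
      simp

lemma card_eq_sum_rowLen (μ : YoungDiagram) :
    μ.card = ∑ r ∈ Finset.range (μ.colLen 0), μ.rowLen r := by
  have h : ∀ x ∈ μ.cells, x.1 ∈ Finset.range (μ.colLen 0) := by
    rintro ⟨r, c⟩ hx
    rw [Finset.mem_range]
    by_contra hc
    have h1 := YoungDiagram.mem_iff_lt_rowLen.1 ((YoungDiagram.mem_cells _).1 hx)
    rw [rowLen_eq_zero (by simpa using hc)] at h1
    omega
  unfold YoungDiagram.card
  rw [Finset.card_eq_sum_card_fiberwise h]
  refine Finset.sum_congr rfl fun r _ => ?_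
  rw [YoungDiagram.rowLen_eq_card]
  rfl

lemma size_betaSet (μ : YoungDiagram) : size (betaSet μ) = μ.card := by
  unfold size
  rw [pair_betaSet_vac, card_eq_sum_rowLen]
  push_cast
  refine Finset.sum_congr rfl fun r _ => ?_
  simp only [id, beta]; ring

lemma charge_betaSet (μ : YoungDiagram) : pair (betaSet μ) vac (fun _ => 1) = 0 := by
  rw [pair_betaSet_vac]; simp

lemma ext_rowLen {μ ν : YoungDiagram} (h : ∀ r, μ.rowLen r = ν.rowLen r) : μ = ν := by
  ext ⟨r, c⟩
  simp only [YoungDiagram.mem_cells, YoungDiagram.mem_iff_lt_rowLen, h]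

lemma betaSet_injective {μ ν : YoungDiagram} (h : betaSet μ = betaSet ν) : μ = ν := by
  have hm : ∀ κ : YoungDiagram, StrictMono fun r => -beta κ r := fun κ a b hab => by
    have := beta_strictAnti κ hab
    simp only; omega
  have hr : ∀ κ : YoungDiagram, Set.range (fun r => -beta κ r) = {x | -x ∈ betaSet κ} := by
    intro κ; ext x
    simp only [Set.mem_range, Set.mem_ofPred_eq, mem_betaSet]
    exact exists_congr fun r => by omega
  have := ((hm μ).range_inj (hm ν)).1 (by rw [hr, hr, h])
  refine ext_rowLen fun r => ?_
  have := congrFun this r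
  simp only [beta] at this
  omega

lemma exists_rowLen_eq (f : ℕ → ℕ) (hf : Antitone f) (N : ℕ) (hN : ∀ r, N ≤ r → f r = 0) :
    ∃ μ : YoungDiagram, ∀ r, μ.rowLen r = f r := by
  classical
  let μ : YoungDiagram :=
    { cells := (Finset.range N ×ˢ Finset.range (f 0)).filter fun p => p.2 < f p.1
      isLowerSet := by
        rintro ⟨a, b⟩ ⟨c, d⟩ hle h
        simp only [Finset.coe_filter, Finset.mem_product, Finset.mem_range,
          Set.mem_ofPred_eq] at h ⊢
        obtain ⟨h1, h2⟩ := Prod.mk_le_mk.1 hle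
        have := hf h1
        omega }
  have hmem : ∀ r c, (r, c) ∈ μ ↔ c < f r := by
    intro r c
    change (r, c) ∈ Finset.filter _ _ ↔ _
    simp only [Finset.mem_filter, Finset.mem_product, Finset.mem_range]
    constructor
    · exact fun h => h.2
    · intro h
      have h1 := hf (Nat.zero_le r)
      refine ⟨⟨?_, by omega⟩, h⟩
      by_contra hc
      have := hN r (by omega)
      omega
  refine ⟨μ, fun r => ?_⟩
  have h1 := fun c => (YoungDiagram.mem_iff_lt_rowLen (μ := μ)).symm.trans (hmem r c)
  have h2 := h1 (f r)
  have h3 := h1 (μ.rowLen r)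
  omega

lemma exists_betaSet_move_succ {ν : YoungDiagram} {b : ℤ} (hb : b ∈ betaSet ν)
    (hb' : b + 1 ∉ betaSet ν) : ∃ μ : YoungDiagram, betaSet μ = move (betaSet ν) b (b + 1) := by
  obtain ⟨i, hi⟩ := mem_betaSet.1 hb
  obtain ⟨μ, hμ⟩ := exists_rowLen_eq (fun r => if r = i then ν.rowLen r + 1 else ν.rowLen r) (by
    refine antitone_nat_of_succ_le fun r => ?_
    have h1 := ν.rowLen_anti r (r + 1) (by omega)
    by_cases h : r + 1 = i
    · subst h
      have h2 : b + 1 ≠ beta ν r := fun h => hb' (h ▸ beta_mem ν r)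
      unfold beta at hi h2
      push_cast at hi
      simp only [if_true, show r ≠ r + 1 by omega, if_false]
      omega
    · simp only [h, if_false]
      split_ifs <;> omega) (max (ν.colLen 0) (i + 1)) (by
    intro r hr
    have := rowLen_eq_zero (μ := ν) (r := r) (by omega)
    have h2 : r ≠ i := by omega
    simp [h2, this])
  refine ⟨μ, ?_⟩
  have hβ : ∀ r, beta μ r = if r = i then b + 1 else beta ν r := by
    intro r
    unfold beta at hi ⊢
    rw [hμ]
    split_ifs with h
    · subst h; push_cast; omega
    · rfl
  ext x
  rw [mem_move, mem_betaSet, mem_betaSet]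
  constructor
  · rintro ⟨r, rfl⟩
    rw [hβ]
    split_ifs with h
    · exact Or.inr rfl
    · exact Or.inl ⟨⟨r, rfl⟩, by rw [hi]; exact fun h' => h (beta_inj.1 h')⟩
  · rintro (⟨⟨r, rfl⟩, h⟩ | rfl)
    · refine ⟨r, ?_⟩
      rw [hβ, if_neg]
      rintro rfl; exact h hi.symm
    · exact ⟨i, by rw [hβ, if_pos rfl]⟩

/-- With charge zero the weight x may be replaced by x + 1/2, which is negative exactly on `vac`, so
every term becomes nonnegative. The weight is doubled to stay in the integers. -/
lemma size_nonneg {A : Set ℤ} (hA : Maya A) (h0 : pair A vac (fun _ => 1) = 0) : 0 ≤ size A := by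
  have h1 : pair A vac (fun x => 2 * id x + 1) = 2 * size A := by
    rw [pair_add hA maya_vac (fun x => 2 * id x), pair_mul hA maya_vac, h0, add_zero]; rfl
  have h2 : 0 ≤ pair A vac (fun x => 2 * id x + 1) := by
    refine pair_nonneg fun x => ?_
    simp only [id]
    by_cases hx : x < 0
    · rw [ind_of_mem (show x ∈ vac from hx)]
      nlinarith [ind_le_one A x]
    · rw [ind_of_notMem (show x ∉ vac from hx)]
      nlinarith [ind_nonneg A x]
  omega

lemma betaSet_bot : betaSet ⊥ = vac := by
  have h : ∀ r, (⊥ : YoungDiagram).rowLen r = 0 := by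
    intro r
    by_contra hc
    exact YoungDiagram.notMem_bot _ (YoungDiagram.mem_iff_lt_rowLen.2 (Nat.pos_of_ne_zero hc))
  ext x
  simp only [mem_betaSet, beta, h, vac, Set.mem_ofPred_eq]
  constructor
  · rintro ⟨r, rfl⟩; push_cast; omega
  · intro hx; exact ⟨(-x - 1).toNat, by push_cast; omega⟩

/-- Induction on the size, removing one box at a time: if some bead can move down by 1, doing so
lowers the size by 1, and `exists_betaSet_move_succ` puts the box back. If none can, A is closed
under subtracting 1 with charge zero, hence is `vac`. -/
lemma exists_betaSet_eq {A : Set ℤ} (hA : Maya A) (h0 : pair A vac (fun _ => 1) = 0) :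
    ∃ μ : YoungDiagram, betaSet μ = A := by
  obtain ⟨k, hk⟩ := Int.eq_ofNat_of_zero_le (size_nonneg hA h0)
  induction k generalizing A with
  | zero =>
    refine ⟨⊥, betaSet_bot.trans ?_⟩
    have hcl : Closed 1 A := by
      intro b hb
      by_contra hb'
      have hm := size_move hA hb hb'
      have := size_nonneg (hA.move (b + 1) b) (by
        rw [pair_trans (hA.move _ _) hA maya_vac, h0, pair_move hb hb']; ring)
      rw [hm, hk] at this
      push_cast at this; omega
    refine Closed.eq_of_equicharged (s := 1) maya_vac hA (fun x hx => ?_) hcl ?_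
    · have : x + 1 < 0 := hx
      exact show x < 0 by omega
    · refine Equicharged.symm fun w hw => ?_
      have : w = fun _ => w 0 * 1 := by
        ext x
        have := periodic_mul hw x 0
        simpa using this
      rw [this, pair_mul hA maya_vac, h0, mul_zero]
  | succ k ih =>
    by_cases hcl : Closed 1 A
    · have : Equicharged 1 A vac := by
        intro w hw
        have : w = fun _ => w 0 * 1 := by
          ext x
          have := periodic_mul hw x 0
          simpa using this
        rw [this, pair_mul hA maya_vac, h0, mul_zero]
      have hAv : A = vac := Closed.eq_of_equicharged hA maya_vac hcl
        (fun x hx => by have : x + 1 < 0 := hx; exact show x < 0 by omega) this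
      exact ⟨⊥, betaSet_bot.trans hAv.symm⟩
    · unfold Closed at hcl
      push Not at hcl
      obtain ⟨b, hb, hb'⟩ := hcl
      have hne : b + 1 ≠ b := by omega
      obtain ⟨ν, hν⟩ := ih (hA.move (b + 1) b) (by
        rw [pair_trans (hA.move _ _) hA maya_vac, h0, pair_move hb hb']; ring) (by
        rw [size_move hA hb hb', hk]; push_cast; ring)
      obtain ⟨μ, hμ⟩ := exists_betaSet_move_succ (ν := ν) (b := b)
        (by rw [hν]; exact Or.inr rfl) (by rw [hν, mem_move]; omega)
      exact ⟨μ, by rw [hμ, hν, move_move hb hb']⟩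

/-- Beads and gaps are the vertical and horizontal steps of the boundary path, and transposing
reverses the path and exchanges the two kinds. If a row r and a column c gave the same position, the
tests c < `rowLen r` and r < `colLen c` for the node (r, c) would disagree. -/
lemma betaSet_transpose (μ : YoungDiagram) (x : ℤ) :
    bar x ∈ betaSet μ.transpose ↔ x ∉ betaSet μ := by
  constructor
  · rintro ⟨c, hc⟩ ⟨r, hr⟩
    rw [YoungDiagram.rowLen_transpose] at hc
    unfold bar at hc
    have h1 : (r, c) ∈ μ ↔ _ := YoungDiagram.mem_iff_lt_rowLen
    have h2 : (r, c) ∈ μ ↔ _ := YoungDiagram.mem_iff_lt_colLen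
    rw [h1] at h2
    omega
  · intro hx
    -- The first row r whose bead lies below the gap x determines the column x + r, whose length is
    -- then exactly r.
    have hex : ∃ r, beta μ r < x := by
      refine ⟨max (μ.colLen 0) (-x).toNat, ?_⟩
      rw [beta_of_le (le_max_left _ _)]
      push_cast
      omega
    classical
    have h1 := Nat.find_spec hex
    have h2 : ∀ m < Nat.find hex, x < beta μ m := fun m hm => by
      have h3 := Nat.find_min hex hm
      have h4 : x ≠ beta μ m := fun h => hx ⟨m, h⟩
      omega
    set r := Nat.find hex
    have hc0 : 0 ≤ x + r := by unfold beta at h1; omega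
    refine ⟨(x + r).toNat, ?_⟩
    rw [YoungDiagram.rowLen_transpose]
    have h3 : (r, (x + r).toNat) ∉ μ := by
      rw [YoungDiagram.mem_iff_lt_rowLen]
      unfold beta at h1; omega
    rw [YoungDiagram.mem_iff_lt_colLen] at h3
    have h5 : r ≤ μ.colLen (x + r).toNat := by
      rcases Nat.eq_zero_or_pos r with h0 | h0
      · omega
      · have h6 := h2 (r - 1) (by omega)
        have h7 : (r - 1, (x + r).toNat) ∈ μ := by
          rw [YoungDiagram.mem_iff_lt_rowLen]
          unfold beta at h6; omega
        rw [YoungDiagram.mem_iff_lt_colLen] at h7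
        omega
    unfold bar
    omega

lemma isSelfConjugate_iff {μ : YoungDiagram} : IsSelfConjugate μ ↔ Anti (betaSet μ) := by
  constructor
  · intro h x
    have := betaSet_transpose μ x
    rwa [h] at this
  · intro h
    refine betaSet_injective (Set.ext fun x => ?_)
    rw [← bar_bar x, betaSet_transpose, h, not_not, bar_bar]

/-! ### Rim hooks as moves of one bead. -/

lemma hasse_nat_adj_iff {x y : ℕ × ℕ} : (SimpleGraph.hasse (ℕ × ℕ)).Adj x y ↔
    (x.1 = y.1 ∧ (x.2 + 1 = y.2 ∨ y.2 + 1 = x.2)) ∨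
      (x.2 = y.2 ∧ (x.1 + 1 = y.1 ∨ y.1 + 1 = x.1)) := by
  rw [SimpleGraph.hasse_prod, SimpleGraph.boxProd_adj]
  simp only [SimpleGraph.hasse_adj, Nat.covBy_iff_add_one_eq]
  tauto

lemma mem_skew {μ ν : YoungDiagram} {x : ℕ × ℕ} :
    x ∈ (↑(μ.cells \ ν.cells) : Set (ℕ × ℕ)) ↔ ν.rowLen x.1 ≤ x.2 ∧ x.2 < μ.rowLen x.1 := by
  obtain ⟨r, c⟩ := x
  simp only [Finset.coe_sdiff, Set.mem_sdiff, Finset.mem_coe, YoungDiagram.mem_cells,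
    YoungDiagram.mem_iff_lt_rowLen]
  omega

lemma mem_rim {μ : YoungDiagram} {x : ℕ × ℕ} :
    x ∈ rim μ ↔ x.2 < μ.rowLen x.1 ∧ μ.rowLen (x.1 + 1) ≤ x.2 + 1 := by
  obtain ⟨r, c⟩ := x
  simp only [rim, Set.mem_ofPred_eq, YoungDiagram.mem_iff_lt_rowLen]
  omega

lemma le_iff_rowLen {μ ν : YoungDiagram} : ν ≤ μ ↔ ∀ r, ν.rowLen r ≤ μ.rowLen r := by
  constructor
  · intro h r
    by_contra hc
    have h1 : (r, μ.rowLen r) ∈ ν := YoungDiagram.mem_iff_lt_rowLen.2 (by omega)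
    have h2 := YoungDiagram.mem_iff_lt_rowLen.1 (h h1)
    omega
  · rintro h ⟨r, c⟩ hx
    have hx' : (r, c) ∈ ν := hx
    rw [YoungDiagram.mem_iff_lt_rowLen] at hx'
    have h1 : (r, c) ∈ μ := YoungDiagram.mem_iff_lt_rowLen.2 (hx'.trans_le (h r))
    exact h1

lemma card_skew {μ ν : YoungDiagram} (h : ν ≤ μ) :
    ((μ.cells \ ν.cells).card : ℤ) = μ.card - ν.card := by
  have h1 : ν.cells ⊆ μ.cells := YoungDiagram.cells_subset_iff.2 h
  rw [Finset.card_sdiff_of_subset h1, Nat.cast_sub (Finset.card_le_card h1)]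

/-- Consecutive nonempty rows of a connected skew diagram overlap. -/
lemma exists_crossing {μ ν : YoungDiagram} {k : ℕ} {x y : ℕ × ℕ}
    (hconn : ((SimpleGraph.hasse (ℕ × ℕ)).induce
      (↑(μ.cells \ ν.cells) : Set (ℕ × ℕ))).Connected)
    (hx : x ∈ (↑(μ.cells \ ν.cells) : Set (ℕ × ℕ)))
    (hy : y ∈ (↑(μ.cells \ ν.cells) : Set (ℕ × ℕ)))
    (hxk : x.1 ≤ k) (hyk : k < y.1) :
    ∃ c, (k, c) ∈ (↑(μ.cells \ ν.cells) : Set (ℕ × ℕ)) ∧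
      (k + 1, c) ∈ (↑(μ.cells \ ν.cells) : Set (ℕ × ℕ)) := by
  obtain ⟨p⟩ := hconn.preconnected ⟨x, hx⟩ ⟨y, hy⟩
  obtain ⟨d, -, hd1, hd2⟩ := p.exists_boundary_dart {z | z.1.1 ≤ k} hxk
    (fun h => by simp only [Set.mem_ofPred_eq] at h; omega)
  obtain ⟨⟨⟨⟨a, b⟩, hab⟩, ⟨⟨a', b'⟩, hab'⟩⟩, hadj⟩ := d
  have := hasse_nat_adj_iff.1 (SimpleGraph.induce_adj.1 hadj)
  simp only [Set.mem_ofPred_eq] at hd1 hd2 this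
  obtain rfl : a = k := by omega
  obtain rfl : a' = a + 1 := by omega
  obtain rfl : b = b' := by omega
  exact ⟨b, hab, hab'⟩

/-- Let i and j be the first and last rows meeting the hook. Between them the beads are renumbered,
bead r of `ν` being bead r + 1 of `μ`. So only bead i of `μ` disappears and bead j of `ν` is new;
comparing sizes shows that they differ by s. -/
lemma betaSet_of_removesRimHook {s : ℕ} (hs : 0 < s) {μ ν : YoungDiagram}
    (h : RemovesRimHook s μ ν) :
    ∃ b, b ∈ betaSet μ ∧ b - s ∉ betaSet μ ∧ betaSet ν = move (betaSet μ) b (b - s) := by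
  classical
  obtain ⟨hle, hrim, hconn, hcard⟩ := h
  have hle' := le_iff_rowLen.1 hle
  have hne : ∃ r, ν.rowLen r < μ.rowLen r := by
    have : (μ.cells \ ν.cells).Nonempty := by rw [← Finset.card_pos]; omega
    obtain ⟨x, hx⟩ := this
    have := mem_skew.1 (Finset.mem_coe.2 hx)
    exact ⟨x.1, by omega⟩
  set i := Nat.find hne with hi
  have hi1 := Nat.find_spec hne
  have hi2 : ∀ r < i, ν.rowLen r = μ.rowLen r := fun r hr => by
    have := Nat.find_min hne hr
    have := hle' r
    omega
  have hbd : ∀ r, ν.rowLen r < μ.rowLen r → r ≤ μ.colLen 0 := fun r hr => by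
    by_contra hc
    rw [rowLen_eq_zero (μ := μ) (by omega)] at hr
    omega
  set j := Nat.findGreatest (fun r => ν.rowLen r < μ.rowLen r) (μ.colLen 0) with hj
  have hj1 : ν.rowLen j < μ.rowLen j :=
    Nat.findGreatest_spec (P := fun r => ν.rowLen r < μ.rowLen r) (hbd _ hi1) hi1
  have hj2 : ∀ r, j < r → ν.rowLen r = μ.rowLen r := fun r hr => by
    have h1 := hle' r
    by_contra hc
    have h2 : ν.rowLen r < μ.rowLen r := by omega
    have := Nat.le_findGreatest (P := fun r => ν.rowLen r < μ.rowLen r) (hbd r h2) h2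
    omega
  have hij : i ≤ j := by
    by_contra hc
    have := hi2 j (by omega)
    omega
  -- Connectedness makes consecutive rows overlap, giving one inequality; the rim condition at the
  -- first removed node of row r gives the other.
  have hmid : ∀ r, i ≤ r → r < j → μ.rowLen (r + 1) = ν.rowLen r + 1 := by
    intro r hr1 hr2
    obtain ⟨c, hc1, hc2⟩ := exists_crossing (k := r) (x := (i, _)) (y := (j, _)) hconn
      (mem_skew.2 ⟨le_refl (ν.rowLen i), hi1⟩) (mem_skew.2 ⟨le_refl (ν.rowLen j), hj1⟩) hr1 hr2
    have h1 := mem_skew.1 hc1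
    have h2 := mem_skew.1 hc2
    simp only at h1 h2
    have h4 : (r, ν.rowLen r) ∈ (↑(μ.cells \ ν.cells) : Set (ℕ × ℕ)) :=
      mem_skew.2 ⟨le_rfl, by simp only; omega⟩
    have h3 := (mem_rim.1 (hrim h4)).2
    simp only at h3
    omega
  have hb0 : ∀ r, r < i ∨ j < r → beta ν r = beta μ r := by
    rintro r (hr | hr)
    · simp only [beta, hi2 r hr]
    · simp only [beta, hj2 r hr]
  have hb1 : ∀ r, i ≤ r → r < j → beta ν r = beta μ (r + 1) := by
    intro r h1 h2
    simp only [beta, hmid r h1 h2]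
    push_cast; ring
  have hjlt : beta ν j < beta μ j := by unfold beta; omega
  have hnot : beta ν j ∉ betaSet μ := by
    rintro ⟨r, hr⟩
    change _ = beta μ r at hr
    rcases le_or_gt r j with h | h
    · have := (beta_strictAnti μ).antitone h
      omega
    · rw [← hb0 r (Or.inr h), beta_inj] at hr
      omega
  have hset : betaSet ν = move (betaSet μ) (beta μ i) (beta ν j) := by
    ext x
    rw [mem_move, mem_betaSet, mem_betaSet]
    constructor
    · rintro ⟨r, rfl⟩
      rcases Nat.lt_or_ge r i with h | h
      · left
        rw [hb0 r (Or.inl h)]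
        exact ⟨⟨r, rfl⟩, fun h' => by rw [beta_inj] at h'; omega⟩
      · rcases lt_trichotomy r j with h' | h' | h'
        · left
          rw [hb1 r h h']
          exact ⟨⟨r + 1, rfl⟩, fun h' => by rw [beta_inj] at h'; omega⟩
        · right; rw [h']
        · left
          rw [hb0 r (Or.inr h')]
          exact ⟨⟨r, rfl⟩, fun h' => by rw [beta_inj] at h'; omega⟩
    · rintro (⟨⟨r, rfl⟩, h⟩ | rfl)
      · rw [Ne, beta_inj] at h
        by_cases h1 : r < i ∨ j < r
        · exact ⟨r, (hb0 r h1).symm⟩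
        · refine ⟨r - 1, ?_⟩
          rw [hb1 (r - 1) (by omega) (by omega), Nat.sub_add_cancel (by omega)]
      · exact ⟨j, rfl⟩
  have hsz := size_move (maya_betaSet μ) (beta_mem μ i) hnot
  rw [← hset, size_betaSet, size_betaSet] at hsz
  have hcs := card_skew hle
  have hval : beta ν j = beta μ i - s := by
    have : (s : ℤ) = ((μ.cells \ ν.cells).card : ℤ) := by rw [hcard]
    omega
  exact ⟨beta μ i, beta_mem μ i, hval ▸ hnot, hval ▸ hset⟩

/-- The new partition is dictated by sorting the beads after the move: b is bead i, the gap b - s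
falls between beads j and j + 1, and the beads in between move up one place in the numbering. Each
removed row is connected to its first node, which is linked to the row above through the last
removed node of its own row. -/
lemma removesRimHook_of_betaSet {s : ℕ} (hs : 0 < s) {μ : YoungDiagram} {b : ℤ}
    (hb : b ∈ betaSet μ) (hb' : b - s ∉ betaSet μ) : ∃ ν, RemovesRimHook s μ ν := by
  classical
  obtain ⟨i, hi⟩ := mem_betaSet.1 hb
  have hex : ∃ r, beta μ r < b - s := by
    refine ⟨max (μ.colLen 0) (-(b - s)).toNat, ?_⟩
    rw [beta_of_le (le_max_left _ _)]
    push_cast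
    omega
  obtain ⟨j, hj1, hj2⟩ : ∃ j, beta μ (j + 1) < b - s ∧ ∀ r ≤ j, b - s < beta μ r := by
    have h1 := Nat.find_spec hex
    have h2 : ∀ r < Nat.find hex, b - s < beta μ r := fun r hr => by
      have h3 := Nat.find_min hex hr
      have h4 : b - s ≠ beta μ r := fun h => hb' ⟨r, h⟩
      omega
    have h0 : Nat.find hex ≠ 0 := by
      intro h0
      rw [h0] at h1
      have := (beta_strictAnti μ).antitone (Nat.zero_le i)
      omega
    refine ⟨Nat.find hex - 1, ?_, fun r hr => h2 r (by omega)⟩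
    rwa [Nat.sub_add_cancel (by omega)]
  have hij : i ≤ j := by
    by_contra hc
    have := (beta_strictAnti μ).antitone (show j + 1 ≤ i by omega)
    omega
  have hlow : -(μ.colLen 0 : ℤ) ≤ b - s := by
    by_contra hc
    exact hb' (mem_betaSet_of_lt (by omega))
  have hpos : ∀ r ≤ j, 1 ≤ μ.rowLen r := by
    intro r hr
    by_contra hc
    have h1 := hj2 r hr
    refine hb' (mem_betaSet.2 ⟨(-(b - s) - 1).toNat, ?_⟩)
    unfold beta at h1 ⊢
    have h2 := μ.rowLen_anti r (-(b - s) - 1).toNat (by omega)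
    omega
  set f : ℕ → ℕ := fun r => if r < i then μ.rowLen r else if r < j then μ.rowLen (r + 1) - 1 else
    if r = j then (b - s + j + 1).toNat else μ.rowLen r with hf
  have hj1' := hj1
  have hi' := hi
  unfold beta at hj1' hi'
  push_cast at hj1'
  obtain ⟨ν, hν⟩ := exists_rowLen_eq f (by
    refine antitone_nat_of_succ_le fun r => ?_
    have h1 := μ.rowLen_anti r (r + 1) (by omega)
    have h2 := μ.rowLen_anti (r + 1) (r + 1 + 1) (by omega)
    simp only [hf]
    rcases lt_trichotomy r j with h | h | h
    · have h3 := hj2 (r + 1) (by omega)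
      have h4 := hj2 r (by omega)
      unfold beta at h3 h4
      push_cast at h3 h4
      have h5 := hpos (r + 1) (by omega)
      have h6 : r + 1 = j → r + 1 + 1 = j + 1 := by omega
      by_cases h7 : r + 1 = i
      · subst h7
        split_ifs <;> omega
      · split_ifs <;> omega
    · subst h
      split_ifs <;> omega
    · split_ifs <;> omega) (max (μ.colLen 0) (j + 1)) (by
    intro r hr
    have := rowLen_eq_zero (μ := μ) (r := r) (by omega)
    simp only [hf]
    split_ifs <;> omega)
  have hfj : f j = (b - s + j + 1).toNat := by
    simp only [hf]; rw [if_neg (by omega), if_neg (by omega)]; simp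
  have hfm : ∀ r, i ≤ r → r < j → f r = μ.rowLen (r + 1) - 1 := by
    intro r h1 h2
    simp only [hf]; rw [if_neg (by omega), if_pos h2]
  have hfo : ∀ r, r < i ∨ j < r → f r = μ.rowLen r := by
    intro r h
    simp only [hf]
    split_ifs <;> first | rfl | omega
  have hβj : beta ν j = b - s := by
    unfold beta; rw [hν, hfj]; omega
  have hβm : ∀ r, i ≤ r → r < j → beta ν r = beta μ (r + 1) := by
    intro r h1 h2
    have := hpos (r + 1) (by omega)
    unfold beta; rw [hν, hfm r h1 h2]; push_cast; omega
  have hβo : ∀ r, r < i ∨ j < r → beta ν r = beta μ r := by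
    intro r h
    unfold beta; rw [hν, hfo r h]
  have hle' : ∀ r, ν.rowLen r ≤ μ.rowLen r := by
    intro r
    have h1 := μ.rowLen_anti r (r + 1) (by omega)
    rw [hν]
    by_cases h : r < i ∨ j < r
    · rw [hfo r h]
    · rcases Nat.lt_or_ge r j with h' | h'
      · rw [hfm r (by omega) h']; omega
      · obtain rfl : r = j := by omega
        have := hj2 r le_rfl
        unfold beta at this
        rw [hfj]; omega
  have hle : ν ≤ μ := le_iff_rowLen.2 hle'
  have hset : betaSet ν = move (betaSet μ) b (b - s) := by
    ext x
    rw [mem_move, mem_betaSet, mem_betaSet]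
    constructor
    · rintro ⟨r, rfl⟩
      rw [hi]
      by_cases h : r < i ∨ j < r
      · left
        rw [hβo r h]
        exact ⟨⟨r, rfl⟩, fun h' => by rw [beta_inj] at h'; omega⟩
      · rcases Nat.lt_or_ge r j with h' | h'
        · left
          rw [hβm r (by omega) h']
          exact ⟨⟨r + 1, rfl⟩, fun h' => by rw [beta_inj] at h'; omega⟩
        · right
          obtain rfl : r = j := by omega
          rw [hβj, hi]
    · rintro (⟨⟨r, rfl⟩, h⟩ | rfl)
      · rw [hi, Ne, beta_inj] at h
        by_cases h1 : r < i ∨ j < r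
        · exact ⟨r, (hβo r h1).symm⟩
        · refine ⟨r - 1, ?_⟩
          rw [hβm (r - 1) (by omega) (by omega), Nat.sub_add_cancel (by omega)]
      · exact ⟨j, hβj.symm⟩
  have hcard : (μ.cells \ ν.cells).card = s := by
    have h1 := card_skew hle
    have h2 := size_move (maya_betaSet μ) hb hb'
    rw [← hset, size_betaSet, size_betaSet] at h2
    omega
  have hrow : ∀ x ∈ (↑(μ.cells \ ν.cells) : Set (ℕ × ℕ)), i ≤ x.1 ∧ x.1 ≤ j := by
    intro x hx
    have h1 := mem_skew.1 hx
    by_contra hc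
    rw [hν, hfo x.1 (by omega)] at h1
    omega
  have hnext : ∀ r, i ≤ r → r ≤ j → μ.rowLen (r + 1) ≤ f r + 1 := by
    intro r h1 h2
    rcases Nat.lt_or_ge r j with h' | h'
    · rw [hfm r h1 h']; omega
    · obtain rfl : r = j := by omega
      rw [hfj]; omega
  refine ⟨ν, hle, ?_, ?_, hcard⟩
  · intro x hx
    obtain ⟨h1, h2⟩ := mem_skew.1 hx
    obtain ⟨h3, h4⟩ := hrow x hx
    have h5 := hnext x.1 h3 h4
    rw [hν] at h1
    exact mem_rim.2 ⟨h2, by omega⟩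
  · set S : Set (ℕ × ℕ) := (↑(μ.cells \ ν.cells) : Set (ℕ × ℕ)) with hS
    have hlt : ∀ r, i ≤ r → r ≤ j → ν.rowLen r < μ.rowLen r := by
      intro r h1 h2
      have h3 := μ.rowLen_anti r (r + 1) (by omega)
      have h4 := hpos r h2
      rw [hν]
      rcases Nat.lt_or_ge r j with h' | h'
      · rw [hfm r h1 h']; omega
      · obtain rfl : r = j := by omega
        have := hj2 r le_rfl
        unfold beta at this
        rw [hfj]; omega
    have hstart : ∀ r, i ≤ r → r ≤ j → (r, ν.rowLen r) ∈ S := fun r h1 h2 =>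
      mem_skew.2 ⟨le_rfl, hlt r h1 h2⟩
    have hrowc : ∀ r k, ∀ (h0 : (r, ν.rowLen r) ∈ S) (h : (r, ν.rowLen r + k) ∈ S),
        ((SimpleGraph.hasse (ℕ × ℕ)).induce S).Reachable ⟨_, h⟩ ⟨_, h0⟩ := by
      intro r k h0
      induction k with
      | zero => intro h; exact SimpleGraph.Reachable.refl _
      | succ k ih =>
        intro h
        have h' : (r, ν.rowLen r + k) ∈ S := by
          have := mem_skew.1 h
          exact mem_skew.2 (by simp only at this ⊢; omega)
        refine SimpleGraph.Reachable.trans (SimpleGraph.Adj.reachable ?_) (ih h')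
        exact SimpleGraph.induce_adj.2 (hasse_nat_adj_iff.2 (Or.inl ⟨rfl, Or.inr rfl⟩))
    have hall : ∀ k, ∀ (h0 : (i, ν.rowLen i) ∈ S) (h : (i + k, ν.rowLen (i + k)) ∈ S),
        ((SimpleGraph.hasse (ℕ × ℕ)).induce S).Reachable ⟨_, h⟩ ⟨_, h0⟩ := by
      intro k h0
      induction k with
      | zero => intro h; exact SimpleGraph.Reachable.refl _
      | succ k ih =>
        intro h
        have h1 := (hrow _ h).2
        simp only at h1
        have h2 := hstart (i + k) (by omega) (by omega)
        have h3 : ν.rowLen (i + k) + 1 = μ.rowLen (i + (k + 1)) := by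
          have := hpos (i + k + 1) (by omega)
          rw [hν, hfm (i + k) (by omega) (by omega), ← add_assoc]
          omega
        have h4 := hlt (i + (k + 1)) (by omega) (by omega)
        have h5 : (i + (k + 1), ν.rowLen (i + (k + 1)) +
            (μ.rowLen (i + (k + 1)) - 1 - ν.rowLen (i + (k + 1)))) ∈ S :=
          mem_skew.2 (by simp only; omega)
        refine ((hrowc _ _ h h5).symm.trans (SimpleGraph.Adj.reachable ?_)).trans (ih h2)
        exact SimpleGraph.induce_adj.2 (hasse_nat_adj_iff.2
          (Or.inr ⟨by simp only; omega, Or.inr rfl⟩))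
    have h0 := hstart i le_rfl hij
    have hreach : ∀ x (hx : x ∈ S),
        ((SimpleGraph.hasse (ℕ × ℕ)).induce S).Reachable ⟨x, hx⟩ ⟨_, h0⟩ := by
      rintro ⟨r, c⟩ hx
      obtain ⟨h1, h2⟩ := hrow _ hx
      simp only at h1 h2
      obtain ⟨k, rfl⟩ := Nat.exists_eq_add_of_le h1
      obtain ⟨l, hl⟩ := Nat.exists_eq_add_of_le (mem_skew.1 hx).1
      simp only at hl
      subst hl
      exact (hrowc _ l (hstart _ h1 h2) hx).trans (hall k h0 _)
    have : Nonempty S := ⟨⟨_, h0⟩⟩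
    exact SimpleGraph.Connected.mk fun x y => (hreach x.1 x.2).trans (hreach y.1 y.2).symm

lemma isCore_iff {s : ℕ} (hs : 0 < s) {μ : YoungDiagram} :
    IsCore s μ ↔ Closed s (betaSet μ) := by
  constructor
  · intro h x hx
    by_contra hc
    obtain ⟨ν, hν⟩ := removesRimHook_of_betaSet hs hx (by rwa [add_sub_cancel_right])
    exact h ν hν
  · intro h ν hν
    obtain ⟨b, hb, hb', -⟩ := betaSet_of_removesRimHook hs hν
    exact hb' (h _ (by rwa [sub_add_cancel]))

lemma equicharged_of_removesRimHook {s : ℕ} (hs : 0 < s) {μ ν : YoungDiagram}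
    (h : RemovesRimHook s μ ν) : Equicharged s (betaSet ν) (betaSet μ) := by
  obtain ⟨b, hb, hb', h⟩ := betaSet_of_removesRimHook hs h
  rw [h]
  exact equicharged_move hb hb' ⟨-1, by ring⟩

lemma equicharged_of_reflTransGen {s : ℕ} (hs : 0 < s) {μ ν : YoungDiagram}
    (h : Relation.ReflTransGen (RemovesRimHook s) μ ν) :
    Equicharged s (betaSet μ) (betaSet ν) := by
  induction h with
  | refl => exact Equicharged.refl _ _
  | tail _ h ih =>
    exact ih.trans (maya_betaSet _) (maya_betaSet _) (maya_betaSet _)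
      (equicharged_of_removesRimHook hs h).symm

lemma card_of_removesRimHook {s : ℕ} {μ ν : YoungDiagram} (h : RemovesRimHook s μ ν) :
    ν.card + s = μ.card := by
  have h1 := card_skew h.1
  rw [h.2.2.2] at h1
  omega

lemma exists_hasCore {s : ℕ} (hs : 0 < s) (μ : YoungDiagram) : ∃ σ, HasCore s μ σ := by
  induction h : μ.card using Nat.strong_induction_on generalizing μ with
  | _ n ih =>
    by_cases hc : IsCore s μ
    · exact ⟨μ, Relation.ReflTransGen.refl, hc⟩
    · unfold IsCore at hc
      push Not at hc
      obtain ⟨ν, hν⟩ := hc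
      have := card_of_removesRimHook hν
      obtain ⟨σ, h1, h2⟩ := ih ν.card (by omega) ν rfl
      exact ⟨σ, Relation.ReflTransGen.head hν h1, h2⟩

/-- Hook removal preserves charges and some core is always reached, while a core is determined by
its charges. So the order of removals is irrelevant. -/
lemma hasCore_iff {s : ℕ} (hs : 0 < s) {μ σ : YoungDiagram} (hσ : IsCore s σ) :
    HasCore s μ σ ↔ Equicharged s (betaSet μ) (betaSet σ) := by
  constructor
  · exact fun h => equicharged_of_reflTransGen hs h.1
  · intro h
    obtain ⟨ρ, h1, h2⟩ := exists_hasCore hs μ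
    have h3 := equicharged_of_reflTransGen hs h1
    have : ρ = σ := betaSet_injective (Closed.eq_of_equicharged (maya_betaSet _) (maya_betaSet _)
      ((isCore_iff hs).1 h2) ((isCore_iff hs).1 hσ)
      (h3.symm.trans (maya_betaSet _) (maya_betaSet _) (maya_betaSet _) h))
    exact this ▸ ⟨h1, h2⟩

/-! ### Reduction to sets of integers. -/

/-- `A` is the beta-set of a self-conjugate partition of size `n` whose `s`-core and `t`-core have
beta-sets `S` and `T`. -/
structure IsSolution (s t : ℤ) (S T : Set ℤ) (n : ℤ) (A : Set ℤ) : Prop where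
  maya : Maya A
  anti : Anti A
  equi_s : Equicharged s A S
  equi_t : Equicharged t A T
  size_eq : size A = n

lemma IsSolution.swap {s t : ℤ} {S T : Set ℤ} {n : ℤ} {A : Set ℤ} (h : IsSolution s t S T n A) :
    IsSolution t s T S n A := ⟨h.maya, h.anti, h.equi_t, h.equi_s, h.size_eq⟩

lemma Anti.charge {A : Set ℤ} (h : Anti A) : pair A vac (fun _ => 1) = 0 := by
  have := pair_comp_bar h anti_vac (fun _ => 1)
  simp only at this
  omega

lemma existsUnique_iff {s t : ℕ} (hs : 0 < s) (ht : 0 < t) {σ τ : YoungDiagram}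
    (hσ : IsCore s σ) (hτ : IsCore t τ) (n : ℕ) :
    (∃! μ : YoungDiagram, μ ∈ partitionsWithCores s t n σ τ ∧ IsSelfConjugate μ) ↔
      ∃! A : Set ℤ, IsSolution s t (betaSet σ) (betaSet τ) n A := by
  have key : ∀ μ : YoungDiagram, (μ ∈ partitionsWithCores s t n σ τ ∧ IsSelfConjugate μ) ↔
      IsSolution s t (betaSet σ) (betaSet τ) n (betaSet μ) := by
    intro μ
    rw [isSelfConjugate_iff]
    constructor
    · rintro ⟨⟨h1, h2, h3⟩, h4⟩
      exact ⟨maya_betaSet μ, h4, (hasCore_iff hs hσ).1 h2, (hasCore_iff ht hτ).1 h3, by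
        rw [size_betaSet, h1]⟩
    · rintro ⟨-, h4, h2, h3, h1⟩
      rw [size_betaSet] at h1
      exact ⟨⟨by exact_mod_cast h1, (hasCore_iff hs hσ).2 h2, (hasCore_iff ht hτ).2 h3⟩, h4⟩
  constructor
  · rintro ⟨μ, h1, h2⟩
    refine ⟨betaSet μ, (key μ).1 h1, fun A hA => ?_⟩
    obtain ⟨ν, rfl⟩ := exists_betaSet_eq hA.maya hA.anti.charge
    rw [h2 ν ((key ν).2 hA)]
  · rintro ⟨A, h1, h2⟩
    obtain ⟨μ, rfl⟩ := exists_betaSet_eq h1.maya h1.anti.charge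
    exact ⟨μ, (key μ).2 h1, fun ν hν => betaSet_injective (h2 _ ((key ν).1 hν))⟩

/-- The reflected complement of S is again closed and, since A is its own reflected complement, has
the charges of A. Hence it equals S: cores of self-conjugate partitions are self-conjugate. -/
lemma Closed.anti {s : ℤ} {A S : Set ℤ} (hA : Maya A) (aA : Anti A) (hS : Maya S)
    (cS : Closed s S) (h : Equicharged s A S) : Anti S := by
  set S' : Set ℤ := {x | bar x ∉ S} with hS'
  have mS' : Maya S' := by
    obtain ⟨N, h1, h2⟩ := hS
    refine ⟨N + 1, fun x hx => ?_, fun x hx hc => ?_⟩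
    · exact h2 _ (by unfold bar; omega)
    · exact hc (h1 _ (by unfold bar; omega))
  have cS' : Closed s S' := by
    intro x hx hc
    refine hx (cS _ ?_)
    rwa [show bar (x + s) + s = bar x by unfold bar; ring]
  have eS' : Equicharged s A S' := by
    intro w hw
    have h1 : pair A S' w = pair S A (fun x => w (bar x)) := by
      unfold pair
      rw [← finsum_comp_equiv barEquiv]
      refine finsum_congr fun x => ?_
      change (ind A (bar x) - ind S' (bar x)) * w (bar x) = _
      have e1 : ind A (bar x) = 1 - ind A x := by
        by_cases h : x ∈ A
        · rw [ind_of_mem h, ind_of_notMem fun h' => (aA x).1 h' h]; ring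
        · rw [ind_of_notMem h, ind_of_mem ((aA x).2 h)]; ring
      have e2 : ind S' (bar x) = 1 - ind S x := by
        by_cases h : x ∈ S
        · rw [ind_of_mem h, ind_of_notMem (A := S')
          fun h' : bar (bar x) ∉ S => h' (by rwa [bar_bar])]; ring
        · rw [ind_of_notMem h, ind_of_mem (show bar (bar x) ∉ S by rwa [bar_bar])]; ring
      rw [e1, e2]; ring
    rw [h1]
    refine h.symm _ fun x => ?_
    rw [← hw (bar (x + s)), show bar (x + s) + s = bar x by unfold bar; ring]
  have hSS := Closed.eq_of_equicharged mS' hS cS' cS (eS'.symm.trans mS' hA hS h)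
  intro x
  conv_lhs => rw [← hSS]
  change bar (bar x) ∉ S ↔ _
  rw [bar_bar]

/-! ### Rectangle exchanges, ascents and descents. -/

/-- The set obtained from `A` by replacing `b` with `c` and `bar c` with `bar b`. -/
def symMove (A : Set ℤ) (b c : ℤ) : Set ℤ := move (move A b c) (bar c) (bar b)

lemma bar_inj {x y : ℤ} : bar x = bar y ↔ x = y := by unfold bar; omega

lemma Anti.bar_mem {A : Set ℤ} (h : Anti A) {x : ℤ} (hx : x ∉ A) : bar x ∈ A := (h x).2 hx

lemma Anti.bar_notMem {A : Set ℤ} (h : Anti A) {x : ℤ} (hx : x ∈ A) : bar x ∉ A :=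
  fun h' => (h x).1 h' hx

lemma Anti.symMove {A : Set ℤ} (h : Anti A) {b c : ℤ} (hb : b ∈ A) (hc : c ∉ A) :
    Anti (symMove A b c) := by
  intro x
  have hbc : b ≠ c := fun h => hc (h ▸ hb)
  have e1 : bar x = b ↔ x = bar b := by unfold bar; omega
  have e2 : bar x = c ↔ x = bar c := by unfold bar; omega
  have h1 := h.bar_notMem hb
  have h2 := h.bar_mem hc
  have h3 : b ≠ bar b := by unfold bar; omega
  have h4 : c ≠ bar c := by unfold bar; omega
  simp only [CorePartitions.symMove, mem_move, h x, Ne, bar_inj, e1, e2]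
  by_cases x1 : x = b
  · subst x1; simp [hbc, h3, hb]
  · by_cases x2 : x = c
    · subst x2; simp [h4, hc, x1]
    · by_cases x3 : x = bar b
      · subst x3; simp [h1, bar_inj, hbc, x1]
      · by_cases x4 : x = bar c
        · subst x4; simp [h2, bar_inj, x1, x2, Ne.symm hbc]
        · simp [x1, x2, x3, x4]

lemma Maya.symMove {A : Set ℤ} (h : Maya A) (b c : ℤ) : Maya (symMove A b c) :=
  (h.move b c).move _ _

lemma pair_symMove {A : Set ℤ} (hA : Maya A) (aA : Anti A) {b c : ℤ} (hb : b ∈ A) (hc : c ∉ A)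
    (hbc : c ≠ bar b) (w : ℤ → ℤ) :
    pair (symMove A b c) A w = w c - w b + w (bar b) - w (bar c) := by
  unfold symMove
  rw [pair_trans ((hA.move b c).move _ _) (hA.move b c) hA, pair_move hb hc, pair_move]
  · ring
  · refine mem_move.2 (Or.inl ⟨aA.bar_mem hc, fun h => hbc ?_⟩)
    rw [← h, bar_bar]
  · rw [mem_move, not_or]
    exact ⟨fun h => aA.bar_notMem hb h.1, hbc.symm⟩

/-- The rectangle exchange forced on a unique solution. -/
lemma rect_of_unique {s t : ℤ} {S T : Set ℤ} {n : ℤ} {A : Set ℤ} (hA : IsSolution s t S T n A)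
    (hS : Maya S) (hT : Maya T) (huniq : ∀ A', IsSolution s t S T n A' → A' = A) (b p q : ℤ)
    (h1 : b ∈ A) (h2 : b + s * p ∉ A) (h3 : b + t * q ∉ A) (h4 : b + s * p + t * q ∈ A) :
    s * p = t * q ∨ s * p + t * q = 0 ∨ 2 * b + 1 = -(s * p) ∨ 2 * b + 1 = -(t * q) ∨
      2 * (b + s * p) + 1 = -(t * q) ∨ 2 * (b + t * q) + 1 = -(s * p) := by
  by_contra hc
  simp only [not_or] at hc
  obtain ⟨c1, c2, c3, c4, c5, c6⟩ := hc
  -- The exchange is done along the two sides parallel to s, each with its mirror image; read along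
  -- the other two sides it also preserves classes modulo t, and the two displacements cancel in the
  -- size. The excluded equalities are coincidences of opposite corners and mirror symmetries
  -- between adjacent ones. Opposite corners are both in or both out of A, so they are never mirror
  -- images.
  set A1 := symMove A b (b + s * p) with hA1
  have m1 : Maya A1 := hA.maya.symMove _ _
  have a1 : Anti A1 := hA.anti.symMove h1 h2
  have k1 : b + s * p + t * q ∈ A1 := by
    simp only [hA1, symMove, mem_move]
    refine Or.inl ⟨Or.inl ⟨h4, by omega⟩, ?_⟩
    unfold bar; omega
  have k2 : b + t * q ∉ A1 := by
    simp only [hA1, symMove, mem_move, not_or, not_and_or]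
    refine ⟨Or.inl ⟨Or.inl h3, by omega⟩, ?_⟩
    unfold bar; omega
  have d1 := fun w => pair_symMove hA.maya hA.anti h1 h2 (by unfold bar; omega) w
  have d2 := fun w => pair_symMove m1 a1 k1 k2 (by unfold bar; omega) w
  set A2 := symMove A1 (b + s * p + t * q) (b + t * q) with hA2
  have m2 : Maya A2 := m1.symMove _ _
  have d : ∀ w, pair A2 A w = w (b + s * p) - w b + w (bar b) - w (bar (b + s * p)) +
      (w (b + t * q) - w (b + s * p + t * q) + w (bar (b + s * p + t * q)) -
        w (bar (b + t * q))) := fun w => by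
    rw [pair_trans m2 m1 hA.maya, d1, d2]; ring
  have heq : A2 = A := by
    refine huniq _ ⟨m2, a1.symMove k1 k2, ?_, ?_, ?_⟩
    · refine Equicharged.trans m2 hA.maya hS (fun w hw => ?_) hA.equi_s
      rw [d, show b + t * q = b + s * p + t * q + s * (-p) by ring,
        show bar (b + s * p + t * q + s * (-p)) = bar (b + s * p + t * q) + s * p by
          unfold bar; ring,
        show bar b = bar (b + s * p) + s * p by unfold bar; ring]
      simp only [periodic_mul hw]
      ring
    · refine Equicharged.trans m2 hA.maya hT (fun w hw => ?_) hA.equi_t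
      rw [d, show bar (b + s * p + t * q) = bar (b + s * p) + t * (-q) by unfold bar; ring,
        show bar (b + t * q) = bar b + t * (-q) by unfold bar; ring]
      simp only [periodic_mul hw]
      ring
    · rw [← hA.size_eq]
      unfold size
      rw [pair_trans m2 hA.maya maya_vac, d]
      simp only [id, bar]
      ring
  have hb : b ∉ A2 := by
    have hsp : b ≠ b + s * p := fun h => h2 (h ▸ h1)
    have htq : b ≠ b + t * q := fun h => h3 (h ▸ h1)
    have h0 : b ∉ A1 := by
      simp only [hA1, symMove, mem_move, not_or, not_and_or]
      refine ⟨Or.inl ⟨Or.inr (not_not.2 rfl), hsp⟩, ?_⟩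
      unfold bar; omega
    simp only [hA2, symMove, mem_move, not_or, not_and_or]
    refine ⟨Or.inl ⟨Or.inl h0, htq⟩, fun h => hA.anti.bar_notMem h4 (h ▸ h1)⟩
  exact hb (heq ▸ h1)

lemma Maya.shift {A : Set ℤ} (h : Maya A) (t : ℤ) : Maya {y | y + t ∈ A} := by
  obtain ⟨N, h1, h2⟩ := h
  refine ⟨N + |t|, fun x hx => h1 _ ?_, fun x hx => h2 _ ?_⟩
  · have := le_abs_self t; omega
  · have := neg_abs_le t; omega

lemma pair_shift (A B : Set ℤ) (t : ℤ) (w : ℤ → ℤ) :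
    pair {y | y + t ∈ A} {y | y + t ∈ B} w = pair A B (fun x => w (x - t)) := by
  unfold pair
  rw [← finsum_comp_equiv (Equiv.addRight t) (f := fun x => (ind A x - ind B x) * w (x - t))]
  refine finsum_congr fun x => ?_
  simp only [Equiv.coe_addRight, add_sub_cancel_right]
  rfl

/-- The sum counts descents by t minus ascents by t in a class modulo s. It depends only on the
s-charges, so A may be replaced by its s-core S; there t-closedness rules out ascents. -/
lemma pair_shift_nonneg {s t : ℤ} {A S : Set ℤ} (hA : Maya A) (hS : Maya S) (cS : Closed t S)
    (h : Equicharged s A S) (r : ℤ) : 0 ≤ pair A {y | y + t ∈ A} (classInd s r) := by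
  have e1 := h _ (classInd_periodic s r)
  have e2 : pair {y | y + t ∈ A} {y | y + t ∈ S} (classInd s r) = 0 := by
    rw [pair_shift]
    refine h _ fun x => ?_
    rw [show x + s - t = x - t + s by ring, classInd_periodic]
  have e3 := pair_trans hA hS (hA.shift t) (classInd s r)
  have e4 := pair_trans hS (hS.shift t) (hA.shift t) (classInd s r)
  rw [pair_symm, neg_eq_zero] at e2
  rw [e3, e4, e1, e2]
  have : 0 ≤ pair S {y | y + t ∈ S} (classInd s r) := by
    refine pair_nonneg fun x => mul_nonneg ?_ (by unfold classInd; split_ifs <;> simp)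
    by_cases hx : x + t ∈ S
    · rw [ind_of_mem (cS x hx)]
      have := ind_le_one {y | y + t ∈ S} x
      omega
    · rw [ind_of_notMem (A := {y | y + t ∈ S}) hx]
      have := ind_nonneg S x
      omega
  omega

lemma exists_descent {s t : ℤ} {A S : Set ℤ} (hA : Maya A) (hS : Maya S) (cS : Closed t S)
    (h : Equicharged s A S) {b : ℤ} (hb : b ∉ A) (hb' : b + t ∈ A) :
    ∃ p, b + s * p ∈ A ∧ b + t + s * p ∉ A := by
  by_contra hc
  push Not at hc
  have h0 := pair_shift_nonneg hA hS cS h b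
  rw [pair_symm] at h0
  have hterm : ∀ x, 0 ≤ (ind {y | y + t ∈ A} x - ind A x) * classInd s b x := by
    intro x
    by_cases hx : s ∣ x - b
    · rw [classInd_of_dvd hx, mul_one]
      by_cases hxA : x ∈ A
      · obtain ⟨p, hp⟩ := hx
        have := hc p (by rwa [← hp, add_sub_cancel])
        rw [ind_of_mem hxA, ind_of_mem (show x ∈ {y | y + t ∈ A} from ?_)]; · simp
        change x + t ∈ A
        rwa [show x + t = b + t + s * p by rw [← hp]; ring]
      · rw [ind_of_notMem hxA]
        have := ind_nonneg {y | y + t ∈ A} x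
        omega
    · rw [classInd_of_not_dvd hx, mul_zero]
  have := term_le_pair (hA.shift t) hA hterm b
  rw [ind_of_mem (show b ∈ {y | y + t ∈ A} from hb'), ind_of_notMem hb,
    classInd_of_dvd (by simp)] at this
  omega

/-- Two ascents in one class require two descents there, so one of them avoids any prescribed
position. -/
lemma exists_second_descent {s t : ℤ} {A S : Set ℤ} (hA : Maya A) (hS : Maya S)
    (cS : Closed t S) (h : Equicharged s A S) {b p' : ℤ} (hp' : s * p' ≠ 0) (hb : b ∉ A)
    (hb' : b + t ∈ A) (h2 : b + s * p' ∉ A) (h2' : b + s * p' + t ∈ A) (x₀ : ℤ) :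
    ∃ p, b + s * p ≠ x₀ ∧ b + s * p ∈ A ∧ b + t + s * p ∉ A := by
  by_cases hx₀ : x₀ ∈ A ∧ x₀ + t ∉ A
  swap
  · obtain ⟨p, h3, h4⟩ := exists_descent hA hS cS h hb hb'
    refine ⟨p, fun h5 => hx₀ ⟨h5 ▸ h3, ?_⟩, h3, h4⟩
    rw [← h5]
    rwa [show b + s * p + t = b + t + s * p by ring]
  by_contra hc
  push Not at hc
  have h0 := pair_shift_nonneg hA hS cS h b
  rw [pair_symm] at h0
  classical
  set w : ℤ → ℤ := fun x => if x = x₀ then 0 else classInd s b x with hw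
  set w' : ℤ → ℤ := fun x => if x = x₀ then classInd s b x else 0 with hw'
  have hsplit : classInd s b = fun x => w x + w' x := by
    ext x; simp only [hw, hw']; split_ifs <;> simp
  have e1 : pair {y | y + t ∈ A} A w' = - classInd s b x₀ := by
    rw [pair_eq_sum {x₀}, Finset.sum_singleton, ind_of_mem hx₀.1,
      ind_of_notMem (A := {y | y + t ∈ A}) hx₀.2]
    · simp [hw']
    · intro x hx
      simp only [Finset.mem_singleton] at hx
      simp [hw', hx]
  have hterm : ∀ x, 0 ≤ (ind {y | y + t ∈ A} x - ind A x) * w x := by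
    intro x
    simp only [hw]
    split_ifs with hxx
    · simp
    by_cases hx : s ∣ x - b
    · rw [classInd_of_dvd hx, mul_one]
      by_cases hxA : x ∈ A
      · obtain ⟨p, hp⟩ := hx
        have hxp : b + s * p = x := by rw [← hp]; ring
        have := hc p (by rwa [hxp]) (by rwa [hxp])
        rw [ind_of_mem hxA, ind_of_mem (show x ∈ {y | y + t ∈ A} from ?_)]; · simp
        change x + t ∈ A
        rwa [show x + t = b + t + s * p by rw [← hp]; ring]
      · rw [ind_of_notMem hxA]
        have := ind_nonneg {y | y + t ∈ A} x
        omega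
    · rw [classInd_of_not_dvd hx, mul_zero]
  have hne : b ≠ b + s * p' := by omega
  have := sum_le_pair (hA.shift t) hA hterm {b, b + s * p'}
  rw [Finset.sum_pair hne, ind_of_mem (show b ∈ {y | y + t ∈ A} from hb'), ind_of_notMem hb,
    ind_of_mem (show b + s * p' ∈ {y | y + t ∈ A} from h2'), ind_of_notMem h2] at this
  have w1 : w b = 1 := by
    simp only [hw]
    rw [if_neg (by rintro rfl; exact hb hx₀.1), classInd_of_dvd (by simp)]
  have w2 : w (b + s * p') = 1 := by
    simp only [hw]
    rw [if_neg (by rintro rfl; exact h2 hx₀.1), classInd_of_dvd (by simp)]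
  rw [w1, w2] at this
  rw [hsplit, pair_add (hA.shift t) hA, e1] at h0
  have w3 : classInd s b x₀ ≤ 1 := by unfold classInd; split_ifs <;> simp
  omega

/-! ### Rigid sets: ascents by s * t and by t. -/

/-- The properties of a unique solution from which the classification is deduced. -/
structure Rigid (s t : ℤ) (A : Set ℤ) : Prop where
  hs : 1 < s
  ht : 1 < t
  cop : IsCoprime s t
  maya : Maya A
  anti : Anti A
  rect : ∀ b p q, b ∈ A → b + s * p ∉ A → b + t * q ∉ A → b + s * p + t * q ∈ A →
    s * p = t * q ∨ s * p + t * q = 0 ∨ 2 * b + 1 = -(s * p) ∨ 2 * b + 1 = -(t * q) ∨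
      2 * (b + s * p) + 1 = -(t * q) ∨ 2 * (b + t * q) + 1 = -(s * p)
  desc_t : ∀ b, b ∉ A → b + t ∈ A → ∃ p, b + s * p ∈ A ∧ b + t + s * p ∉ A
  desc_t' : ∀ b p', s * p' ≠ 0 → b ∉ A → b + t ∈ A → b + s * p' ∉ A → b + s * p' + t ∈ A →
    ∀ x₀, ∃ p, b + s * p ≠ x₀ ∧ b + s * p ∈ A ∧ b + t + s * p ∉ A
  desc_s : ∀ b, b ∉ A → b + s ∈ A → ∃ q, b + t * q ∈ A ∧ b + s + t * q ∉ A
  desc_s' : ∀ b q', t * q' ≠ 0 → b ∉ A → b + s ∈ A → b + t * q' ∉ A → b + t * q' + s ∈ A →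
    ∀ x₀, ∃ q, b + t * q ≠ x₀ ∧ b + t * q ∈ A ∧ b + s + t * q ∉ A

lemma Rigid.swap {s t : ℤ} {A : Set ℤ} (h : Rigid s t A) : Rigid t s A where
  hs := h.ht
  ht := h.hs
  cop := h.cop.symm
  maya := h.maya
  anti := h.anti
  rect b p q h1 h2 h3 h4 := by
    have := h.rect b q p h1 h3 h2 (by rwa [add_right_comm])
    omega
  desc_t := h.desc_s
  desc_t' := h.desc_s'
  desc_s := h.desc_t
  desc_s' := h.desc_t'

lemma rigid_of_unique {s t : ℤ} (hs : 1 < s) (ht : 1 < t) (hst : IsCoprime s t) {S T : Set ℤ}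
    {n : ℤ} {A : Set ℤ} (hA : IsSolution s t S T n A)
    (hS : Maya S) (hT : Maya T) (cS : Closed t S) (cT : Closed s T)
    (huniq : ∀ A', IsSolution s t S T n A' → A' = A) : Rigid s t A where
  hs := hs
  ht := ht
  cop := hst
  maya := hA.maya
  anti := hA.anti
  rect := rect_of_unique hA hS hT huniq
  desc_t _ hb hb' := exists_descent hA.maya hS cS hA.equi_s hb hb'
  desc_t' _ _ hp' hb hb' h2 h2' x₀ :=
    exists_second_descent hA.maya hS cS hA.equi_s hp' hb hb' h2 h2' x₀
  desc_s _ hb hb' := exists_descent hA.maya hT cT hA.equi_t hb hb'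
  desc_s' _ _ hp' hb hb' h2 h2' x₀ :=
    exists_second_descent hA.maya hT cT hA.equi_t hp' hb hb' h2 h2' x₀

lemma Maya.exists_low {A : Set ℤ} (h : Maya A) (x : ℤ) {c : ℤ} (hc : 0 < c) :
    ∃ k₀, ∀ k ≤ k₀, x + c * k ∈ A := by
  obtain ⟨N, h1, -⟩ := h
  refine ⟨-(|N| + |x| + 1), fun k hk => h1 _ ?_⟩
  have := le_abs_self N
  have := le_abs_self x
  have := abs_nonneg N
  have := abs_nonneg x
  nlinarith

lemma Maya.exists_high {A : Set ℤ} (h : Maya A) (x : ℤ) {c : ℤ} (hc : 0 < c) :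
    ∃ k₀, ∀ k, k₀ ≤ k → x + c * k ∉ A := by
  obtain ⟨N, -, h1⟩ := h
  refine ⟨|N| + |x| + 1, fun k hk => h1 _ ?_⟩
  have := le_abs_self N
  have := neg_abs_le x
  have := abs_nonneg N
  have := abs_nonneg x
  nlinarith

lemma exists_center {s x : ℤ} (h : s ∣ 2 * x + 1) : ∃ u, 2 * u + 1 = -s := by
  obtain ⟨m, hm⟩ := h
  have : Odd (s * m) := ⟨x, hm.symm⟩
  obtain ⟨k, hk⟩ := (Int.odd_mul.1 this).1
  exact ⟨-k - 1, by omega⟩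

lemma exists_eq_center_add {s x u : ℤ} (hu : 2 * u + 1 = -s) (h : s ∣ 2 * x + 1) :
    ∃ i, x = u + s * i := by
  obtain ⟨m, hm⟩ := h
  have : Odd (s * m) := ⟨x, hm.symm⟩
  obtain ⟨k, hk⟩ := (Int.odd_mul.1 this).2
  refine ⟨k + 1, ?_⟩
  rw [hk] at hm
  linarith

namespace Rigid

variable {s t : ℤ} {A : Set ℤ}

lemma dvd_cancel (h : Rigid s t A) {x : ℤ} (hx : s ∣ t * x) : s ∣ x :=
  h.cop.dvd_of_dvd_mul_left hx

lemma not_dvd_one (h : Rigid s t A) : ¬ s ∣ 1 := fun hd => by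
  have := Int.le_of_dvd one_pos hd
  have := h.hs
  omega

lemma not_dvd (h : Rigid s t A) : ¬ s ∣ t := fun hd =>
  h.not_dvd_one (h.dvd_cancel (by simpa using hd))

/-- Propagating an ascent along a row through all parallel rows in a residue class. -/
lemma false_of_ascent (h : Rigid s t A) {b m q₀ : ℤ} (hm : 0 < m) (hb : b ∉ A)
    (hb' : b + s * (t * m) ∈ A) (hq₀ : ¬ s ∣ q₀) (hc : 2 * b + 1 ≠ -(s * (t * m)))
    (hex : ∀ k, 2 * b + 1 ≠ -(t * (q₀ + s * k)) ∧
      2 * (b + s * (t * m)) + 1 ≠ -(t * (q₀ + s * k)) ∧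
      2 * (b + t * (q₀ + s * k)) + 1 ≠ -(s * (t * m))) : False := by
  have hs := h.hs
  have ht := h.ht
  -- A failure would make the given ascent and a parallel descent into a forbidden rectangle.
  -- Iterating from far below, where everything is in A, puts arbitrarily large integers into A.
  have step : ∀ k, b + t * (q₀ + s * k) ∈ A → b + t * (q₀ + s * (k + m)) ∈ A := by
    intro k hk
    by_contra hk'
    obtain ⟨e1, e2, e3⟩ := hex k
    have hd : ∀ j, q₀ + s * k ≠ s * j := fun j hj => hq₀ ⟨j - k, by rw [mul_sub]; omega⟩
    have := h.rect (b + s * (t * m)) (-(t * m)) (q₀ + s * k) hb'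
      (by rwa [show b + s * (t * m) + s * -(t * m) = b by ring])
      (by rwa [show b + s * (t * m) + t * (q₀ + s * k) = b + t * (q₀ + s * (k + m)) by ring])
      (by rwa [show b + s * (t * m) + s * -(t * m) + t * (q₀ + s * k) =
        b + t * (q₀ + s * k) by ring])
    rcases this with g | g | g | g | g | g
    · refine hd (-m) (mul_left_cancel₀ (show t ≠ 0 by omega) ?_)
      rw [← g]; ring
    · refine hd m (mul_left_cancel₀ (show t ≠ 0 by omega) ?_)
      linear_combination g
    · apply hc; linear_combination g
    · exact e2 g
    · apply e1; linear_combination g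
    · apply e3; linear_combination g
  obtain ⟨k₀, hk₀⟩ := h.maya.exists_low (b + t * q₀) (show 0 < t * s by nlinarith)
  obtain ⟨k₁, hk₁⟩ := h.maya.exists_high (b + t * q₀) (show 0 < t * s by nlinarith)
  have hall : ∀ n : ℕ, b + t * (q₀ + s * (k₀ + m * n)) ∈ A := by
    intro n
    induction n with
    | zero =>
      have := hk₀ k₀ le_rfl
      rw [show b + t * (q₀ + s * (k₀ + m * ((0 : ℕ) : ℤ))) = b + t * q₀ + t * s * k₀ by
        push_cast; ring]
      exact this
    | succ n ih =>
      have := step _ ih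
      rw [show k₀ + m * ((n + 1 : ℕ) : ℤ) = k₀ + m * n + m by push_cast; ring]
      exact this
  refine hk₁ (k₀ + m * (k₁ - k₀).toNat) ?_ ?_
  · have : k₁ - k₀ ≤ (k₁ - k₀).toNat := Int.self_le_toNat _
    nlinarith
  · have := hall (k₁ - k₀).toNat
    rwa [show ∀ j, b + t * q₀ + t * s * j = b + t * (q₀ + s * j) by intro j; ring]

lemma ascent_of_even (h : Rigid s t A) (ht : Even t) {b : ℤ} (hb : b ∉ A) (hb' : b + s * t ∈ A) :
    False := by
  refine h.false_of_ascent (q₀ := 1) one_pos hb (by rwa [mul_one]) h.not_dvd_one ?_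
    fun k => ⟨?_, ?_, ?_⟩
  · obtain ⟨r, hr⟩ := (ht.mul_right 1).mul_left s
    omega
  · obtain ⟨r, hr⟩ := ht.mul_right (1 + s * k)
    omega
  · obtain ⟨r, hr⟩ := ht.mul_right (1 + s * k)
    omega
  · obtain ⟨r, hr⟩ := (ht.mul_right 1).mul_left s
    omega

/-- The parallel row must avoid three classes of symmetric positions modulo s. Among the offsets 1,
2, 3 none is divisible by s, and since s ≥ 5 each of the two remaining congruences excludes at most
one of them, so an admissible offset is left. -/
lemma ascent_of_five_le (h : Rigid s t A) (hs : 5 ≤ s) {b : ℤ} (hb : b ∉ A)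
    (hb' : b + s * t ∈ A) : 2 * b + 1 = -(s * t) := by
  by_contra hne
  have hsmall : ∀ d : ℤ, 1 ≤ d → d ≤ 4 → ¬ s ∣ d := fun d h1 h2 hd => by
    have := Int.le_of_dvd (by omega) hd
    omega
  have key : ∃ q₀ : ℤ, ¬ s ∣ q₀ ∧ ¬ s ∣ t * q₀ + (2 * b + 1) ∧ ¬ s ∣ 2 * (t * q₀) + (2 * b + 1) := by
    by_contra hc
    push Not at hc
    have hP : ∀ q q' : ℤ, s ∣ t * q + (2 * b + 1) → s ∣ t * q' + (2 * b + 1) →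
        1 ≤ q' - q → q' - q ≤ 4 → False := fun q q' h1 h2 h3 h4 => by
      refine hsmall _ h3 h4 (h.dvd_cancel ?_)
      have := dvd_sub h2 h1
      rwa [show t * q' + (2 * b + 1) - (t * q + (2 * b + 1)) = t * (q' - q) by ring] at this
    have hQ : ∀ q q' : ℤ, s ∣ 2 * (t * q) + (2 * b + 1) → s ∣ 2 * (t * q') + (2 * b + 1) →
        1 ≤ q' - q → q' - q ≤ 2 → False := fun q q' h1 h2 h3 h4 => by
      refine hsmall (2 * (q' - q)) (by omega) (by omega) (h.dvd_cancel ?_)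
      have := dvd_sub h2 h1
      rwa [show 2 * (t * q') + (2 * b + 1) - (2 * (t * q) + (2 * b + 1)) =
        t * (2 * (q' - q)) by ring] at this
    have c1 := hc 1 (hsmall 1 (by omega) (by omega))
    have c2 := hc 2 (hsmall 2 (by omega) (by omega))
    have c3 := hc 3 (hsmall 3 (by omega) (by omega))
    by_cases p1 : s ∣ t * 1 + (2 * b + 1) <;> by_cases p2 : s ∣ t * 2 + (2 * b + 1) <;>
      by_cases p3 : s ∣ t * 3 + (2 * b + 1)
    · exact hP 1 2 p1 p2 (by omega) (by omega)
    · exact hP 1 2 p1 p2 (by omega) (by omega)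
    · exact hP 1 3 p1 p3 (by omega) (by omega)
    · exact hQ 2 3 (c2 p2) (c3 p3) (by omega) (by omega)
    · exact hP 2 3 p2 p3 (by omega) (by omega)
    · exact hQ 1 3 (c1 p1) (c3 p3) (by omega) (by omega)
    · exact hQ 1 2 (c1 p1) (c2 p2) (by omega) (by omega)
    · exact hQ 1 2 (c1 p1) (c2 p2) (by omega) (by omega)
  obtain ⟨q₀, h1, h2, h3⟩ := key
  refine h.false_of_ascent (q₀ := q₀) one_pos hb (by rwa [mul_one]) h1 (by rwa [mul_one])
    fun k => ⟨fun e => h2 ?_, fun e => h2 ?_, fun e => h3 ?_⟩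
  · exact ⟨-(t * k), by linear_combination e⟩
  · exact ⟨-(t * k) - 2 * t, by linear_combination e⟩
  · exact ⟨-(2 * t * k) - t, by linear_combination e⟩

/-- If s or t is even, parity excludes the symmetric positions. If both are odd, one of them is at
least 5, as otherwise s = t = 3 contradicts coprimality. -/
lemma eq_of_ascent (h : Rigid s t A) {b : ℤ} (hb : b ∉ A) (hb' : b + s * t ∈ A) :
    2 * b + 1 = -(s * t) := by
  rcases Int.even_or_odd t with ht | ht
  · exact (h.ascent_of_even ht hb hb').elim
  rcases Int.even_or_odd s with hs | hs
  · exact (h.swap.ascent_of_even hs hb (by rwa [mul_comm])).elim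
  obtain ⟨k, hk⟩ := ht
  obtain ⟨l, hl⟩ := hs
  have h1 := h.hs
  have h2 := h.ht
  by_cases h5 : 5 ≤ s
  · exact h.ascent_of_five_le h5 hb hb'
  by_cases h6 : 5 ≤ t
  · rw [mul_comm s t] at hb' ⊢
    exact h.swap.ascent_of_five_le h6 hb hb'
  · exact absurd (show s ∣ t from ⟨1, by omega⟩) h.not_dvd

/-- An ascent by `t` is either central, or starts or ends in the central row. -/
lemma ascent_cases (h : Rigid s t A) {b : ℤ} (hb : b ∉ A) (hb' : b + t ∈ A)
    (hne : 2 * b + 1 ≠ -t) :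
    (s ∣ 2 * b + 1 ∧ b - t ∈ A ∧ bar b + t ∉ A) ∨ (s ∣ 2 * (b + t) + 1 ∧ b + t + t ∉ A) := by
  have hnd := h.not_dvd
  obtain ⟨p, hp1, hp2⟩ := h.desc_t b hb hb'
  have hrect := h.rect (b + s * p) (-p) 1 hp1
    (by rwa [show b + s * p + s * -p = b by ring])
    (by rwa [show b + s * p + t * 1 = b + t + s * p by ring])
    (by rwa [show b + s * p + s * -p + t * 1 = b + t by ring])
  rcases hrect with g | g | g | g | g | g
  · exact absurd ⟨-p, by linear_combination -g⟩ hnd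
  · exact absurd ⟨p, by linear_combination g⟩ hnd
  · left
    have e : b + s * p = bar b := by unfold bar; linear_combination g
    refine ⟨⟨-p, by linear_combination g⟩, ?_, ?_⟩
    · have := h.anti.bar_mem hp2
      rwa [show bar (b + t + s * p) = b - t by rw [add_right_comm, e]; unfold bar; ring] at this
    · rwa [← e, add_right_comm]
  -- Here the descent found is itself central, so the mirror image of the ascent is a second ascent
  -- in the same class. This forces a second descent, for which every alternative of the rectangle
  -- condition fails.
  · exfalso
    have hp0 : p ≠ 0 := by rintro rfl; exact hb (by simpa using hp1)
    have hs := h.hs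
    have h1 : b + s * (2 * p) ∉ A := by
      have := h.anti.bar_notMem hb'
      rwa [show bar (b + t) = b + s * (2 * p) by unfold bar; linear_combination -g] at this
    have h2 : b + s * (2 * p) + t ∈ A := by
      have := h.anti.bar_mem hb
      rwa [show bar b = b + s * (2 * p) + t by unfold bar; linear_combination -g] at this
    have hne0 : s * (2 * p) ≠ 0 := mul_ne_zero (by omega) (by omega)
    obtain ⟨m, hm1, hm2, hm3⟩ := h.desc_t' b (2 * p) hne0 hb hb' h1 h2 (b + s * p)
    have hrect := h.rect (b + s * m) (-m) 1 hm2
      (by rwa [show b + s * m + s * -m = b by ring])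
      (by rwa [show b + s * m + t * 1 = b + t + s * m by ring])
      (by rwa [show b + s * m + s * -m + t * 1 = b + t by ring])
    rcases hrect with g' | g' | g' | g' | g' | g'
    · exact hnd ⟨-m, by linear_combination -g'⟩
    · exact hnd ⟨m, by linear_combination g'⟩
    · exact hnd ⟨m - 2 * p, by linear_combination g - g'⟩
    · exact hm1 (by linarith)
    · apply hne; linear_combination g'
    · exact hnd ⟨2 * p - m, by linear_combination g' - g⟩
  · exact absurd (by linear_combination g) hne
  · right
    have e : b + t + s * p = bar (b + t) := by unfold bar; linear_combination g
    refine ⟨⟨-p, by linear_combination g⟩, ?_⟩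
    have := h.anti.bar_notMem hp1
    rwa [show bar (b + s * p) = b + t + t by
      rw [show b + s * p = bar (b + t) - t by rw [← e]; ring]; unfold bar; ring] at this

end Rigid

/-! ### The central row and the classification of ascents by t. -/

namespace Rigid

variable {s t : ℤ} {A : Set ℤ}

lemma dvd_of_dvd_two_mul (h : Rigid s t A) {u q : ℤ} (hu : 2 * u + 1 = -s)
    (hd : s ∣ 2 * (t * q)) : s ∣ q := by
  have hc : IsCoprime s 2 := ⟨-1, -u, by linear_combination -hu⟩
  exact h.dvd_cancel (hc.dvd_of_dvd_mul_left hd)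

lemma center_bar_zero {u : ℤ} (hu : 2 * u + 1 = -s) (i : ℤ) :
    bar (u + s * i) = u + s * (1 - i) := by
  unfold bar; linear_combination -hu

/-- Two rows, one of them central, can only be incomparable at opposite positions. -/
lemma central_rect (h : Rigid s t A) {u q i i' : ℤ} (hu : 2 * u + 1 = -s) (hq : ¬ s ∣ q)
    (h1 : u + s * i ∉ A) (h2 : u + s * i' ∈ A) (h3 : u + s * i + t * q ∈ A)
    (h4 : u + s * i' + t * q ∉ A) : i + i' = 1 := by
  have hs := h.hs
  have := h.rect (u + s * i') (i - i') q h2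
    (by rwa [show u + s * i' + s * (i - i') = u + s * i by ring]) h4
    (by rwa [show u + s * i' + s * (i - i') + t * q = u + s * i + t * q by ring])
  rcases this with g | g | g | g | g | g
  · exact absurd (h.dvd_cancel ⟨i - i', g.symm⟩) hq
  · exact absurd (h.dvd_cancel ⟨-(i - i'), by linear_combination g⟩) hq
  · refine mul_left_cancel₀ (show s ≠ 0 by omega) ?_
    linear_combination g - hu
  · exact absurd (h.dvd_cancel ⟨1 - 2 * i', by linear_combination g - hu⟩) hq
  · exact absurd (h.dvd_cancel ⟨1 - 2 * i, by linear_combination g - hu⟩) hq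
  · exact absurd (h.dvd_of_dvd_two_mul hu ⟨1 - i - i', by linear_combination g - hu⟩) hq

lemma no_ascent_near_center (h : Rigid s t A) {u q : ℤ} (hu : 2 * u + 1 = -s) (hq : q ≠ 0)
    (h1 : u + t * q ∉ A) (h2 : u + s + t * q ∈ A) : False := by
  have ht := h.ht
  rcases h.swap.ascent_cases h1 (by rwa [add_right_comm]) (fun g => hq (mul_left_cancel₀
    (show t ≠ 0 by omega) (by linarith))) with ⟨g, -⟩ | ⟨g, -⟩
  · refine h.swap.not_dvd ?_
    obtain ⟨k, hk⟩ := g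
    exact ⟨2 * q - k, by linear_combination hu - hk⟩
  · refine h.swap.not_dvd ?_
    obtain ⟨k, hk⟩ := g
    exact ⟨k - 2 * q, by linear_combination hk - hu⟩

/-- The hypothesis on i makes the start x of the ascent differ from `bar x` by a multiple of s * t.
Closedness under s * t then compares A at mirror positions, where `Anti` demands opposite answers.
-/
lemma central_row_ascent_aux (h : Rigid s t A) (hcl : Closed (s * t) A) {u i : ℤ}
    (hu : 2 * u + 1 = -s) (h1 : u + s * i ∉ A) (h2 : u + s * (i + 1) ∈ A)
    (hd : t ∣ 2 * i - 1) : False := by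
  have ht := h.ht
  have hs := h.hs
  have hi : i ≠ 0 := by
    rintro rfl
    exact h.swap.not_dvd_one (by simpa using (dvd_neg.2 hd))
  obtain ⟨k, hk⟩ := hd
  have h2' : u + s * i + s ∈ A := by rwa [show u + s * i + s = u + s * (i + 1) by ring]
  have hX : 2 * (u + s * i) + 1 = s * (t * k) := by linear_combination hu + s * hk
  have hk0 : 0 ≤ k := by
    by_contra hk0
    refine h1 (hcl.mul _ (k := -k) (by omega) ?_)
    have := h.anti.bar_mem h1
    rwa [show bar (u + s * i) = u + s * i + s * t * -k by
      unfold bar; linear_combination -hX] at this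
  rcases h.swap.ascent_cases h1 h2' (fun g => hi (mul_left_cancel₀
    (show s ≠ 0 by omega) (by linarith))) with ⟨-, g, -⟩ | ⟨g, -⟩
  · refine h.anti.bar_notMem h2' (hcl.mul _ hk0 ?_)
    rwa [show bar (u + s * i + s) + s * t * k = u + s * i - s by
      unfold bar; linear_combination -hX]
  · have h3 : t ∣ s * 2 := by
      obtain ⟨m, hm⟩ := g
      exact ⟨m - s * k, by linear_combination hm - hX⟩
    have h4 := Int.le_of_dvd two_pos (h.swap.dvd_cancel h3)
    obtain rfl : t = 2 := by omega
    omega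

lemma central_row_ascent (h : Rigid s t A) (hcl : Closed (s * t) A) {u i : ℤ}
    (hu : 2 * u + 1 = -s) (h1 : u + s * i ∉ A) (h2 : u + s * (i + 1) ∈ A) : i = 0 := by
  have hs := h.hs
  by_contra hi
  have h2' : u + s * i + s ∈ A := by rwa [show u + s * i + s = u + s * (i + 1) by ring]
  rcases h.swap.ascent_cases h1 h2' (fun g => hi (mul_left_cancel₀
    (show s ≠ 0 by omega) (by linarith))) with ⟨⟨m, hm⟩, -⟩ | ⟨⟨m, hm⟩, -⟩
  · refine h.central_row_ascent_aux hcl hu h1 h2 (h.swap.dvd_cancel ⟨m, ?_⟩)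
    linear_combination hm - hu
  · have h3 := h.anti.bar_notMem h2
    have h4 := h.anti.bar_mem h1
    rw [center_bar_zero hu] at h3 h4
    refine h.central_row_ascent_aux hcl hu (i := -i)
      (by rwa [show -i = 1 - (i + 1) by ring]) (by rwa [show -i + 1 = 1 - i by ring])
      (h.swap.dvd_cancel ⟨-m, ?_⟩)
    linear_combination hu - hm

/-- The central row is either trivial or trivial up to exchanging its two central positions. -/
lemma central_row (h : Rigid s t A) (hcl : Closed (s * t) A) {u : ℤ} (hu : 2 * u + 1 = -s) :
    (∀ i, u + s * i ∈ A ↔ i ≤ 0) ∨ (u ∉ A ∧ ∀ i, u + s * i ∈ A ↔ i ≤ -1 ∨ i = 1) := by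
  have hs := h.hs
  have ht := h.ht
  have hbar : ∀ i, u + s * (1 - i) ∈ A ↔ u + s * i ∉ A := fun i => by
    rw [← center_bar_zero hu]; exact h.anti _
  have hdown : ∀ i, i ≠ 0 → u + s * (i + 1) ∈ A → u + s * i ∈ A := fun i hi h2 => by
    by_contra h1
    exact hi (h.central_row_ascent hcl hu h1 h2)
  have hdesc : ∀ i, i ≤ 0 → u + s * i ∈ A → ∀ n : ℕ, u + s * (i - n) ∈ A := by
    intro i hi h0 n
    induction n with
    | zero => simpa using h0
    | succ n ih =>
      refine hdown _ (by push_cast; omega) ?_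
      rwa [show i - ((n + 1 : ℕ) : ℤ) + 1 = i - n by push_cast; ring]
  have hdesc' : ∀ i, i ≤ 0 → u + s * i ∈ A → ∀ j ≤ i, u + s * j ∈ A := by
    intro i hi h0 j hj
    have := hdesc i hi h0 (i - j).toNat
    rwa [show i - ((i - j).toNat : ℤ) = j by omega] at this
  by_cases h0 : u + s * 0 ∈ A
  · left
    intro i
    constructor
    · intro hi
      by_contra hc
      exact (hbar i).1 (hdesc' 0 le_rfl h0 (1 - i) (by omega)) hi
    · exact hdesc' 0 le_rfl h0 i
  · right
    have h1 : u + s * 1 ∈ A := (hbar 0).2 h0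
    -- Were it in A, the descent class of the central ascent would supply a row at offset t * q.
    -- Either s divides q and closedness under s * t puts u into A, or that row has an ascent which
    -- forces t = 3. In the latter case closedness under s * t carries u + 2 * s down to its mirror
    -- image u - s.
    have h2 : u + s * 2 ∉ A := by
      intro h2
      have hm1 : u + s * (-1) ∉ A := fun h' => by
        have := (hbar 2).1 (by rwa [show (1 : ℤ) - 2 = -1 by norm_num])
        exact this h2
      obtain ⟨q, hq1, hq2⟩ := h.desc_s u (by simpa using h0) (by simpa using h1)
      by_cases hsq : s ∣ q
      · obtain ⟨k, rfl⟩ := hsq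
        apply h0
        rcases le_or_gt 0 k with hk | hk
        · refine hcl.mul _ hk ?_
          rwa [show u + s * 0 + s * t * k = u + t * (s * k) by ring]
        · refine hcl.mul _ (k := -k) (by omega) ?_
          have h3 := h.anti.bar_mem hq2
          rwa [show bar (u + s + t * (s * k)) = u + s * 0 + s * t * -k by
            unfold bar; linear_combination -hu] at h3
      · have h4 : u + s * 2 + t * q ∈ A := by
          by_contra h4
          have := h.central_rect hu hsq h0 h2 (by simpa using hq1) h4
          omega
        rcases h.swap.ascent_cases hq2 (by
          rwa [show u + s + t * q + s = u + s * 2 + t * q by ring]) (fun g => hsq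
          (h.dvd_of_dvd_two_mul hu ⟨-2, by linear_combination g - hu⟩)) with ⟨⟨m, hm⟩, -⟩ | ⟨⟨m, hm⟩, -⟩
        · exact h.swap.not_dvd ⟨m - 2 * q, by linear_combination hm - hu⟩
        · have h5 : t ∣ 3 := h.swap.dvd_cancel ⟨m - 2 * q, by linear_combination hm - hu⟩
          have h6 := Int.le_of_dvd (by norm_num) h5
          have h7 : t ≠ 2 := by rintro rfl; omega
          obtain rfl : t = 3 := by omega
          refine hm1 (hcl _ ?_)
          rwa [show u + s * -1 + s * 3 = u + s * 2 by ring]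
    have hm1 : u + s * (-1) ∈ A := by
      have := (hbar 2).2 h2
      rwa [show (1 : ℤ) - 2 = -1 by norm_num] at this
    refine ⟨by simpa using h0, fun i => ?_⟩
    constructor
    · intro hi
      by_contra hc
      rcases eq_or_ne i 0 with rfl | hi0
      · exact h0 hi
      · exact (hbar i).1 (hdesc' _ (by norm_num) hm1 (1 - i) (by omega)) hi
    · rintro (hi | rfl)
      · exact hdesc' _ (by norm_num) hm1 i hi
      · exact h1

/-- An ascent by `t` out of the central row starts at the centre. -/
lemma ascent_of_central_row (h : Rigid s t A) (hcl : Closed (s * t) A) {u i : ℤ}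
    (hu : 2 * u + 1 = -s) (h1 : u + s * i ∉ A) (h2 : u + s * i + t ∈ A) :
    i = 0 ∧ u + s * (1 - i) + t ∉ A := by
  have hs := h.hs
  have ht := h.ht
  have hd1 : ¬ s ∣ 1 := h.not_dvd_one
  have hbt : u + s * (1 - i) + t ∉ A := by
    rcases h.ascent_cases h1 h2 (fun g => h.not_dvd ⟨1 - 2 * i, by linear_combination g - hu⟩) with
      ⟨-, -, g⟩ | ⟨⟨m, hm⟩, -⟩
    · rwa [center_bar_zero hu] at g
    · exact absurd (h.dvd_of_dvd_two_mul (q := 1) hu ⟨m - 2 * i + 1, by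
        linear_combination hm - hu⟩) hd1
  refine ⟨?_, hbt⟩
  have hb : u + s * (1 - i) ∈ A := by
    rw [← center_bar_zero hu]; exact h.anti.bar_mem h1
  have hup : ∀ j, u + s * j ∉ A → u + s * j + t ∈ A → j = i := fun j hj1 hj2 => by
    have := h.central_rect hu hd1 hj1 hb (by rwa [mul_one]) (by rwa [mul_one])
    omega
  have hdn : ∀ j, u + s * j ∈ A → u + s * j + t ∉ A → j = 1 - i := fun j hj1 hj2 => by
    have := h.central_rect hu hd1 h1 hj1 (by rwa [mul_one]) (by rwa [mul_one])
    omega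
  have near : u + s * 0 + t ∉ A → u + s * 1 + t ∈ A → False := fun e1 e2 =>
    h.no_ascent_near_center hu one_ne_zero (by simpa using e1) (by simpa using e2)
  -- The row shifted by t can differ from the central row only at positions i and 1 - i. With a
  -- trivial central row, the resulting ascent by s in the shifted row leads back to the centre or
  -- into the central row for t, at a coordinate where that row must be empty.
  rcases h.central_row hcl hu with hr | ⟨-, hr⟩
  · exfalso
    have hi : 1 ≤ i := by
      by_contra hc
      exact h1 ((hr i).2 (by omega))
    rcases eq_or_lt_of_le hi with rfl | hi
    · exact near (by simpa using hbt) h2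
    · have h3 : u + s * (i - 1) + t ∉ A := fun h3 => by
        have := hup (i - 1) (fun h' => by have := (hr _).1 h'; omega) h3
        omega
      rcases h.swap.ascent_cases h3 (by rwa [show u + s * (i - 1) + t + s = u + s * i + t by ring])
        (fun g => h.not_dvd (h.dvd_of_dvd_two_mul (q := 1) hu
          ⟨2 - 2 * i, by linear_combination g - hu⟩ |> fun g => absurd g hd1)) with
        ⟨⟨m, hm⟩, g, -⟩ | ⟨⟨m, hm⟩, -⟩
      · have h4 : u + s * (i - 2) ∈ A := by
          by_contra h4
          have := hup (i - 2) h4 (by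
            rwa [show u + s * (i - 1) + t - s = u + s * (i - 2) + t by ring] at g)
          omega
        have h5 := (hr _).1 h4
        obtain rfl : i = 2 := by omega
        exact h.swap.not_dvd ⟨m - 2, by linear_combination hm - hu⟩
      · obtain ⟨k, hk⟩ : t ∣ 2 * i - 1 := h.swap.dvd_cancel ⟨m - 2, by linear_combination hm - hu⟩
        have hodd : Odd (t * k) := ⟨i - 1, by omega⟩
        obtain ⟨⟨l, hl⟩, ⟨k', hk'⟩⟩ := Int.odd_mul.1 hodd
        have hk0 : 0 ≤ k' := by
          by_contra hc
          have : t * k ≤ 0 := mul_nonpos_of_nonneg_of_nonpos (by omega) (by omega)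
          omega
        have hv : 2 * (-l - 1) + 1 = -t := by omega
        -- This rewrites the top of the ascent, u + s * i + t, in the central row for t, whose
        -- centre is -l - 1; its coordinate is at least 2.
        have hmem : -l - 1 + t * (s * k' - u + 1) ∈ A := by
          rwa [show -l - 1 + t * (s * k' - u + 1) = u + s * i + t from ?_]
          have : (2 : ℤ) ≠ 0 := two_ne_zero
          refine mul_left_cancel₀ this ?_
          have e1 : k = 2 * k' + 1 := hk'
          linear_combination hv - hu * (1 + t) - s * hk - s * t * e1
        have hbig : 2 ≤ s * k' - u + 1 := by
          have : 0 ≤ s * k' := mul_nonneg (by omega) hk0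
          omega
        rcases h.swap.central_row (by rwa [mul_comm]) hv with hr' | ⟨-, hr'⟩
        · have := (hr' _).1 hmem; omega
        · have := (hr' _).1 hmem; omega
  · by_contra hi0
    have hi : 2 ≤ i := by
      by_contra hc
      exact h1 ((hr i).2 (by omega))
    refine near (fun h' => ?_) (by_contra fun h' => ?_)
    · have := hup 0 (fun h' => by have := (hr _).1 h'; omega) h'
      omega
    · have := hdn 1 ((hr 1).2 (by omega)) h'
      omega

/-- The ascents by `t`. -/
lemma ascent_classification (h : Rigid s t A) (hcl : Closed (s * t) A) {b : ℤ} (hb : b ∉ A)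
    (hb' : b + t ∈ A) : 2 * b + 1 = -t ∨
      ∃ u, 2 * u + 1 = -s ∧ u ∉ A ∧ (b = u ∨ b + t = u + s) := by
  by_contra hc
  rw [not_or] at hc
  obtain ⟨hc1, hc2⟩ := hc
  rcases h.ascent_cases hb hb' hc1 with ⟨g, -⟩ | ⟨g, -⟩
  · obtain ⟨u, hu⟩ := exists_center g
    obtain ⟨i, rfl⟩ := exists_eq_center_add hu g
    obtain ⟨rfl, -⟩ := h.ascent_of_central_row hcl hu hb hb'
    exact hc2 ⟨u, hu, by simpa using hb, Or.inl (by ring)⟩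
  · obtain ⟨u, hu⟩ := exists_center g
    have g' : s ∣ 2 * bar (b + t) + 1 := by
      rw [show 2 * bar (b + t) + 1 = -(2 * (b + t) + 1) by unfold bar; ring]
      exact dvd_neg.2 g
    obtain ⟨i, hi⟩ := exists_eq_center_add hu g'
    have h1 := h.anti.bar_notMem hb'
    have h2 := h.anti.bar_mem hb
    rw [show bar b = bar (b + t) + t by unfold bar; ring] at h2
    rw [hi] at h1 h2
    obtain ⟨rfl, -⟩ := h.ascent_of_central_row hcl hu h1 h2
    refine hc2 ⟨u, hu, by simpa using h1, Or.inr ?_⟩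
    unfold bar at hi
    linear_combination -hi - hu

lemma closed_of_trivial (h : Rigid s t A) (hcl : Closed (s * t) A)
    (h1 : ∀ u, 2 * u + 1 = -s → u ∈ A) (h2 : ∀ v, 2 * v + 1 = -t → v ∈ A) : Closed t A := by
  intro x hx
  by_contra hx'
  rcases h.ascent_classification hcl hx' hx with g | ⟨u, hu, hu', -⟩
  · exact hx' (h2 x g)
  · exact hu' (h1 u hu)

lemma central_row_of_notMem (h : Rigid s t A) (hcl : Closed (s * t) A) {u : ℤ}
    (hu : 2 * u + 1 = -s) (hu' : u ∉ A) (i : ℤ) : u + s * i ∈ A ↔ i ≤ -1 ∨ i = 1 := by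
  rcases h.central_row hcl hu with hr | ⟨-, hr⟩
  · exact absurd ((hr 0).2 le_rfl) (by simpa using hu')
  · exact hr i

lemma closed_move_of_trivial (h : Rigid s t A) (hcl : Closed (s * t) A)
    (h1 : ∀ u, 2 * u + 1 = -s → u ∈ A) {v : ℤ} (hv : 2 * v + 1 = -t) (hv' : v ∉ A) :
    Closed t (move A (v + t) v) := by
  have hr := h.swap.central_row_of_notMem (by rwa [mul_comm]) hv hv'
  have ht := h.ht
  intro x hx
  rw [mem_move] at hx ⊢
  rcases hx with ⟨hx1, hx2⟩ | hx
  · by_cases hxA : x ∈ A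
    · refine Or.inl ⟨hxA, ?_⟩
      rintro rfl
      have := (hr 2).1 (by rwa [show v + t * 2 = v + t + t by ring])
      omega
    · rcases h.ascent_classification hcl hxA hx1 with g | ⟨u, hu, hu', -⟩
      · right; omega
      · exact absurd (h1 u hu) hu'
  · left
    have := (hr (-1)).2 (by omega)
    rw [show v + t * -1 = x by linear_combination -hx] at this
    exact ⟨this, by omega⟩

lemma central_upper_notMem (h : Rigid s t A) (hcl : Closed (s * t) A) {u : ℤ}
    (hu : 2 * u + 1 = -s) (hu' : u ∉ A) : u + s + t ∉ A := by
  intro h1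
  have h2 : u + t ∈ A := by
    by_contra h2
    exact h.no_ascent_near_center hu one_ne_zero (by simpa using h2) (by simpa using h1)
  have := (h.ascent_of_central_row hcl hu (i := 0) (by simpa using hu') (by simpa using h2)).2
  exact this (by simpa using h1)

/-- The possible ascents by t are the central one and those involving the exchanged pair u, u + s.
Undoing both central exchanges removes them, and the beads at u - t and v - t ensure that no new
ascent is created. -/
lemma closed_move_move (h : Rigid s t A) (hcl : Closed (s * t) A) {u v : ℤ}
    (hu : 2 * u + 1 = -s) (hu' : u ∉ A) (hv : 2 * v + 1 = -t) (hv' : v ∉ A) :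
    Closed t (move (move A (u + s) u) (v + t) v) := by
  have hr := h.swap.central_row_of_notMem (by rwa [mul_comm]) hv hv'
  have hs := h.hs
  have ht := h.ht
  have hup := h.central_upper_notMem hcl hu hu'
  have hlow : u - t ∈ A := by
    by_contra hc
    have := h.anti.bar_mem hc
    rw [show bar (u - t) = u + s + t by unfold bar; linear_combination -hu] at this
    exact hup this
  intro x hx
  simp only [mem_move] at hx ⊢
  rcases hx with ⟨⟨hx1, hx2⟩ | hx1, hx3⟩ | hx
  · by_cases hxA : x ∈ A
    · refine Or.inl ⟨Or.inl ⟨hxA, ?_⟩, ?_⟩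
      · rintro rfl; exact hup hx1
      · rintro rfl
        have := (hr 2).1 (by rwa [show v + t * 2 = v + t + t by ring])
        omega
    · rcases h.ascent_classification hcl hxA hx1 with g | ⟨u', hu1, -, g | g⟩
      · right; omega
      · left; exact ⟨Or.inr (by omega), by omega⟩
      · omega
  · left
    rw [show x = u - t by omega]
    exact ⟨Or.inl ⟨hlow, by omega⟩, by omega⟩
  · left
    have := (hr (-1)).2 (by omega)
    rw [show v + t * -1 = x by linear_combination -hx] at this
    exact ⟨Or.inl ⟨this, by omega⟩, by omega⟩

end Rigid

/-! ### Reading off both cores when there is no ascent by s * t. -/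

/-- `S` is obtained from `T` by a swap of `b` and `bar b`, as in `SingleSwap`. -/
def SetSwap (s t : ℤ) (S T : Set ℤ) : Prop :=
  ∃ b : ℤ, b ∈ T \ S ∧ bar b - b ≡ t [ZMOD 2 * s] ∧ S = (T \ {b}) ∪ {bar b}

/-- `S` is obtained from `T` by swaps at `b` and `c`, as in `DoubleSwapAt`. -/
def SetDoubleSwapAt (s t : ℤ) (S T : Set ℤ) (b c : ℤ) : Prop :=
  b ≠ c ∧ b ∈ T \ S ∧ c ∈ T \ S ∧ bar b - b ≡ t [ZMOD 2 * s] ∧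
    bar c - c ≡ -s [ZMOD 2 * t] ∧ S = (T \ {b, c}) ∪ {bar b, bar c}

lemma Closed.exists_last {s : ℤ} (hs : 0 < s) {A : Set ℤ} (hA : Maya A) (cA : Closed s A) (x : ℤ) :
    ∃ k, ∀ j, x + s * j ∈ A ↔ j ≤ k := by
  obtain ⟨k₀, hk₀⟩ := hA.exists_low x hs
  obtain ⟨k₁, hk₁⟩ := hA.exists_high x hs
  obtain ⟨k, hk, hk'⟩ := Int.exists_greatest_of_bdd (P := fun j => x + s * j ∈ A)
    ⟨k₁, fun z hz => by
      by_contra hc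
      exact hk₁ z (by omega) hz⟩ ⟨k₀, hk₀ k₀ le_rfl⟩
  refine ⟨k, fun j => ⟨hk' j, fun hj => cA.mul _ (k := k - j) (by omega) ?_⟩⟩
  rwa [show x + s * j + s * (k - j) = x + s * k by ring]

lemma Closed.mul_right {s : ℤ} {A : Set ℤ} (h : Closed s A) {t : ℤ} (ht : 0 ≤ t) :
    Closed (s * t) A := fun x hx => h.mul x ht hx

lemma move_comm {A : Set ℤ} {a b c d : ℤ} (hbc : b ≠ c) (hda : d ≠ a) :
    move (move A a b) c d = move (move A c d) a b := by
  ext x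
  simp only [mem_move]
  by_cases h1 : x = b
  · subst h1; simp [hbc]
  · by_cases h2 : x = d
    · subst h2; simp [hda]
    · simp only [h1, h2, or_false]; tauto

lemma bar_ne (b : ℤ) : bar b ≠ b := by unfold bar; omega

lemma modEq_of_eq_add {s t b v k : ℤ} (hv : 2 * v + 1 = -t) (hb : b = v + s * k) :
    bar b - b ≡ t [ZMOD 2 * s] := by
  refine (Int.modEq_iff_dvd.2 ⟨k, ?_⟩)
  unfold bar
  rw [hb]
  linear_combination hv

/-- Swapping the centre of a self-conjugate core moves, after passing to the core, the last
element of its residue class. -/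
lemma exists_core_swap {s t : ℤ} (hs : 0 < s) (hst : ¬ s ∣ t) {K L : Set ℤ} (hK : Maya K)
    (aK : Anti K) (cK : Closed s K) (hL : Maya L) (cL : Closed s L) {v : ℤ}
    (hv : 2 * v + 1 = -t) (hvK : v ∈ K) (h : Equicharged s (move K v (v + t)) L) :
    ∃ k, 0 ≤ k ∧ v + s * k ∈ K ∧ v + s * k + s ∉ K ∧
      L = move K (v + s * k) (bar (v + s * k)) := by
  obtain ⟨k, hk⟩ := cK.exists_last hs hK v
  have hk1 := (hk k).2 le_rfl
  have hk2 : v + s * k + s ∉ K := by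
    rw [show v + s * k + s = v + s * (k + 1) by ring, hk]; omega
  refine ⟨k, (hk 0).1 (by simpa using hvK), hk1, hk2, ?_⟩
  set b := v + s * k with hb
  have hbar := aK.bar_notMem hk1
  have hvt : v + t ∉ K := by
    have := aK.bar_notMem hvK
    rwa [show bar v = v + t by unfold bar; omega] at this
  refine Closed.eq_of_equicharged hL (hK.move _ _) cL ?_ ?_
  · intro x hx
    rw [mem_move] at hx ⊢
    left
    rcases hx with ⟨hx1, -⟩ | hx
    · refine ⟨cK x hx1, ?_⟩
      rintro rfl; exact hk2 hx1
    · have := aK.bar_mem hk2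
      rw [show bar (b + s) = x by unfold bar at hx ⊢; omega] at this
      refine ⟨this, fun hxb => hst ⟨2 * k + 1, ?_⟩⟩
      unfold bar at hx
      rw [hxb, hb] at hx
      linear_combination hv - hx
  · refine Equicharged.symm (Equicharged.trans (hK.move _ _) (hK.move _ _) hL (fun w hw => ?_) h)
    rw [pair_trans (hK.move _ _) hK (hK.move _ _), pair_symm K, pair_move hk1 hbar,
      pair_move hvK hvt, show bar b = v + t + s * (-k) by
        unfold bar; rw [hb]; linear_combination -hv, hb]
    simp only [periodic_mul hw]
    ring

lemma center_mem {t : ℤ} {K : Set ℤ} (aK : Anti K) (cK : Closed t K) {v : ℤ}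
    (hv : 2 * v + 1 = -t) : v ∈ K := by
  by_contra h
  have := aK.bar_mem h
  rw [show bar v = v + t by unfold bar; omega] at this
  exact h (cK _ this)

lemma center_add_notMem {t : ℤ} {K : Set ℤ} (aK : Anti K) (cK : Closed t K) {v : ℤ}
    (hv : 2 * v + 1 = -t) : v + t ∉ K := by
  have := aK.bar_notMem (center_mem aK cK hv)
  rwa [show bar v = v + t by unfold bar; omega] at this

lemma Anti.move_center {t : ℤ} {K : Set ℤ} (aK : Anti K) {v : ℤ}
    (hv : 2 * v + 1 = -t) (hvK : v ∈ K) : Anti (CorePartitions.move K v (v + t)) := by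
  have := aK.move hvK
  rwa [show bar v = v + t by unfold bar; omega] at this

lemma isSolution_move_mul {s t : ℤ} (ht : 0 ≤ t) {S : Set ℤ} (hS : Maya S) (aS : Anti S)
    (cS : Closed s S) {b : ℤ} (hb : 2 * b + 1 = -(s * t)) :
    IsSolution s t S S (size S + s * t) (move S b (b + s * t)) := by
  have cst := cS.mul_right ht
  have h1 := center_mem aS cst hb
  have h2 := center_add_notMem aS cst hb
  refine ⟨hS.move _ _, aS.move_center hb h1, equicharged_move h1 h2 ⟨t, by ring⟩,
    equicharged_move h1 h2 ⟨s, by ring⟩, ?_⟩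
  rw [size_move hS h1 h2]; ring

section Forward

variable {s t : ℤ} {S T : Set ℤ} {n : ℤ} {A : Set ℤ}

lemma forward_trivial (h : Rigid s t A) (hA : IsSolution s t S T n A) (hS : Maya S) (hT : Maya T)
    (cS : Closed s S) (cT : Closed t T) (hcl : Closed (s * t) A)
    (h1 : ∀ u, 2 * u + 1 = -s → u ∈ A) (h2 : ∀ v, 2 * v + 1 = -t → v ∈ A) :
    S = T ∧ n = size S := by
  have e1 := Closed.eq_of_equicharged hA.maya hS
    (h.swap.closed_of_trivial (by rwa [mul_comm]) h2 h1) cS hA.equi_s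
  have e2 := Closed.eq_of_equicharged hA.maya hT (h.closed_of_trivial hcl h1 h2) cT hA.equi_t
  exact ⟨e1.symm.trans e2, by rw [← e1, hA.size_eq]⟩

lemma forward_single (h : Rigid s t A) (hA : IsSolution s t S T n A) (hS : Maya S) (hT : Maya T)
    (aT : Anti T) (cS : Closed s S) (cT : Closed t T) (cT' : Closed s T) (hcl : Closed (s * t) A)
    (h1 : ∀ u, 2 * u + 1 = -s → u ∈ A) {v : ℤ} (hv : 2 * v + 1 = -t) (hv' : v ∉ A) :
    Odd t ∧ SetSwap s t S T ∧ n = size T + t := by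
  have hs := h.hs
  have hvt : v + t ∈ A := by
    have := hA.anti.bar_mem hv'
    rwa [show bar v = v + t by unfold bar; omega] at this
  have e1 : move A (v + t) v = T := Closed.eq_of_equicharged (hA.maya.move _ _) hT
    (h.closed_move_of_trivial hcl h1 hv hv') cT
    ((equicharged_move hvt hv' ⟨-1, by ring⟩).trans (hA.maya.move _ _) hA.maya hT hA.equi_t)
  have e2 : A = move T v (v + t) := by rw [← e1, move_move hvt hv']
  have hvT := center_mem aT cT hv
  have hvT' := center_add_notMem aT cT hv
  refine ⟨⟨-v - 1, by omega⟩, ?_, ?_⟩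
  · obtain ⟨k, -, hk1, -, hk2⟩ := exists_core_swap (by omega) h.not_dvd hT aT cT' hS cS hv hvT
      (e2 ▸ hA.equi_s)
    refine ⟨v + s * k, ⟨hk1, ?_⟩, modEq_of_eq_add hv rfl, hk2⟩
    rw [hk2, mem_move, not_or]
    exact ⟨fun h => h.2 rfl, (bar_ne _).symm⟩
  · rw [← hA.size_eq, e2, size_move hT hvT hvT']; ring

/-- Undoing both central exchanges gives an (s,t)-core Y, the beta-set of the star partition. Modulo
s only the exchange at v matters, so S is Y with some b reflected; modulo t only the one at u
matters, so T is Y with some c reflected. Relative to T the two swapped elements are b and `bar c`.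
-/
lemma forward_double (h : Rigid s t A) (hA : IsSolution s t S T n A) (hS : Maya S) (hT : Maya T)
    (aS : Anti S) (cS : Closed s S) (cT : Closed t T)
    (huniq : ∀ A', IsSolution s t S T n A' → A' = A) (hcl : Closed (s * t) A) {u v : ℤ}
    (hu : 2 * u + 1 = -s) (hu' : u ∉ A) (hv : 2 * v + 1 = -t) (hv' : v ∉ A) :
    Odd s ∧ Odd t ∧ ∃ b c, SetDoubleSwapAt s t S T b c ∧
      n = size ((T \ {c}) ∪ {bar c}) + s + t := by
  have hs := h.hs
  have ht := h.ht
  have huv : s ≠ t := by rintro rfl; exact h.not_dvd dvd_rfl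
  have bu : bar u = u + s := by unfold bar; omega
  have bv : bar v = v + t := by unfold bar; omega
  have hus : u + s ∈ A := bu ▸ hA.anti.bar_mem hu'
  have hvt : v + t ∈ A := bv ▸ hA.anti.bar_mem hv'
  set A1 := move A (u + s) u with hA1
  have m1 : Maya A1 := hA.maya.move _ _
  have a1 : Anti A1 := by
    have := hA.anti.move hus
    rwa [show bar (u + s) = u by unfold bar; omega] at this
  have k1 : v + t ∈ A1 := Or.inl ⟨hvt, by simp only [Set.mem_singleton_iff]; omega⟩
  have k2 : v ∉ A1 := by rw [hA1, mem_move]; rintro (g | g); exacts [hv' g.1, by omega]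
  set Y := move A1 (v + t) v with hY
  have mY : Maya Y := m1.move _ _
  have aY : Anti Y := by
    have := a1.move k1
    rwa [show bar (v + t) = v by unfold bar; omega] at this
  have cY : Closed t Y := h.closed_move_move hcl hu hu' hv hv'
  have cY' : Closed s Y := by
    have := h.swap.closed_move_move (by rwa [mul_comm]) hv hv' hu hu'
    rwa [move_comm (by omega) (by omega)] at this
  have huY := center_mem aY cY' hu
  have huY' := center_add_notMem aY cY' hu
  have hvY := center_mem aY cY hv
  have hvY' := center_add_notMem aY cY hv
  have hpair : ∀ w, pair A Y w = w (u + s) - w u + (w (v + t) - w v) := fun w => by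
    have e1 : pair A1 A w = w u - w (u + s) := pair_move hus hu' w
    have e2 : pair Y A1 w = w v - w (v + t) := pair_move k1 k2 w
    rw [pair_trans hA.maya m1 mY, pair_symm A A1, pair_symm A1 Y, e1, e2]; ring
  have eS : Equicharged s (move Y v (v + t)) S := by
    refine Equicharged.trans (mY.move _ _) hA.maya hS (fun w hw => ?_) hA.equi_s
    rw [pair_trans (mY.move _ _) mY hA.maya, pair_symm Y, pair_move hvY hvY', hpair, hw]; ring
  have eT : Equicharged t (move Y u (u + s)) T := by
    refine Equicharged.trans (mY.move _ _) hA.maya hT (fun w hw => ?_) hA.equi_t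
    rw [pair_trans (mY.move _ _) mY hA.maya, pair_symm Y, pair_move huY huY', hpair, hw]; ring
  have hn : n = size Y + s + t := by
    rw [← hA.size_eq]
    unfold size
    rw [pair_trans hA.maya mY maya_vac, hpair]
    simp only [id]; ring
  obtain ⟨k, hk0, hb1, hb2, hb3⟩ :=
    exists_core_swap (by omega) h.not_dvd mY aY cY' hS cS hv hvY eS
  obtain ⟨l, -, hc1, hc2, hc3⟩ :=
    exists_core_swap (by omega) h.swap.not_dvd mY aY cY hT cT hu huY eT
  set b := v + s * k with hb
  set c := u + t * l with hc
  have hbb := aY.bar_notMem hb1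
  have hcc := aY.bar_notMem hc1
  -- If b = c then S = T and the arithmetic forces n = size S + s * t. Then S with its central pair
  -- at distance s * t exchanged is a second solution, different from A because A is closed under s
  -- * t.
  have hne : b ≠ c := by
    intro hbc
    have hST : S = T := by rw [hb3, hc3, hbc]
    have hdvd : t ∣ 2 * k + 1 := h.swap.dvd_cancel ⟨2 * l + 1, by
      have : v + s * k = u + t * l := hbc
      linear_combination 2 * this + hu - hv⟩
    obtain ⟨m, hm⟩ := hdvd
    have hm1 : 1 ≤ m := by
      by_contra hc
      have : t * m ≤ 0 := mul_nonpos_of_nonneg_of_nonpos (by omega) (by omega)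
      omega
    have hm3 : m < 3 := by
      by_contra hc
      have hkt : t ≤ k := by nlinarith
      have h1 : v + s * t ∈ Y := by
        refine cY'.mul _ (k := k - t) (by omega) ?_
        rwa [show v + s * t + s * (k - t) = b by rw [hb]; ring]
      refine hvY' (cY.mul _ (k := s - 1) (by omega) ?_)
      rwa [show v + t + t * (s - 1) = v + s * t by ring]
    have hodd : Odd (t * m) := ⟨k, by omega⟩
    obtain ⟨m', hm'⟩ := (Int.odd_mul.1 hodd).2
    obtain rfl : m = 1 := by omega
    have hX : 2 * b + 1 = s * t - s - t := by rw [hb]; linear_combination hv + s * hm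
    have hnS : n = size S + s * t := by
      rw [hn, hb3, size_move mY hb1 hbb]
      unfold bar; linear_combination hX
    have hst : Odd (s * t) := by
      rw [Int.odd_mul]; exact ⟨⟨-u - 1, by omega⟩, ⟨-v - 1, by omega⟩⟩
    obtain ⟨r, hr⟩ := hst
    have hb0 : 2 * (-r - 1) + 1 = -(s * t) := by omega
    have hsol := isSolution_move_mul (t := t) (by omega) hS aS cS hb0
    have heq := huniq _ (by rw [hnS, ← hST]; exact hsol)
    have c0 := center_mem aS (cS.mul_right (show 0 ≤ t by omega)) hb0
    have h1 : -r - 1 + s * t ∈ A := heq ▸ Or.inr rfl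
    have h2 := hcl _ h1
    rw [← heq, mem_move] at h2
    rcases h2 with g | g
    · exact g.2 rfl
    · omega
  have bcc : bar (bar c) = c := bar_bar c
  have hbT : b ∈ T := by rw [hc3]; exact Or.inl ⟨hb1, hne⟩
  have hbS : b ∉ S := by
    rw [hb3, mem_move, not_or]
    exact ⟨fun h => h.2 rfl, (bar_ne _).symm⟩
  have hcT : bar c ∈ T := by rw [hc3]; exact Or.inr rfl
  have hcS : bar c ∉ S := by
    rw [hb3, mem_move, not_or, bar_inj]
    exact ⟨fun h => hcc h.1, hne.symm⟩
  refine ⟨⟨-u - 1, by omega⟩, ⟨-v - 1, by omega⟩, b, bar c,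
    ⟨fun h => hcc (h ▸ hb1), ⟨hbT, hbS⟩, ⟨hcT, hcS⟩, modEq_of_eq_add hv hb, ?_, ?_⟩, ?_⟩
  · refine Int.modEq_iff_dvd.2 ⟨-l, ?_⟩
    unfold bar
    rw [hc]
    linear_combination -hu
  · rw [hb3, hc3, bar_bar]
    ext x
    simp only [mem_move, Set.mem_union, Set.mem_sdiff, Set.mem_insert_iff, Set.mem_singleton_iff,
      not_or]
    have e1 : c ≠ bar c := (bar_ne c).symm
    by_cases x1 : x = c
    · subst x1; simp [hc1, hne.symm]
    · by_cases x2 : x = bar c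
      · subst x2; simp [hcc, bar_inj, hne.symm, x1]
      · simp [x1, x2]
  · have hmv : (T \ {bar c}) ∪ {bar (bar c)} = Y := by
      rw [bar_bar, hc3]
      exact move_move hc1 hcc
    rw [hmv, hn]

end Forward

/-! ### The case of an ascent by s * t. -/

/-- `K` is the beta-set of the largest `(s, t)`-core, for `t` odd: the positions in the columns
next to the centre are cut at the central row. -/
def IsKappa (s t : ℤ) (K : Set ℤ) : Prop :=
  ∃ v, 2 * v + 1 = -t ∧ ∀ i, -t < 2 * i → 2 * i < t → ∀ j, v + s * i + t * j ∈ K ↔ j ≤ 0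

namespace Rigid

variable {s t : ℤ} {A : Set ℤ} {b : ℤ}

lemma bar_ascent (hb : 2 * b + 1 = -(s * t)) (q : ℤ) : bar (b + t * q) = b + t * (s - q) := by
  unfold bar; linear_combination -hb

lemma not_dvd_of_odd_ascent (h : Rigid s t A) (hb : 2 * b + 1 = -(s * t)) {q : ℤ}
    (hd : s ∣ 2 * (t * q)) : s ∣ q := by
  obtain ⟨u, hu⟩ := exists_center (s := s) (x := b) ⟨-t, by linear_combination hb⟩
  exact h.dvd_of_dvd_two_mul hu hd

lemma double_ascent_notMem (h : Rigid s t A) (hb : 2 * b + 1 = -(s * t)) (hb' : b ∉ A) :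
    b + s * (t * 2) ∉ A := by
  intro h2
  have hs := h.hs
  have ht := h.ht
  have hst : 0 < s * t := by positivity
  refine h.false_of_ascent (q₀ := 1) two_pos hb' h2 h.not_dvd_one (by nlinarith)
    fun k => ⟨fun e => ?_, fun e => ?_, fun e => ?_⟩
  · exact h.not_dvd_one (h.dvd_cancel ⟨t - t * k, by linear_combination e - hb⟩)
  · exact h.not_dvd_one (h.dvd_cancel ⟨-3 * t - t * k, by linear_combination e - hb⟩)
  · exact h.not_dvd_one (h.not_dvd_of_odd_ascent hb ⟨-t - 2 * t * k, by linear_combination e - hb⟩)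

lemma closed_mul_move (h : Rigid s t A) (hb : 2 * b + 1 = -(s * t)) (hb' : b ∉ A) :
    Closed (s * t) (move A (b + s * t) b) := by
  have hs := h.hs
  have ht := h.ht
  have hst : 0 < s * t := by positivity
  have h2 := h.double_ascent_notMem hb hb'
  intro x hx
  rw [mem_move] at hx ⊢
  rcases hx with ⟨hx1, hx2⟩ | hx
  · by_cases hxA : x ∈ A
    · refine Or.inl ⟨hxA, ?_⟩
      rintro rfl
      exact h2 (by rwa [show b + s * (t * 2) = b + s * t + s * t by ring])
    · have := h.eq_of_ascent hxA hx1
      right; omega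
  · left
    have := h.anti.bar_mem h2
    rw [show bar (b + s * (t * 2)) = x by unfold bar; linear_combination -hb - hx] at this
    exact ⟨this, by omega⟩

lemma mem_move_iff (h : Rigid s t A) {p q : ℤ} (hp : ¬ t ∣ p) :
    b + s * p + t * q ∈ move A (b + s * t) b ↔ b + s * p + t * q ∈ A := by
  have h1 : b + s * p + t * q ≠ b := fun e =>
    hp (h.swap.dvd_cancel ⟨-q, by linear_combination e⟩)
  have h2 : b + s * p + t * q ≠ b + s * t := fun e =>
    hp (h.swap.dvd_cancel ⟨s - q, by linear_combination e⟩)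
  rw [mem_move]; tauto

/-- Each column is a translate of the central one. -/
lemma exists_column_eq (h : Rigid s t A) (hb : 2 * b + 1 = -(s * t)) (hb' : b ∉ A) {p : ℤ}
    (hp : ¬ t ∣ p) : ∃ k, ∀ q, b + t * q ∈ move A (b + s * t) b ↔
      b + s * (p + t * k) + t * q ∈ move A (b + s * t) b := by
  have hs := h.hs
  have ht := h.ht
  have hst : 0 < s * t := by positivity
  have hcl := h.closed_mul_move hb hb'
  have hbst : b + s * t ∈ A := by
    have := h.anti.bar_mem hb'
    rwa [show bar b = b + s * t by unfold bar; linear_combination -hb] at this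
  have mK := h.maya.move (b + s * t) b
  set K := move A (b + s * t) b with hK
  obtain ⟨k, hk⟩ := hcl.exists_last hst mK (b + s * p)
  refine ⟨k, fun q => ?_⟩
  set p' := p + t * k with hp'
  have hp0 : ¬ t ∣ p' := fun hd => hp ((Int.dvd_add_left ⟨k, rfl⟩).1 hd)
  have hline : ∀ j, b + s * p' + s * t * j ∈ K ↔ j ≤ 0 := fun j => by
    rw [hp', show b + s * (p + t * k) + s * t * j = b + s * p + s * t * (k + j) by ring, hk]
    omega
  have hbK : b ∈ K := Or.inr rfl
  have hbK' : b + s * t ∉ K := by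
    rw [hK, mem_move]; rintro (g | g); exacts [g.2 rfl, by omega]
  have hline0 : ∀ j, b + s * t * j ∈ K ↔ j ≤ 0 := by
    obtain ⟨k', hk'⟩ := hcl.exists_last hst mK b
    have h1 := (hk' 0).1 (by simpa using hbK)
    have h2 := (hk' 1).not.1 (by simpa using hbK')
    obtain rfl : k' = 0 := by omega
    exact hk'
  by_cases hq : s ∣ q
  · obtain ⟨j, rfl⟩ := hq
    rw [show b + t * (s * j) = b + s * t * j by ring,
      show b + s * p' + t * (s * j) = b + s * p' + s * t * j by ring, hline, hline0]
  · have hq' : b + t * q ∈ K ↔ b + t * q ∈ A := by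
      have e1 : b + t * q ≠ b := fun e => hq (h.dvd_cancel ⟨0, by linear_combination e⟩)
      have e2 : b + t * q ≠ b + s * t := fun e => hq (h.dvd_cancel ⟨t, by linear_combination e⟩)
      rw [hK, mem_move]; tauto
    rw [hq', hK, h.mem_move_iff hp0]
    have k1 : b + s * p' ∈ A := by
      have := (hline 0).2 le_rfl
      rw [show b + s * p' + s * t * 0 = b + s * p' + t * 0 by ring, hK, h.mem_move_iff hp0] at this
      simpa using this
    have k2 : b + s * t + s * p' ∉ A := by
      have := (hline 1).not.2 (by omega)
      rw [show b + s * p' + s * t * 1 = b + s * p' + t * s by ring, hK, h.mem_move_iff hp0] at this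
      rwa [show b + s * t + s * p' = b + s * p' + t * s by ring]
    have hp1 : s * p' ≠ s * t := fun e =>
      hp0 (h.swap.dvd_cancel ⟨s, by linear_combination e⟩)
    -- A disagreement between the two columns is a forbidden rectangle, one side being a bead and a
    -- gap at coordinates divisible by s. In one direction the lower ends b and b + s * p' serve as
    -- that side; in the other direction, b + s * t and its neighbour do.
    constructor
    · intro h1
      by_contra h2
      have := h.rect (b + s * p') (-p') q k1 (by rwa [show b + s * p' + s * -p' = b by ring]) h2
        (by rwa [show b + s * p' + s * -p' + t * q = b + t * q by ring])
      rcases this with g | g | g | g | g | g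
      · exact hq (h.dvd_cancel ⟨-p', by linear_combination -g⟩)
      · exact hq (h.dvd_cancel ⟨p', by linear_combination g⟩)
      · apply hp1; linear_combination g - hb
      · exact hq (h.dvd_cancel ⟨t - 2 * p', by linear_combination g - hb⟩)
      · exact hq (h.dvd_cancel ⟨t, by linear_combination g - hb⟩)
      · exact hq (h.not_dvd_of_odd_ascent hb ⟨t - p', by linear_combination g - hb⟩)
    · intro h1
      by_contra h2
      have hq2 : ¬ s ∣ q - s := fun hd => hq (by simpa using hd)
      have := h.rect (b + s * t) p' (q - s) hbst k2
        (by rwa [show b + s * t + t * (q - s) = b + t * q by ring])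
        (by rwa [show b + s * t + s * p' + t * (q - s) = b + s * p' + t * q by ring])
      rcases this with g | g | g | g | g | g
      · exact hq2 (h.dvd_cancel ⟨p', by linear_combination -g⟩)
      · exact hq2 (h.dvd_cancel ⟨-p', by linear_combination g⟩)
      · exact hp0 (h.swap.dvd_cancel ⟨-s, by linear_combination g - hb⟩)
      · exact hq2 (h.dvd_cancel ⟨-t, by linear_combination g - hb⟩)
      · exact hq2 (h.dvd_cancel ⟨-t - 2 * p', by linear_combination g - hb⟩)
      · exact hq2 (h.not_dvd_of_odd_ascent hb ⟨-t - p', by linear_combination g - hb⟩)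

lemma anti_move_ascent (h : Rigid s t A) (hb : 2 * b + 1 = -(s * t)) (hb' : b ∉ A) :
    Anti (move A (b + s * t) b) := by
  have hbst := h.anti.bar_mem hb'
  rw [show bar b = b + s * t by unfold bar; linear_combination -hb] at hbst
  have := h.anti.move hbst
  rwa [show bar (b + s * t) = b by unfold bar; linear_combination -hb] at this

/-- An ascent in the central column is copied by a non-central column, where `ascent_cases` applies
and forces s to divide q or q + 1. Reflection and closedness under s * t then give a contradiction.
-/
lemma central_column_closed (h : Rigid s t A) (hb : 2 * b + 1 = -(s * t)) (hb' : b ∉ A) {q : ℤ}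
    (h1 : b + t * (q + 1) ∈ move A (b + s * t) b) : b + t * q ∈ move A (b + s * t) b := by
  by_contra h2
  have hs := h.hs
  have ht := h.ht
  have hst : 0 < s * t := by positivity
  have hcl := h.closed_mul_move hb hb'
  have aK := h.anti_move_ascent hb hb'
  obtain ⟨k, hk⟩ := h.exists_column_eq hb hb' h.swap.not_dvd_one
  set p' := 1 + t * k with hp'
  have hp0 : ¬ t ∣ p' := fun hd => h.swap.not_dvd_one ((Int.dvd_add_left ⟨k, rfl⟩).1 hd)
  set K := move A (b + s * t) b with hK
  have hKA : ∀ j, b + t * j ∈ K ↔ b + s * p' + t * j ∈ A := fun j => by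
    rw [hk, hK, h.mem_move_iff hp0]
  have hneg : ∀ j, b + t * (s - j) ∈ K ↔ b + t * j ∉ K := fun j => by
    rw [← bar_ascent hb]; exact aK _
  have e1 := (hKA _).1 h1
  have e2 := (hKA _).not.1 h2
  have hbK : b ∈ K := Or.inr rfl
  have hbK' : b + s * t ∉ K := by
    rw [hK, mem_move]; rintro (g | g); exacts [g.2 rfl, by omega]
  rcases h.ascent_cases e2 (by rwa [show b + s * p' + t * q + t = b + s * p' + t * (q + 1) by ring])
    (fun e => hp0 (h.swap.not_dvd_of_odd_ascent (by rwa [mul_comm t s])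
      ⟨s - 2 * q - 1, by linear_combination e - hb⟩)) with ⟨⟨m, hm⟩, g, -⟩ | ⟨⟨m, hm⟩, g⟩
  · obtain ⟨l, rfl⟩ := h.not_dvd_of_odd_ascent hb (q := q)
      ⟨m + t - 2 * p', by linear_combination hm - hb⟩
    have hl : 1 ≤ l := by
      by_contra hc
      refine h2 (hcl.mul _ (k := -l) (by omega) ?_)
      rwa [show b + t * (s * l) + s * t * -l = b by ring]
    have g1 := (hKA (s * l - 1)).2 (by
      rwa [show b + s * p' + t * (s * l - 1) = b + s * p' + t * (s * l) - t by ring])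
    have g2 := hcl.mul (b + t * (s - (s * l + 1))) (k := 2 * l - 1) (by omega) (by
      rwa [show b + t * (s - (s * l + 1)) + s * t * (2 * l - 1) = b + t * (s * l - 1) by ring])
    exact (hneg _).1 g2 h1
  · obtain ⟨l, hl'⟩ := h.not_dvd_of_odd_ascent hb (q := q + 1)
      ⟨m + t - 2 * p', by linear_combination hm - hb⟩
    obtain rfl : q = s * l - 1 := by omega
    have hl : l ≤ 0 := by
      by_contra hc
      refine hbK' (hcl.mul _ (k := l - 1) (by omega) ?_)
      rwa [show b + s * t + s * t * (l - 1) = b + t * (s * l - 1 + 1) by ring]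
    have g1 := (hKA (s * l + 1)).not.2 (by
      rwa [show b + s * p' + t * (s * l + 1) = b + s * p' + t * (s * l - 1) + t + t by ring])
    refine g1 (hcl.mul _ (k := 1 - 2 * l) (by omega) ?_)
    have := (hneg _).2 h2
    rwa [show b + t * (s * l + 1) + s * t * (1 - 2 * l) = b + t * (s - (s * l - 1)) by ring]

lemma central_column (h : Rigid s t A) (hb : 2 * b + 1 = -(s * t)) (hb' : b ∉ A) (q : ℤ) :
    b + t * q ∈ move A (b + s * t) b ↔ 2 * q < s := by
  have aK := h.anti_move_ascent hb hb'
  have hneg := aK (b + t * q)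
  rw [bar_ascent hb] at hneg
  have hodd : Odd s := by
    have : Odd (s * t) := ⟨-b - 1, by linear_combination hb⟩
    exact (Int.odd_mul.1 this).1
  obtain ⟨r, hr⟩ := hodd
  have hdesc : ∀ q, b + t * q ∈ move A (b + s * t) b → ∀ q' ≤ q,
      b + t * q' ∈ move A (b + s * t) b := by
    intro q hq q' hle
    have : ∀ n : ℕ, b + t * (q - n) ∈ move A (b + s * t) b := by
      intro n
      induction n with
      | zero => simpa using hq
      | succ n ih =>
        refine h.central_column_closed hb hb' ?_
        rwa [show q - ((n + 1 : ℕ) : ℤ) + 1 = q - n by push_cast; ring]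
    have := this (q - q').toNat
    rwa [show q - ((q - q').toNat : ℤ) = q' by omega] at this
  constructor
  · intro hq
    by_contra hc
    exact hneg.1 (hdesc _ hq (s - q) (by omega)) hq
  · intro hq
    by_contra hc
    exact hc (hdesc _ (hneg.2 hc) q (by omega))

lemma exists_column (h : Rigid s t A) (hb : 2 * b + 1 = -(s * t)) (hb' : b ∉ A) (x : ℤ) :
    ∃ p q, x = b + s * p + t * q ∧
      ∀ j, b + s * p + t * j ∈ move A (b + s * t) b ↔ 2 * j < s := by
  obtain ⟨α, β, hαβ⟩ := h.cop
  by_cases hp : t ∣ α * (x - b)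
  · obtain ⟨r, hr⟩ := hp
    refine ⟨0, s * r + β * (x - b), ?_, fun j => ?_⟩
    · linear_combination s * hr - (x - b) * hαβ
    · rw [mul_zero, add_zero, h.central_column hb hb']
  · obtain ⟨k, hk⟩ := h.exists_column_eq hb hb' hp
    refine ⟨α * (x - b) + t * k, β * (x - b) - s * k, ?_, fun j => ?_⟩
    · linear_combination - (x - b) * hαβ
    · rw [← hk, h.central_column hb hb']

lemma closed_move_ascent (h : Rigid s t A) (hb : 2 * b + 1 = -(s * t)) (hb' : b ∉ A) :
    Closed t (move A (b + s * t) b) := by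
  intro x hx
  obtain ⟨p, q, rfl, hpq⟩ := h.exists_column hb hb' x
  rw [show b + s * p + t * q + t = b + s * p + t * (q + 1) by ring, hpq] at hx
  rw [hpq]; omega

/-- Measured from v, every class modulo t has a representative column cut at height 0. Closedness
under s and the reflection confine its index p to -t < 2 * p < t, so it is the standard
representative. -/
lemma isKappa_of_ascent (h : Rigid s t A) (hb : 2 * b + 1 = -(s * t)) (hb' : b ∉ A) :
    IsKappa s t (move A (b + s * t) b) := by
  have hs := h.hs
  have ht := h.ht
  have hodd : Odd (s * t) := ⟨-b - 1, by linear_combination hb⟩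
  obtain ⟨⟨r, hr⟩, ⟨r', hr'⟩⟩ := Int.odd_mul.1 hodd
  have aK := h.anti_move_ascent hb hb'
  have cs : Closed s (move A (b + s * t) b) := by
    have := h.swap.closed_move_ascent (by rwa [mul_comm t s]) hb'
    rwa [mul_comm] at this
  have hcol := fun x => h.exists_column hb hb' x
  set K := move A (b + s * t) b with hK
  have hv : 2 * (-r' - 1) + 1 = -t := by omega
  set v := -r' - 1
  have hbv : b = v + t * (-r) := by
    refine mul_left_cancel₀ (two_ne_zero (α := ℤ)) ?_
    linear_combination hb - hv - t * hr
  have hcol' : ∀ x, ∃ p q, x = v + s * p + t * q ∧ ∀ j, v + s * p + t * j ∈ K ↔ j ≤ 0 := by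
    intro x
    obtain ⟨p, q, hx, hpq⟩ := hcol x
    refine ⟨p, q - r, by rw [hx, hbv]; ring, fun j => ?_⟩
    rw [show v + s * p + t * j = b + s * p + t * (j + r) by rw [hbv]; ring, hpq]
    omega
  have hupper : ∀ p, (∀ j, v + s * p + t * j ∈ K ↔ j ≤ 0) → 2 * p < t := by
    intro p hp
    by_contra hc
    have h1 : v + s * (t - p) ∈ K := by
      refine cs.mul _ (k := 2 * p - t) (by omega) ?_
      rw [show v + s * (t - p) + s * (2 * p - t) = v + s * p + t * 0 by ring, hp]
    have h2 := aK.bar_notMem h1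
    rw [show bar (v + s * (t - p)) = v + s * p + t * (1 - s) by
      unfold bar; linear_combination -hv, hp] at h2
    omega
  refine ⟨v, hv, fun i hi1 hi2 => ?_⟩
  obtain ⟨p, q, hx, hp⟩ := hcol' (v + s * i)
  have hp1 := hupper p hp
  have hp2 := hupper (-p) fun j => by
    have := aK (v + s * p + t * (1 - j))
    rw [hp, show bar (v + s * p + t * (1 - j)) = v + s * -p + t * j by
      unfold bar; linear_combination -hv] at this
    rw [this]; omega
  have hd : t ∣ i - p := h.swap.dvd_cancel ⟨q, by linear_combination hx⟩
  have := Int.eq_zero_of_abs_lt_dvd hd (by rw [abs_lt]; constructor <;> omega)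
  obtain rfl : i = p := by omega
  exact hp

end Rigid

/-- The classification of the pairs of cores with a unique self-conjugate partition. -/
lemma forward {s t : ℤ} (hs : 1 < s) (ht : 1 < t) (hst : IsCoprime s t) {S T : Set ℤ} {n : ℤ}
    {A : Set ℤ} (hA : IsSolution s t S T n A) (hS : Maya S) (hT : Maya T) (cS : Closed s S)
    (cS' : Closed t S) (cT : Closed t T) (cT' : Closed s T)
    (huniq : ∀ A', IsSolution s t S T n A' → A' = A) :
    (S = T ∧ n = size S) ∨ (Odd t ∧ SetSwap s t S T ∧ n = size T + t) ∨
      (Odd s ∧ SetSwap t s T S ∧ n = size S + s) ∨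
      (Odd s ∧ Odd t ∧ ∃ b c, SetDoubleSwapAt s t S T b c ∧
        n = size ((T \ {c}) ∪ {bar c}) + s + t) ∨
      (Odd s ∧ Odd t ∧ S = T ∧ IsKappa s t S ∧ n = size S + s * t) := by
  have h := rigid_of_unique hs ht hst hA hS hT cS' cT' huniq
  have aS := Closed.anti hA.maya hA.anti hS cS hA.equi_s
  have aT := Closed.anti hA.maya hA.anti hT cT hA.equi_t
  by_cases hcl : Closed (s * t) A
  · by_cases h1 : ∀ u, 2 * u + 1 = -s → u ∈ A <;> by_cases h2 : ∀ v, 2 * v + 1 = -t → v ∈ A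
    · exact Or.inl (forward_trivial h hA hS hT cS cT hcl h1 h2)
    · push Not at h2
      obtain ⟨v, hv, hv'⟩ := h2
      exact Or.inr (Or.inl (forward_single h hA hS hT aT cS cT cT' hcl h1 hv hv'))
    · push Not at h1
      obtain ⟨u, hu, hu'⟩ := h1
      exact Or.inr (Or.inr (Or.inl (forward_single h.swap hA.swap hT hS aS cT cS cS'
        (by rwa [mul_comm]) h2 hu hu')))
    · push Not at h1 h2
      obtain ⟨u, hu, hu'⟩ := h1
      obtain ⟨v, hv, hv'⟩ := h2
      exact Or.inr (Or.inr (Or.inr (Or.inl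
        (forward_double h hA hS hT aS cS cT huniq hcl hu hu' hv hv'))))
  · unfold Closed at hcl
    push Not at hcl
    obtain ⟨b, hb1, hb'⟩ := hcl
    have hb := h.eq_of_ascent hb' hb1
    have ct := h.closed_move_ascent hb hb'
    have cs : Closed s (move A (b + s * t) b) := by
      have := h.swap.closed_move_ascent (by rwa [mul_comm t s]) hb'
      rwa [mul_comm] at this
    have e1 : move A (b + s * t) b = S := Closed.eq_of_equicharged (hA.maya.move _ _) hS cs cS
      ((equicharged_move hb1 hb' ⟨-t, by ring⟩).trans (hA.maya.move _ _) hA.maya hS hA.equi_s)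
    have e2 : move A (b + s * t) b = T := Closed.eq_of_equicharged (hA.maya.move _ _) hT ct cT
      ((equicharged_move hb1 hb' ⟨-s, by ring⟩).trans (hA.maya.move _ _) hA.maya hT hA.equi_t)
    have hodd : Odd (s * t) := ⟨-b - 1, by linear_combination hb⟩
    obtain ⟨o1, o2⟩ := Int.odd_mul.1 hodd
    refine Or.inr (Or.inr (Or.inr (Or.inr ⟨o1, o2, e1.symm.trans e2, ?_, ?_⟩)))
    · rw [← e1]; exact h.isKappa_of_ascent hb hb'
    · rw [← e1, size_move hA.maya hb1 hb', hA.size_eq]; ring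

/-! ### Column coordinates and the largest simultaneous core. -/

lemma exists_coord {s t v : ℤ} (ht : 0 < t) (hst : IsCoprime s t) (hv : 2 * v + 1 = -t) (x : ℤ) :
    ∃ i j, -t < 2 * i ∧ 2 * i < t ∧ x = v + s * i + t * j := by
  obtain ⟨α, β, h⟩ := hst
  have h1 := Int.emod_nonneg (α * (x - v) - v - 1) ht.ne'
  have h2 := Int.emod_lt_of_pos (α * (x - v) - v - 1) ht
  have h3 := Int.mul_ediv_add_emod (α * (x - v) - v - 1) t
  set r := (α * (x - v) - v - 1) % t
  set q := (α * (x - v) - v - 1) / t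
  refine ⟨r + v + 1, s * q + β * (x - v), by omega, by omega, ?_⟩
  linear_combination -(x - v) * h - s * h3

lemma coord_unique {s t v i j i' j' : ℤ} (ht : 0 < t) (hst : IsCoprime s t)
    (hi : -t < 2 * i ∧ 2 * i < t) (hi' : -t < 2 * i' ∧ 2 * i' < t)
    (h : v + s * i + t * j = v + s * i' + t * j') : i = i' ∧ j = j' := by
  have hd : t ∣ i - i' := hst.symm.dvd_of_dvd_mul_left (show t ∣ s * (i - i') from ⟨j' - j, by linear_combination h⟩)
  have := Int.eq_zero_of_abs_lt_dvd hd (by rw [abs_lt]; constructor <;> omega)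
  obtain rfl : i = i' := by omega
  refine ⟨rfl, mul_left_cancel₀ ht.ne' ?_⟩
  linear_combination h

lemma IsKappa.of_center {s t : ℤ} {K : Set ℤ} (h : IsKappa s t K) {v : ℤ} (hv : 2 * v + 1 = -t)
    {i : ℤ} (h1 : -t < 2 * i) (h2 : 2 * i < t) (j : ℤ) : v + s * i + t * j ∈ K ↔ j ≤ 0 := by
  obtain ⟨v', hv', h⟩ := h
  obtain rfl : v = v' := by omega
  exact h i h1 h2 j

/-- Summation over a `t`-closed set of a weight that is a difference quotient. -/
lemma pair_sub_shift {t : ℤ} {A B : Set ℤ} (hA : Maya A) (hB : Maya B) (W : ℤ → ℤ) :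
    pair A B (fun x => W (x + t) - W x) =
      pair {y | y + -t ∈ A} A W - pair {y | y + -t ∈ B} B W := by
  have h1 : pair A B (fun x => W (x + t)) = pair {y | y + -t ∈ A} {y | y + -t ∈ B} W := by
    rw [pair_shift]; simp only [sub_neg_eq_add]
  rw [pair_sub hA hB (fun x => W (x + t)), h1, pair_trans (hA.shift _) hA (hB.shift _),
    pair_trans hA hB (hB.shift _), pair_symm B]
  ring

section Columns

variable {s t v : ℤ}

/-- Shifting a t-closed set up by t adds just the first gap of each column. -/
lemma pair_shift_columns (ht : 0 < t) (hst : IsCoprime s t) (hv : 2 * v + 1 = -t) {R : Set ℤ}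
    {c : ℤ → ℤ} (hc : ∀ i j, v + s * i + t * j ∈ R ↔ j ≤ c i) (W : ℤ → ℤ) :
    pair {y | y + -t ∈ R} R W =
      ∑ i ∈ Finset.Icc (v + 1) (-v - 1), W (v + s * i + t * (c i + 1)) := by
  classical
  have hmem : ∀ i j, v + s * i + t * j ∈ {y | y + -t ∈ R} ↔ j ≤ c i + 1 := fun i j => by
    change v + s * i + t * j + -t ∈ R ↔ _
    rw [show v + s * i + t * j + -t = v + s * i + t * (j - 1) by ring, hc]; omega
  rw [pair_eq_sum ((Finset.Icc (v + 1) (-v - 1)).image fun i => v + s * i + t * (c i + 1)),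
    Finset.sum_image]
  · refine Finset.sum_congr rfl fun i _ => ?_
    rw [ind_of_mem ((hmem _ _).2 le_rfl), ind_of_notMem ((hc _ _).not.2 (by omega))]
    ring
  · intro i hi i' hi' h
    rw [Finset.mem_coe, Finset.mem_Icc] at hi hi'
    exact (coord_unique ht hst (by omega) (by omega) h).1
  · intro x hx
    obtain ⟨i, j, h1, h2, rfl⟩ := exists_coord ht hst hv x
    rw [ind_congr (A := {y | y + -t ∈ R}) (B := R) (y := v + s * i + t * j), sub_self, zero_mul]
    rw [hmem, hc]
    have : j ≠ c i + 1 := by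
      rintro rfl
      exact hx (Finset.mem_image.2 ⟨i, Finset.mem_Icc.2 (by omega), rfl⟩)
    omega

/-- The weights t and 2 * t * x are the differences W (x + t) - W x of W x = x and W x = x * (x -
t), so both sums telescope to the column tops. -/
lemma pair_columns (ht : 0 < t) (hst : IsCoprime s t) (hv : 2 * v + 1 = -t) {R K : Set ℤ}
    (hR : Maya R) (hK : Maya K) {c d : ℤ → ℤ} (hc : ∀ i j, v + s * i + t * j ∈ R ↔ j ≤ c i)
    (hd : ∀ i j, v + s * i + t * j ∈ K ↔ j ≤ d i) (hdz : ∀ i, -t < 2 * i → 2 * i < t → d i = 0) :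
    pair R K (fun _ => 1) = ∑ i ∈ Finset.Icc (v + 1) (-v - 1), c i ∧
    2 * pair R K id = ∑ i ∈ Finset.Icc (v + 1) (-v - 1), c i * (2 * s * i - 1 + t * c i) := by
  constructor
  · refine mul_left_cancel₀ ht.ne' ?_
    have := pair_sub_shift (t := t) hR hK id
    rw [pair_shift_columns ht hst hv hc, pair_shift_columns ht hst hv hd,
      ← Finset.sum_sub_distrib] at this
    rw [← pair_mul hR hK, Finset.mul_sum]
    convert this using 1
    · congr 1; ext x; simp
    · refine Finset.sum_congr rfl fun i hi => ?_
      rw [Finset.mem_Icc] at hi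
      rw [hdz i (by omega) (by omega)]
      simp only [id]; ring
  · refine mul_left_cancel₀ ht.ne' ?_
    have := pair_sub_shift (t := t) hR hK fun x => x * (x - t)
    rw [pair_shift_columns ht hst hv hc, pair_shift_columns ht hst hv hd,
      ← Finset.sum_sub_distrib] at this
    rw [← mul_assoc, ← pair_mul hR hK, Finset.mul_sum]
    convert this using 1
    · congr 1; ext x; simp only [id]; ring
    · refine Finset.sum_congr rfl fun i hi => ?_
      rw [Finset.mem_Icc] at hi
      rw [hdz i (by omega) (by omega)]
      linear_combination (-t * c i) * hv

lemma sum_sign {m i : ℤ} (h1 : -m ≤ i) (h2 : i ≤ m) :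
    ∑ j ∈ Finset.Icc (-m) m, ((if i < j then (1 : ℤ) else 0) - if j < i then 1 else 0) =
      -2 * i := by
  rw [Finset.sum_sub_distrib, Finset.sum_boole, Finset.sum_boole,
    show (Finset.Icc (-m) m).filter (fun j => i < j) = Finset.Ioc i m by ext j; simp; omega,
    show (Finset.Icc (-m) m).filter (fun j => j < i) = Finset.Ico (-m) i by ext j; simp; omega,
    Int.card_Ioc, Int.card_Ico]
  omega

/-- The quadratic form giving the size of a `t`-core, as a sum over pairs of columns. -/
lemma double_sum_identity {m s : ℤ} (hm : 0 ≤ m) (c : ℤ → ℤ)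
    (h0 : ∑ i ∈ Finset.Icc (-m) m, c i = 0) :
    ∑ i ∈ Finset.Icc (-m) m, ∑ j ∈ Finset.Icc (-m) m, ((c i - c j) ^ 2 -
      s * (((if i < j then (1 : ℤ) else 0) - if j < i then 1 else 0) * (c i - c j))) =
      2 * ∑ i ∈ Finset.Icc (-m) m, c i * (2 * s * i - 1 + (2 * m + 1) * c i) := by
  set I := Finset.Icc (-m) m with hI
  set e : ℤ → ℤ → ℤ := fun i j => (if i < j then (1 : ℤ) else 0) - if j < i then 1 else 0 with he
  have hcard : (I.card : ℤ) = 2 * m + 1 := by rw [hI, Int.card_Icc]; omega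
  have hsq : ∑ i ∈ I, ∑ j ∈ I, (c i - c j) ^ 2 = 2 * (2 * m + 1) * ∑ i ∈ I, c i ^ 2 := by
    have : ∀ i ∈ I, ∑ j ∈ I, (c i - c j) ^ 2 = (2 * m + 1) * c i ^ 2 + ∑ j ∈ I, c j ^ 2 := by
      intro i _
      have e1 : ∀ j ∈ I, (c i - c j) ^ 2 = c i ^ 2 - 2 * c i * c j + c j ^ 2 := fun j _ => by ring
      rw [Finset.sum_congr rfl e1, Finset.sum_add_distrib, Finset.sum_sub_distrib,
        Finset.sum_const, ← Finset.mul_sum, h0, nsmul_eq_mul, hcard]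
      ring
    rw [Finset.sum_congr rfl this, Finset.sum_add_distrib, Finset.sum_const, nsmul_eq_mul, hcard,
      ← Finset.mul_sum]
    ring
  have hlin : ∑ i ∈ I, ∑ j ∈ I, e i j * (c i - c j) = -4 * ∑ i ∈ I, i * c i := by
    have e1 : ∑ i ∈ I, ∑ j ∈ I, e i j * c i = -2 * ∑ i ∈ I, i * c i := by
      rw [Finset.mul_sum]
      refine Finset.sum_congr rfl fun i hi => ?_
      rw [hI, Finset.mem_Icc] at hi
      rw [← Finset.sum_mul, hI, he]
      simp only
      rw [sum_sign hi.1 hi.2]; ring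
    have e2 : ∑ i ∈ I, ∑ j ∈ I, e i j * c j = 2 * ∑ i ∈ I, i * c i := by
      rw [Finset.sum_comm]
      have : ∀ j ∈ I, ∑ i ∈ I, e i j * c j = -∑ i ∈ I, e j i * c j := fun j _ => by
        rw [← Finset.sum_neg_distrib]
        exact Finset.sum_congr rfl fun i _ => by simp only [he]; ring
      rw [Finset.sum_congr rfl this, Finset.sum_neg_distrib, e1]; ring
    simp only [mul_sub, Finset.sum_sub_distrib]
    rw [e1, e2]; ring
  have hR : ∑ i ∈ I, c i * (2 * s * i - 1 + (2 * m + 1) * c i) =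
      2 * s * (∑ i ∈ I, i * c i) + (2 * m + 1) * ∑ i ∈ I, c i ^ 2 := by
    have : ∀ i ∈ I, c i * (2 * s * i - 1 + (2 * m + 1) * c i) =
        2 * s * (i * c i) + (2 * m + 1) * c i ^ 2 - c i := fun i _ => by ring
    rw [Finset.sum_congr rfl this, Finset.sum_sub_distrib, h0, Finset.sum_add_distrib,
      ← Finset.mul_sum, ← Finset.mul_sum, sub_zero]
  have hL : ∑ i ∈ I, ∑ j ∈ I, ((c i - c j) ^ 2 - s * (e i j * (c i - c j))) =
      (∑ i ∈ I, ∑ j ∈ I, (c i - c j) ^ 2) - s * ∑ i ∈ I, ∑ j ∈ I, e i j * (c i - c j) := by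
    simp only [Finset.sum_sub_distrib, Finset.mul_sum]
  rw [hL, hsq, hlin, hR]
  ring

/-- The set with `IsKappa` is strictly larger than every other simultaneous core. -/
lemma IsKappa.size_lt (hs : 0 < s) (ht : 0 < t) (hst : IsCoprime s t) {K R : Set ℤ}
    (hK : Maya K) (cK : Closed t K) (kK : IsKappa s t K) (hR : Maya R) (cR : Closed s R)
    (cR' : Closed t R) (h0 : pair R K (fun _ => 1) = 0) (hne : R ≠ K) : size R < size K := by
  obtain ⟨v, hv, hcols⟩ := id kK
  choose c hc using fun i => cR'.exists_last ht hR (v + s * i)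
  choose d hd using fun i => cK.exists_last ht hK (v + s * i)
  have hdz : ∀ i, -t < 2 * i → 2 * i < t → d i = 0 := fun i h1 h2 => by
    have e1 := (hd i 0).symm.trans (hcols i h1 h2 0)
    have e2 := (hd i 1).symm.trans (hcols i h1 h2 1)
    omega
  obtain ⟨p1, p2⟩ := pair_columns ht hst hv hR hK hc hd hdz
  rw [h0] at p1
  set m := -v - 1 with hm
  have hvm : v + 1 = -m := by omega
  rw [hvm] at p1 p2
  have htm : t = 2 * m + 1 := by omega
  have hid := double_sum_identity (s := s) (m := m) (by omega) c p1.symm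
  rw [← htm, ← p2] at hid
  -- Closedness under s makes the heights decrease, and moving by t columns lowers them by exactly
  -- s. So for i < j in the window d = c i - c j lies in [0, s], and the summand d * (d - s) is at
  -- most 0.
  have hanti : ∀ i j, i ≤ j → c j ≤ c i := fun i j hij => by
    refine (hc i _).1 (cR.mul _ (k := j - i) (by omega) ?_)
    rw [show v + s * i + t * c j + s * (j - i) = v + s * j + t * c j by ring, hc]
  have hper : ∀ i j, j ≤ i + t → c i ≤ c j + s := fun i j hij => by
    have h1 := hanti _ _ hij
    have h2 : c (i + t) = c i - s := by
      have e : ∀ k, k ≤ c (i + t) ↔ k ≤ c i - s := fun k => by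
        rw [← hc (i + t) k, show v + s * (i + t) + t * k = v + s * i + t * (k + s) by ring, hc]
        omega
      have e1 := (e (c (i + t))).1 le_rfl
      have e2 := (e (c i - s)).2 le_rfl
      omega
    omega
  set D : ℤ → ℤ → ℤ := fun i j => (c i - c j) ^ 2 -
      s * (((if i < j then (1 : ℤ) else 0) - if j < i then 1 else 0) * (c i - c j)) with hD
  have hlt : ∀ i ∈ Finset.Icc (-m) m, ∀ j ∈ Finset.Icc (-m) m, i < j →
      D i j = (c i - c j) * (c i - c j - s) ∧ 0 ≤ c i - c j ∧ c i - c j ≤ s := by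
    intro i hi j hj hij
    rw [Finset.mem_Icc] at hi hj
    have h1 := hanti i j hij.le
    have h2 := hper i j (by omega)
    refine ⟨?_, by omega, by omega⟩
    simp only [hD, if_pos hij, if_neg (show ¬ j < i by omega)]
    ring
  have hgt : ∀ i j, D i j = D j i := fun i j => by simp only [hD]; ring
  have hDle : ∀ i ∈ Finset.Icc (-m) m, ∀ j ∈ Finset.Icc (-m) m, D i j ≤ 0 := by
    intro i hi j hj
    rcases lt_trichotomy i j with h | h | h
    · obtain ⟨e1, e2, e3⟩ := hlt i hi j hj h
      rw [e1]; exact mul_nonpos_of_nonneg_of_nonpos e2 (by omega)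
    · subst h; simp [hD]
    · obtain ⟨e1, e2, e3⟩ := hlt j hj i hi h
      rw [hgt, e1]; exact mul_nonpos_of_nonneg_of_nonpos e2 (by omega)
  have hsum : ∀ i ∈ Finset.Icc (-m) m, ∑ j ∈ Finset.Icc (-m) m, D i j ≤ 0 :=
    fun i hi => Finset.sum_nonpos (hDle i hi)
  have htot := Finset.sum_nonpos hsum
  have hsz : size R = size K + pair R K id := by
    unfold size; rw [pair_trans hR hK maya_vac]; ring
  by_contra hcon
  have hzero : ∑ i ∈ Finset.Icc (-m) m, ∑ j ∈ Finset.Icc (-m) m, D i j = 0 := by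
    have : ∑ i ∈ Finset.Icc (-m) m, ∑ j ∈ Finset.Icc (-m) m, D i j = 2 * (2 * pair R K id) := hid
    omega
  have hz1 := (Finset.sum_eq_zero_iff_of_nonpos hsum).1 hzero
  have hmm : m ∈ Finset.Icc (-m) m := Finset.mem_Icc.2 (by omega)
  -- In the extremal case every summand vanishes, so heights differ from the last one by 0 or s.
  -- Charge zero gives t * c m + s * N = 0 with N < t, and coprimality leaves N = 0 and all heights
  -- 0.
  have hstep : ∀ i ∈ Finset.Icc (-m) m, c i = c m ∨ c i = c m + s := by
    intro i hi
    have hz2 := (Finset.sum_eq_zero_iff_of_nonpos (hDle i hi)).1 (hz1 i hi) m hmm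
    rcases eq_or_ne i m with rfl | him
    · exact Or.inl rfl
    · have := Finset.mem_Icc.1 hi
      obtain ⟨e1, -, -⟩ := hlt i hi m hmm (by omega)
      rw [e1] at hz2
      rcases mul_eq_zero.1 hz2 with g | g
      · left; omega
      · right; omega
  have hE : ∑ i ∈ Finset.Icc (-m) m, c i = t * c m +
      s * (((Finset.Icc (-m) m).filter fun i => c i ≠ c m).card : ℤ) := by
    have : ∀ i ∈ Finset.Icc (-m) m, c i = c m + s * if c i ≠ c m then 1 else 0 := by
      intro i hi
      rcases hstep i hi with g | g
      · simp [g]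
      · rw [if_pos (by omega), g]; ring
    rw [Finset.sum_congr rfl this, Finset.sum_add_distrib, Finset.sum_const, ← Finset.mul_sum,
      Finset.sum_boole, nsmul_eq_mul, Int.card_Icc]
    congr 2
    omega
  have hcardlt : ((Finset.Icc (-m) m).filter fun i => c i ≠ c m).card < (Finset.Icc (-m) m).card :=
    Finset.card_lt_card (Finset.filter_ssubset.2 ⟨m, hmm, by simp⟩)
  rw [Int.card_Icc] at hcardlt
  have hdvd : t ∣ (((Finset.Icc (-m) m).filter fun i => c i ≠ c m).card : ℤ) :=
    hst.symm.dvd_of_dvd_mul_left (show t ∣ s * _ from ⟨-c m, by linear_combination -p1 - hE⟩)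
  have hcard0 := Int.eq_zero_of_dvd_of_nonneg_of_lt (by omega) (by omega) hdvd
  have hcm : c m = 0 := by
    rw [hcard0, ← p1, mul_zero, add_zero] at hE
    rcases mul_eq_zero.1 hE.symm with g | g <;> omega
  have hall : ∀ i ∈ Finset.Icc (-m) m, c i = 0 := by
    intro i hi
    have : ((Finset.Icc (-m) m).filter fun i => c i ≠ c m) = ∅ :=
      Finset.card_eq_zero.1 (by exact_mod_cast hcard0)
    have := (Finset.filter_eq_empty_iff.1 this) hi
    rw [not_not] at this
    omega
  refine hne (Set.ext fun x => ?_)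
  obtain ⟨i, j, h1, h2, rfl⟩ := exists_coord ht hst hv x
  rw [hc, hcols i h1 h2, hall i (Finset.mem_Icc.2 (by omega))]

end Columns

lemma exists_center_of_odd {t : ℤ} (h : Odd t) : ∃ v, 2 * v + 1 = -t := by
  obtain ⟨m, rfl⟩ := h
  exact ⟨-m - 1, by ring⟩

lemma exists_isKappa {s t : ℤ} (hs : 0 < s) (ht : 0 < t) (hst : IsCoprime s t) (hodd : Odd t) :
    ∃ K, Maya K ∧ Anti K ∧ Closed s K ∧ Closed t K ∧ IsKappa s t K := by
  obtain ⟨v, hv⟩ := exists_center_of_odd hodd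
  have hK : ∀ i, -t < 2 * i → 2 * i < t → ∀ j, (v + s * i + t * j ∈
      {x : ℤ | ∃ i j, (-t < 2 * i ∧ 2 * i < t) ∧ j ≤ 0 ∧ x = v + s * i + t * j} ↔ j ≤ 0) := by
    intro i h1 h2 j
    refine ⟨?_, fun h => ⟨i, j, ⟨h1, h2⟩, h, rfl⟩⟩
    rintro ⟨i', j', h3, h4, h5⟩
    rw [(coord_unique ht hst ⟨h1, h2⟩ h3 h5).2]
    exact h4
  generalize {x : ℤ | ∃ i j, (-t < 2 * i ∧ 2 * i < t) ∧ j ≤ 0 ∧ x = v + s * i + t * j} = K at hK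
  refine ⟨K, ⟨t + t + s * t, fun x hx => ?_, fun x hx => ?_⟩, fun x => ?_, fun x => ?_, fun x => ?_,
    v, hv, hK⟩
  · obtain ⟨i, j, h1, h2, rfl⟩ := exists_coord ht hst hv x
    rw [hK i h1 h2]
    by_contra hj
    nlinarith [mul_pos ht (show 0 < j by omega), mul_lt_mul_of_pos_left h1 hs]
  · obtain ⟨i, j, h1, h2, rfl⟩ := exists_coord ht hst hv x
    rw [hK i h1 h2]
    intro hj
    nlinarith [mul_nonneg ht.le (show 0 ≤ -j by omega), mul_lt_mul_of_pos_left h2 hs,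
      mul_pos hs ht]
  · obtain ⟨i, j, h1, h2, rfl⟩ := exists_coord ht hst hv x
    rw [show bar (v + s * i + t * j) = v + s * (-i) + t * (1 - j) by
      unfold bar; linear_combination -hv, hK i h1 h2, hK (-i) (by omega) (by omega)]
    omega
  · obtain ⟨i, j, h1, h2, rfl⟩ := exists_coord ht hst hv x
    by_cases h3 : 2 * (i + 1) < t
    · rw [show v + s * i + t * j + s = v + s * (i + 1) + t * j by ring, hK i h1 h2,
        hK (i + 1) (by omega) h3]
      exact id
    · have h4 : i = -v - 1 := by omega
      rw [hK i h1 h2, show v + s * i + t * j + s = v + s * (v + 1) + t * (j + s) by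
        rw [h4]; linear_combination -s * hv, hK (v + 1) (by omega) (by omega)]
      omega
  · obtain ⟨i, j, h1, h2, rfl⟩ := exists_coord ht hst hv x
    rw [show v + s * i + t * j + t = v + s * i + t * (j + 1) by ring, hK i h1 h2, hK i h1 h2]
    omega

/-! ### Uniqueness in C1, C2, C3 and C5. -/

lemma Equicharged.exists_mem {s : ℤ} {A B : Set ℤ} (hA : Maya A) (hB : Maya B)
    (h : Equicharged s A B) {x : ℤ} (hx : x ∈ A) (hx' : x ∉ B) :
    ∃ y, y ∈ B ∧ y ∉ A ∧ s ∣ y - x := by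
  by_contra hc
  push Not at hc
  have h0 := h _ (classInd_periodic s x)
  have h1 := term_le_pair hA hB (w := classInd s x) (fun y => ?_) x
  · rw [h0, ind_of_mem hx, ind_of_notMem hx', classInd_of_dvd (by simp)] at h1
    norm_num at h1
  · by_cases hy : s ∣ y - x
    · rw [classInd_of_dvd hy, mul_one]
      by_cases hyB : y ∈ B
      · rw [ind_of_mem hyB, ind_of_mem (by by_contra hyA; exact hc y hyB hyA hy), sub_self]
      · rw [ind_of_notMem hyB, sub_zero]; exact ind_nonneg _ _
    · rw [classInd_of_not_dvd hy, mul_zero]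

lemma not_closed_step {t : ℤ} {A : Set ℤ} (h : ¬ Closed t A) : ∃ x, x ∉ A ∧ x + t ∈ A := by
  unfold Closed at h
  push Not at h
  obtain ⟨x, h1, h2⟩ := h
  exact ⟨x, h2, h1⟩

/-- The closed set is the one of least size among the sets with given charges. -/
lemma Equicharged.size_le {t : ℤ} (ht : 0 < t) {A T : Set ℤ} (hA : Maya A)
    (h0 : pair A vac (fun _ => 1) = 0) (hT : Maya T) (cT : Closed t T) (h : Equicharged t A T) :
    size T ≤ size A := by
  induction hn : (size A).toNat using Nat.strong_induction_on generalizing A with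
  | _ n ih =>
    by_cases cA : Closed t A
    · rw [cA.eq_of_equicharged hA hT cT h]
    · obtain ⟨x, hx, hx'⟩ := not_closed_step cA
      have hM := hA.move (x + t) x
      have h0' : pair (move A (x + t) x) vac (fun _ => 1) = 0 := by
        rw [pair_trans hM hA maya_vac, pair_move hx' hx, h0]; rfl
      have hsz := size_move hA hx' hx
      have hnn := size_nonneg hM h0'
      have := ih _ (by omega) hM h0'
        ((equicharged_move hx' hx ⟨-1, by ring⟩).trans hM hA hT h) rfl
      omega

lemma Equicharged.eq_of_size_le {t : ℤ} (ht : 0 < t) {A T : Set ℤ} (hA : Maya A)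
    (h0 : pair A vac (fun _ => 1) = 0) (hT : Maya T) (cT : Closed t T) (h : Equicharged t A T)
    (hn : size A ≤ size T) : A = T := by
  by_cases cA : Closed t A
  · exact cA.eq_of_equicharged hA hT cT h
  · obtain ⟨x, hx, hx'⟩ := not_closed_step cA
    have hM := hA.move (x + t) x
    have := Equicharged.size_le ht hM
      (by rw [pair_trans hM hA maya_vac, pair_move hx' hx, h0]; rfl) hT cT
      ((equicharged_move hx' hx ⟨-1, by ring⟩).trans hM hA hT h)
    have hsz := size_move hA hx' hx
    omega

/-- Undoing any ascent by t already brings the size down to the minimum, which only the core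
attains; so A is one bead move away from T. -/
lemma Equicharged.eq_move_of_size_eq {t : ℤ} (ht : 0 < t) {A T : Set ℤ} (hA : Maya A)
    (h0 : pair A vac (fun _ => 1) = 0) (hT : Maya T) (cT : Closed t T) (h : Equicharged t A T)
    (hn : size A = size T + t) : ∃ x, x ∈ T ∧ x + t ∉ T ∧ A = CorePartitions.move T x (x + t) := by
  by_cases cA : Closed t A
  · rw [cA.eq_of_equicharged hA hT cT h] at hn
    omega
  · obtain ⟨x, hx, hx'⟩ := not_closed_step cA
    have hM := hA.move (x + t) x
    have hsz := size_move hA hx' hx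
    have hmv := move_move hx' hx
    have := Equicharged.eq_of_size_le ht hM
      (by rw [pair_trans hM hA maya_vac, pair_move hx' hx, h0]; rfl) hT cT
      ((equicharged_move hx' hx ⟨-1, by ring⟩).trans hM hA hT h) (by omega)
    rw [this] at hmv
    refine ⟨x, ?_, ?_, hmv.symm⟩ <;> rw [← this, mem_move]
    · exact Or.inr rfl
    · omega

section Backward

variable {s t : ℤ} {S T : Set ℤ}

lemma backward_trivial (hs : 0 < s) (hS : Maya S) (aS : Anti S) (cS : Closed s S) :
    ∃! A, IsSolution s t S S (size S) A :=
  ⟨S, ⟨hS, aS, .refl _ _, .refl _ _, rfl⟩, fun _ h =>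
    h.equi_s.eq_of_size_le hs h.maya h.anti.charge hS cS h.size_eq.le⟩

lemma eq_add_of_modEq {b v : ℤ} (hv : 2 * v + 1 = -t) (hb : bar b - b ≡ t [ZMOD 2 * s]) :
    ∃ k, b = v + s * k := by
  obtain ⟨k, hk⟩ := hb.dvd
  unfold bar at hk
  refine ⟨k, ?_⟩
  have : 2 * (b - (v + s * k)) = 0 := by linear_combination hk - hv
  omega

lemma backward_single (ht : 0 < t) (hodd : Odd t) (hT : Maya T) (aT : Anti T)
    (cT : Closed t T) (h : SetSwap s t S T) : ∃! A, IsSolution s t S T (size T + t) A := by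
  obtain ⟨v, hv⟩ := exists_center_of_odd hodd
  have hvT := center_mem aT cT hv
  have hvT' := center_add_notMem aT cT hv
  refine ⟨move T v (v + t), ⟨hT.move _ _, aT.move_center hv hvT, ?_,
    equicharged_move hvT hvT' ⟨1, by ring⟩, ?_⟩, fun A h' => ?_⟩
  · obtain ⟨b, ⟨hb, -⟩, hmod, rfl⟩ := h
    obtain ⟨k, rfl⟩ := eq_add_of_modEq hv hmod
    have hbar := aT.bar_notMem hb
    intro w hw
    have h1 := pair_move hb hbar w
    change pair (move T v (v + t)) (move T (v + s * k) (bar (v + s * k))) w = 0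
    rw [pair_trans (hT.move _ _) hT (hT.move _ _), pair_move hvT hvT', pair_symm T, h1,
      show bar (v + s * k) = v + t + s * (-k) by unfold bar; linear_combination -hv,
      periodic_mul hw, periodic_mul hw]
    ring
  · rw [size_move hT hvT hvT']; ring
  · obtain ⟨x, hx, hx', rfl⟩ :=
      h'.equi_t.eq_move_of_size_eq ht h'.maya h'.anti.charge hT cT h'.size_eq
    have h1 : bar x ∈ move T x (x + t) := h'.anti.bar_mem (by rw [mem_move]; omega)
    rw [mem_move] at h1
    have h2 := aT.bar_notMem hx
    -- The moved bead must land on its own mirror image, which pins x to the centre v.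
    have h3 : bar x = x + t := by tauto
    unfold bar at h3
    rw [show x = v by omega]

/-- The height J is an affine function of x up to a t-periodic term, so the relative sum of 2 * J -
1 is fixed by charges and size: it is 2 * s. As S consists of the x with J x ≤ 0, all terms are
nonnegative. A gained and a lost bead in the same class modulo s already contribute 2 * s, so they
are the only changes. Equal t-charges and the reflection then identify them. -/
lemma backward_kappa (hs : 0 < s) (ht : 0 < t) (hst : IsCoprime s t) (hos : Odd s) (hot : Odd t)
    (hS : Maya S) (aS : Anti S) (cS : Closed s S) (kS : IsKappa s t S) :
    ∃! A, IsSolution s t S S (size S + s * t) A := by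
  obtain ⟨b, hb⟩ := exists_center_of_odd (hos.mul hot)
  refine ⟨_, isSolution_move_mul ht.le hS aS cS hb, fun A hA => ?_⟩
  obtain ⟨v, hv⟩ := exists_center_of_odd hot
  have kS := fun i h1 h2 j => kS.of_center hv (i := i) h1 h2 j
  choose I J hI1 hI2 hIJ using exists_coord ht hst hv
  have hmem : ∀ x, x ∈ S ↔ J x ≤ 0 := fun x => by
    have := kS (I x) (hI1 x) (hI2 x) (J x)
    rwa [← hIJ] at this
  have hper : ∀ x, I (x + t) = I x := fun x =>
    (coord_unique (v := v) (j := J (x + t)) (j' := J x + 1) ht hst ⟨hI1 _, hI2 _⟩ ⟨hI1 _, hI2 _⟩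
      (by rw [← hIJ]; linear_combination hIJ x)).1
  have hpair : pair A S (fun x => 2 * J x - 1) = 2 * s := by
    have e1 : pair A S (fun x => t * (2 * J x - 1)) =
        pair A S (fun x => 2 * id x - (2 * s * I x - 1)) :=
      pair_congr fun x _ => by simp only [id]; linear_combination -hv - 2 * hIJ x
    rw [pair_mul hA.maya hS, pair_sub hA.maya hS (fun x => 2 * id x), pair_mul hA.maya hS,
      hA.equi_t (fun x => 2 * s * I x - 1) (fun x => by rw [hper])] at e1
    have e2 := hA.size_eq
    unfold size at e2
    rw [pair_trans hA.maya hS maya_vac] at e2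
    refine mul_left_cancel₀ ht.ne' ?_
    linear_combination e1 + 2 * e2
  have hterm : ∀ x, 0 ≤ (ind A x - ind S x) * (2 * J x - 1) := by
    intro x
    by_cases h : x ∈ S
    · have := (hmem x).1 h
      have := ind_le_one A x
      rw [ind_of_mem h]
      exact mul_nonneg_of_nonpos_of_nonpos (by omega) (by omega)
    · have := (hmem x).not.1 h
      rw [ind_of_notMem h, sub_zero]
      exact mul_nonneg (ind_nonneg _ _) (by omega)
  obtain ⟨x, hxA, hxS, y, hyS, hyA, hsxy⟩ :
      ∃ x, x ∈ A ∧ x ∉ S ∧ ∃ y, y ∈ S ∧ y ∉ A ∧ s ∣ y - x := by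
    have hne : A ≠ S := by
      rintro rfl
      rw [pair_self] at hpair
      omega
    have : ∃ z, ¬ (z ∈ A ↔ z ∈ S) := by
      by_contra hc
      push Not at hc
      exact hne (Set.ext hc)
    obtain ⟨z, hz⟩ := this
    by_cases hzA : z ∈ A
    · have hzS : z ∉ S := by tauto
      obtain ⟨y, hy⟩ := hA.equi_s.exists_mem hA.maya hS hzA hzS
      exact ⟨z, hzA, hzS, y, hy⟩
    · have hzS : z ∈ S := by tauto
      obtain ⟨y, hy1, hy2, hy3⟩ := hA.equi_s.symm.exists_mem hS hA.maya hzS hzA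
      exact ⟨y, hy1, hy2, z, hzS, hzA, (dvd_sub_comm).1 hy3⟩
  have hJx := (hmem x).not.1 hxS
  have hJy := (hmem y).1 hyS
  have hge : s ≤ J x - J y := by
    refine Int.le_of_dvd (by omega) (hst.dvd_of_dvd_mul_left (show s ∣ t * _ from ?_))
    obtain ⟨k, hk⟩ := hsxy
    exact ⟨-k - I x + I y, by linear_combination -hk + hIJ y - hIJ x⟩
  have hxy : x ≠ y := fun h => hyA (h ▸ hxA)
  have hle := sum_le_pair hA.maya hS hterm {x, y}
  rw [hpair, Finset.sum_pair hxy, ind_of_mem hxA, ind_of_notMem hxS, ind_of_mem hyS,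
    ind_of_notMem hyA] at hle
  have honly : ∀ z, z ≠ x → z ≠ y → (z ∈ A ↔ z ∈ S) := by
    intro z hzx hzy
    have hle := sum_le_pair hA.maya hS hterm {x, y, z}
    rw [hpair, Finset.sum_insert (by simp [hxy, hzx.symm]), Finset.sum_pair hzy.symm,
      ind_of_mem hxA, ind_of_notMem hxS, ind_of_mem hyS, ind_of_notMem hyA] at hle
    -- No budget is left for z, and the weight is odd, hence nonzero; so A and S agree at z.
    have h0 : (ind A z - ind S z) * (2 * J z - 1) = 0 := le_antisymm (by omega) (hterm z)
    rcases mul_eq_zero.1 h0 with h1 | h1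
    · exact ind_eq_iff.1 (by omega)
    · omega
  obtain ⟨y', hy'S, hy'A, ht'⟩ := hA.equi_t.exists_mem hA.maya hS hxA hxS
  obtain rfl : y' = y := by
    by_contra hc
    exact hy'A ((honly y' (fun h => hy'A (h ▸ hxA)) hc).2 hy'S)
  have hII : I x = I y' := by
    obtain ⟨k, hk⟩ := ht'
    exact (coord_unique (v := v) (j := J x) (j' := J y' - k) ht hst ⟨hI1 _, hI2 _⟩
      ⟨hI1 _, hI2 _⟩ (by rw [← hIJ]; linear_combination hIJ y' - hk)).1
  have hx : x = y' + s * t := by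
    have h1 := hIJ x
    have h2 := hIJ y'
    have : J x = J y' + s := by omega
    rw [hII, this] at h1
    linear_combination h1 - h2
  have hbx : bar x = y' := by
    by_contra hc
    have h1 := hA.anti.bar_notMem hxA
    have h2 := aS.bar_mem hxS
    exact h1 ((honly _ (fun h => h1 (by rwa [h])) hc).2 h2)
  have hyb : y' = b := by
    unfold bar at hbx
    omega
  subst hyb
  ext z
  rw [mem_move, ← hx]
  by_cases h1 : z = x
  · simp [h1, hxA]
  · by_cases h2 : z = y'
    · simp [h2, hyA, hxy.symm]
    · simp [h1, h2, honly z h1 h2]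

end Backward

/-! ### Uniqueness in C4: a weight with zero relative sum. -/

/-- If a weight increasing along the `s`-rows balances a set against its `s`-core, then the two sets
differ only where the weight is constant up to the end of the row of the core. -/
lemma eq_of_pair_eq_zero {s : ℤ} (hs : 0 < s) {A S : Set ℤ} (hA : Maya A) (hS : Maya S)
    (cS : Closed s S) (h : Equicharged s A S) {g : ℤ → ℤ} (hg : ∀ x, g x ≤ g (x + s))
    (h0 : pair A S g = 0) (x : ℤ) :
    (x ∈ A → x ∉ S → ∀ j < 0, x + s * (j + 1) ∉ S → g (x + s * j) = g (x + s * (j + 1))) ∧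
    (x ∈ S → x ∉ A → ∀ j ≥ 0, x + s * j ∈ S → g (x + s * j) = g (x + s * (j + 1))) := by
  choose L hL using cS.exists_last hs hS
  have hmono : ∀ x a b, a ≤ b → g (x + s * a) ≤ g (x + s * b) := by
    intro x a b hab
    obtain ⟨n, rfl⟩ := Int.le.dest hab
    clear hab
    induction n with
    | zero => simp
    | succ n ih =>
      refine ih.trans ((hg _).trans_eq (congrArg g ?_))
      push_cast; ring
  have hLper : ∀ x, L (x + s) = L x - 1 := by
    intro x
    have key : ∀ j, j ≤ L (x + s) ↔ j ≤ L x - 1 := fun j => by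
      rw [← hL, show x + s + s * j = x + s * (j + 1) by ring, hL]; omega
    exact le_antisymm ((key _).1 le_rfl) ((key _).2 le_rfl)
  have hper : ∀ x, g (x + s + s * L (x + s)) + g (x + s + s * (L (x + s) + 1)) =
      g (x + s * L x) + g (x + s * (L x + 1)) := by
    intro x
    rw [hLper, show x + s + s * (L x - 1) = x + s * L x by ring,
      show x + s + s * (L x - 1 + 1) = x + s * (L x + 1) by ring]
  have hx0 : x + s * 0 = x := by ring
  -- The subtracted term depends only on the class modulo s, being read at the last bead of S and
  -- the first gap; it costs nothing because the s-charges agree. After the correction the weight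
  -- changes sign at the end of each row of S, so all terms are nonnegative and hence zero.
  have hW : pair A S (fun x => 2 * g x - (g (x + s * L x) + g (x + s * (L x + 1)))) = 0 := by
    rw [pair_sub hA hS (fun x => 2 * g x), pair_mul hA hS, h0, h _ hper]; ring
  have hin : ∀ x, x ∈ S ↔ 0 ≤ L x := fun x => by rw [← hL, mul_zero, add_zero]
  have hterm : ∀ x, 0 ≤ (ind A x - ind S x) *
      (2 * g x - (g (x + s * L x) + g (x + s * (L x + 1)))) := by
    intro x
    by_cases hx : x ∈ S
    · have h1 := hmono x 0 _ ((hin x).1 hx)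
      have h2 := hmono x (L x) (L x + 1) (by omega)
      rw [mul_zero, add_zero] at h1
      have := ind_le_one A x
      rw [ind_of_mem hx]
      exact mul_nonneg_of_nonpos_of_nonpos (by omega) (by omega)
    · have h1 := hmono x (L x + 1) 0 (by have := (hin x).not.1 hx; omega)
      have h2 := hmono x (L x) (L x + 1) (by omega)
      rw [mul_zero, add_zero] at h1
      rw [ind_of_notMem hx, sub_zero]
      exact mul_nonneg (ind_nonneg _ _) (by omega)
  have hz := (term_le_pair hA hS hterm x).trans_eq hW
  refine ⟨fun hxA hxS j hj hj' => ?_, fun hxS hxA j hj hj' => ?_⟩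
  · rw [ind_of_mem hxA, ind_of_notMem hxS] at hz
    have hj'' := (hL x _).not.1 hj'
    have h1 := hmono x (L x) j (by omega)
    have h2 := hmono x j (j + 1) (by omega)
    have h3 := hmono x (j + 1) 0 (by omega)
    have h4 := hmono x (L x + 1) 0 (by omega)
    have h5 := hmono x (L x) (L x + 1) (by omega)
    rw [mul_zero, add_zero] at h3 h4
    omega
  · rw [ind_of_notMem hxA, ind_of_mem hxS] at hz
    have hj'' := (hL x _).1 hj'
    have h1 := hmono x 0 j (by omega)
    have h2 := hmono x j (j + 1) (by omega)
    have h3 := hmono x (j + 1) (L x + 1) (by omega)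
    have h4 := hmono x 0 (L x) (by omega)
    have h5 := hmono x (L x) (L x + 1) (by omega)
    rw [mul_zero, add_zero] at h1 h4
    omega

/-- `I` and `J` are the coordinates of an integer on the grid `v + s * i + t * j`. -/
structure IsCoord (s t v m : ℤ) (I J : ℤ → ℤ) : Prop where
  cop : IsCoprime s t
  m_nonneg : 0 ≤ m
  t_eq : t = 2 * m + 1
  center : 2 * v + 1 = -t
  lo : ∀ x, -m ≤ I x
  hi : ∀ x, I x ≤ m
  eq : ∀ x, x = v + s * I x + t * J x

lemma exists_isCoord {s t v m : ℤ} (hst : IsCoprime s t) (hm : 0 ≤ m) (ht : t = 2 * m + 1)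
    (hv : 2 * v + 1 = -t) : ∃ I J, IsCoord s t v m I J := by
  choose I J h1 h2 h3 using exists_coord (show 0 < t by omega) hst hv
  exact ⟨I, J, hst, hm, ht, hv, fun x => by have := h1 x; omega,
    fun x => by have := h2 x; omega, h3⟩

namespace IsCoord

variable {s t v m : ℤ} {I J : ℤ → ℤ}

lemma of_eq (h : IsCoord s t v m I J) {x i j : ℤ} (h1 : -m ≤ i) (h2 : i ≤ m)
    (hx : x = v + s * i + t * j) : I x = i ∧ J x = j := by
  have := h.t_eq
  have := h.m_nonneg
  have := h.lo x
  have := h.hi x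
  exact coord_unique (v := v) (by omega) h.cop (by omega) (by omega) (by rw [← h.eq, hx])

lemma bar (h : IsCoord s t v m I J) (x : ℤ) : I (bar x) = -I x ∧ J (bar x) = 1 - J x := by
  have := h.lo x
  have := h.hi x
  exact h.of_eq (by omega) (by omega)
    (by unfold CorePartitions.bar; linear_combination -h.eq x - h.center)

lemma add_t (h : IsCoord s t v m I J) (x : ℤ) : I (x + t) = I x ∧ J (x + t) = J x + 1 :=
  h.of_eq (h.lo x) (h.hi x) (by linear_combination h.eq x)

lemma add_s (h : IsCoord s t v m I J) {x : ℤ} (hx : I x < m) :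
    I (x + s) = I x + 1 ∧ J (x + s) = J x := by
  have := h.lo x
  exact h.of_eq (by omega) (by omega) (by linear_combination h.eq x)

lemma add_s_of_eq (h : IsCoord s t v m I J) {x : ℤ} (hx : I x = m) : I (x + s) = -m := by
  have := h.m_nonneg
  refine (h.of_eq (j := J x + s) (by omega) (by omega) ?_).1
  have := h.eq x
  rw [hx] at this
  linear_combination this - s * h.t_eq

lemma of_dvd (h : IsCoord s t v m I J) {x y : ℤ} (hd : t ∣ y - x) : I y = I x := by
  obtain ⟨k, hk⟩ := hd
  exact (h.of_eq (j := J x + k) (h.lo x) (h.hi x) (by linear_combination hk + h.eq x)).1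

end IsCoord

/-- A function of the first coordinate which compensates the growth of `2 * x + 1` along the stretch
from `-k` to `k` and at the passage from `m` to `-m`. -/
def potential (s k m i : ℤ) : ℤ :=
  if -k ≤ i ∧ i ≤ k then 2 * s * i else if i = m then -s else if i = -m then s else 0

lemma potential_step {s k m i : ℤ} (hs : 0 < s) (hk : 1 ≤ k) (hkm : k < m) (hi : i < m) :
    potential s k m (i + 1) ≤ 2 * s + potential s k m i ∧
      (potential s k m (i + 1) = 2 * s + potential s k m i → -k ≤ i ∧ i < k) := by
  have hsk := mul_pos hs (show 0 < k by omega)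
  by_cases h1 : -k ≤ i ∧ i ≤ k
  · by_cases h2 : i = k
    · subst h2
      have : 2 * s * i = 2 * (s * i) := by ring
      unfold potential
      split_ifs <;> omega
    · have : 2 * s * (i + 1) = 2 * s + 2 * s * i := by ring
      unfold potential
      split_ifs <;> omega
  · by_cases h2 : i + 1 = -k
    · have : 2 * s * (i + 1) = -2 * (s * k) := by rw [h2]; ring
      unfold potential
      split_ifs <;> omega
    · unfold potential
      split_ifs <;> omega

lemma potential_wrap {s k m : ℤ} (hk : 1 ≤ k) (hkm : k < m) :
    potential s k m (-m) = 2 * s + potential s k m m := by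
  unfold potential
  split_ifs <;> omega

/-- A step by s raises 2 * x + 1 by 2 * s, and the potential absorbs all of it only inside the
stretch and at the wrap-around. These are the only places where a solution may depart from S. -/
lemma IsCoord.weight_step {s t v m k : ℤ} {I J : ℤ → ℤ} (h : IsCoord s t v m I J) (hs : 0 < s)
    (hk : 1 ≤ k) (hkm : k < m) (x : ℤ) :
    2 * x + 1 - potential s k m (I x) ≤ 2 * (x + s) + 1 - potential s k m (I (x + s)) ∧
      (2 * x + 1 - potential s k m (I x) = 2 * (x + s) + 1 - potential s k m (I (x + s)) →
        (-k ≤ I x ∧ I x < k) ∨ I x = m) := by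
  by_cases hx : I x = m
  · rw [h.add_s_of_eq hx, hx, potential_wrap hk hkm]
    omega
  · have hx' : I x < m := lt_of_le_of_ne (h.hi x) hx
    rw [(h.add_s hx').1]
    have := potential_step hs hk hkm hx'
    omega

/-- If `v + s * k` lies in a self-conjugate core then `k` is small. -/
lemma two_mul_lt_of_mem {s t v k : ℤ} {R : Set ℤ} (hs : 0 < s) (aR : Anti R)
    (cR : Closed s R) (cR' : Closed t R) (hv : 2 * v + 1 = -t) (h : v + s * k ∈ R) :
    2 * k < t := by
  by_contra hc
  have h1 : v + s * (t - k) ∈ R := cR.mul _ (show 0 ≤ 2 * k - t by omega) (by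
    rwa [show v + s * (t - k) + s * (2 * k - t) = v + s * k by ring])
  refine aR.bar_notMem h (cR'.mul _ (show 0 ≤ s - 1 by omega) ?_)
  rwa [show bar (v + s * k) + t * (s - 1) = v + s * (t - k) by
    unfold bar; linear_combination -hv]

/-- Two self-conjugate cores which differ by the reflection of two elements. -/
structure SwapConfig (s t k l m v u : ℤ) (S T : Set ℤ) : Prop where
  hs : 1 < s
  ht : 1 < t
  cop : IsCoprime s t
  t_eq : t = 2 * m + 1
  center_t : 2 * v + 1 = -t
  center_s : 2 * u + 1 = -s
  hk : 1 ≤ k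
  hl : 1 ≤ l
  mS : Maya S
  mT : Maya T
  aS : Anti S
  aT : Anti T
  cS : Closed s S
  cS' : Closed t S
  cT : Closed s T
  cT' : Closed t T
  bT : v + s * k ∈ T
  bS : v + s * k ∉ S
  dT : u + s - t * l ∈ T
  dS : u + s - t * l ∉ S
  eq : S = move (move T (u + s - t * l) (bar (u + s - t * l))) (v + s * k) (bar (v + s * k))

namespace SwapConfig

variable {s t k l m v u : ℤ} {S T : Set ℤ}

lemma d_ne_b (h : SwapConfig s t k l m v u S T) : u + s - t * l ≠ v + s * k := by
  have := h.hs; have := h.ht; have := h.hk; have := h.hl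
  intro he
  have h1 : s * (2 * k - 1) = t * (1 - 2 * l) := by
    linear_combination -2 * he + h.center_s - h.center_t
  have := mul_pos (show 0 < s by omega) (show 0 < 2 * k - 1 by omega)
  have := mul_pos (show 0 < t by omega) (show 0 < 2 * l - 1 by omega)
  have : t * (1 - 2 * l) = -(t * (2 * l - 1)) := by ring
  omega

lemma d_ne_b_sub_s (h : SwapConfig s t k l m v u S T) : u + s - t * l ≠ v + s * k - s := by
  have := h.hs; have := h.ht; have := h.hk; have := h.hl
  intro he
  have h1 : s * (2 * k - 3) = t * (1 - 2 * l) := by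
    linear_combination -2 * he + h.center_s - h.center_t
  have := mul_pos (show 0 < t by omega) (show 0 < 2 * l - 1 by omega)
  have : t * (1 - 2 * l) = -(t * (2 * l - 1)) := by ring
  have h2 : s * (2 * k - 3) < 0 := by omega
  have h3 := neg_of_mul_neg_right h2 (by omega)
  obtain rfl : k = 1 := by omega
  have h4 : t ∣ s := ⟨2 * l - 1, by linear_combination -h1⟩
  have := Int.le_of_dvd one_pos (h.cop.symm.dvd_of_dvd_mul_left (show t ∣ s * 1 by rwa [mul_one]))
  omega

lemma d_ne_b_sub_t (h : SwapConfig s t k l m v u S T) : u + s - t * l ≠ v + s * k - t := by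
  have := h.hs; have := h.ht; have := h.hk; have := h.hl
  intro he
  have h1 : s * (2 * k - 1) = t * (3 - 2 * l) := by
    linear_combination -2 * he + h.center_s - h.center_t
  have h2 := mul_pos (show 0 < s by omega) (show 0 < 2 * k - 1 by omega)
  have h3 := pos_of_mul_pos_right (h1 ▸ h2) (by omega)
  obtain rfl : l = 1 := by omega
  have h4 : s ∣ t * 1 := ⟨2 * k - 1, by linear_combination -h1⟩
  have := Int.le_of_dvd one_pos (h.cop.dvd_of_dvd_mul_left h4)
  omega

lemma bar_b_notMem (h : SwapConfig s t k l m v u S T) : bar (v + s * k) ∉ T :=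
  h.aT.bar_notMem h.bT

lemma bar_d_notMem (h : SwapConfig s t k l m v u S T) : bar (u + s - t * l) ∉ T :=
  h.aT.bar_notMem h.dT

lemma bar_b (h : SwapConfig s t k l m v u S T) : bar (v + s * k) = v + t + s * (-k) := by
  unfold bar; linear_combination -h.center_t

lemma bar_d (h : SwapConfig s t k l m v u S T) : bar (u + s - t * l) = u + t * l := by
  unfold bar; linear_combination -h.center_s

lemma mem_of_mem_T (h : SwapConfig s t k l m v u S T) {x : ℤ} (hx : x ∈ T)
    (h1 : x ≠ v + s * k) (h2 : x ≠ u + s - t * l) : x ∈ S := by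
  rw [h.eq, mem_move, mem_move]; tauto

lemma mem_T_of_mem (h : SwapConfig s t k l m v u S T) {x : ℤ} (hx : x ∈ S)
    (h1 : x ≠ bar (v + s * k)) (h2 : x ≠ bar (u + s - t * l)) : x ∈ T := by
  rw [h.eq, mem_move, mem_move] at hx; tauto

/-- The beta-set of the intermediate core. -/
lemma mem_mid_iff (h : SwapConfig s t k l m v u S T) {x : ℤ} :
    x ∈ move T (u + s - t * l) (bar (u + s - t * l)) ↔
      (x ∈ S ∧ x ≠ bar (v + s * k)) ∨ x = v + s * k := by
  have h1 := h.bar_b_notMem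
  have h2 := h.d_ne_b
  have h3 : bar (u + s - t * l) ≠ bar (v + s * k) := fun he => h2 (bar_inj.1 he)
  have h4 : bar (v + s * k) ≠ u + s - t * l := fun he => h1 (he ▸ h.dT)
  have h5 := h.bT
  rw [h.eq, mem_move, mem_move, mem_move]
  by_cases hx : x = v + s * k
  · subst hx
    simp [h5, h2.symm]
  · by_cases hx' : x = bar (v + s * k)
    · subst hx'
      simp only [h1, h3.symm, hx]
      tauto
    · tauto

lemma mid_eq (h : SwapConfig s t k l m v u S T) :
    move T (u + s - t * l) (bar (u + s - t * l)) = move S (bar (v + s * k)) (v + s * k) :=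
  Set.ext fun x => by rw [h.mem_mid_iff, mem_move]

lemma mid_closed (h : SwapConfig s t k l m v u S T) {r : ℤ} (hS : Closed r S) (hT : Closed r T)
    (hr : u + s - t * l ≠ v + s * k - r) :
    Closed r (move T (u + s - t * l) (bar (u + s - t * l))) := by
  intro x hx
  by_contra hc
  have h1 := h.mem_mid_iff.1 hx
  have h2 := h.mem_mid_iff.not.1 hc
  rw [mem_move] at hx hc
  have h3 := hS x
  have h4 := hT x
  have h5 : bar (u + s - t * l) ≠ v + s * k := fun he => h.bar_d_notMem (he ▸ h.bT)
  have h6 : u + s - t * l ≠ bar (v + s * k) := fun he => h.bar_b_notMem (he ▸ h.dT)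
  have h7 : x + r = bar (u + s - t * l) ∨ x = u + s - t * l := by tauto
  have h8 : x + r = v + s * k ∨ x = bar (v + s * k) := by tauto
  unfold bar at *
  omega

/-- The general bound gives k ≤ m. If k = m, then `bar (v + s * k)` lies below u + s - t * l in the
same class modulo t, so t-closedness would put it into T. -/
lemma k_lt (h : SwapConfig s t k l m v u S T) : k < m := by
  have h1 := two_mul_lt_of_mem (by linarith [h.hs]) h.aT h.cT h.cT' h.center_t
    h.bT
  have h2 := two_mul_lt_of_mem (k := l) (by linarith [h.ht]) h.aS h.cS' h.cS
    h.center_s (by rw [← h.bar_d]; exact h.aS.bar_mem h.dS)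
  have := h.t_eq
  refine lt_of_le_of_ne (by omega) fun hkm => h.bar_b_notMem ?_
  refine h.cT'.mul _ (show 0 ≤ -u - 1 - l by have := h.center_s; omega) ?_
  have h3 : bar (v + s * k) + t * (-u - 1 - l) = u + s - t * l := by
    unfold bar
    rw [hkm]
    have := h.center_t
    have := h.center_s
    have e : m = -v - 1 := by omega
    rw [e]
    linear_combination -(1 + u) * h.center_t + v * h.center_s
  rw [h3]
  exact h.dT

end SwapConfig

namespace SwapConfig

variable {s t k l m v u : ℤ} {S T : Set ℤ} {I J : ℤ → ℤ} {A : Set ℤ}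

lemma pair_S_T (h : SwapConfig s t k l m v u S T) (w : ℤ → ℤ) :
    pair S T w = w (bar (v + s * k)) - w (v + s * k) +
      (w (bar (u + s - t * l)) - w (u + s - t * l)) := by
  have h1 : v + s * k ∈ move T (u + s - t * l) (bar (u + s - t * l)) :=
    h.mem_mid_iff.2 (Or.inr rfl)
  have h2 : bar (v + s * k) ∉ move T (u + s - t * l) (bar (u + s - t * l)) := by
    rw [h.mem_mid_iff]
    have := bar_ne (v + s * k)
    tauto
  have h3 := pair_move h1 h2 w
  rw [← h.eq] at h3
  rw [pair_trans h.mS (h.mT.move _ _) h.mT, h3, pair_move h.dT h.bar_d_notMem]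

lemma size_mid (h : SwapConfig s t k l m v u S T) :
    size (move T (u + s - t * l) (bar (u + s - t * l))) =
      size S + (2 * (v + s * k) + 1) := by
  rw [h.mid_eq, size_move h.mS (h.aS.bar_mem h.bS) h.bS]
  unfold bar; ring

lemma coord_b (h : SwapConfig s t k l m v u S T) (hc : IsCoord s t v m I J) :
    I (v + s * k) = k :=
  (hc.of_eq (j := 0) (by linarith [h.hk, h.k_lt]) h.k_lt.le (by ring)).1

lemma coord_left (h : SwapConfig s t k l m v u S T) (hc : IsCoord s t v m I J) (j : ℤ) :
    I (u + s + t * j) = -m := by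
  refine (hc.of_eq (j := -u + j) le_rfl (by linarith [hc.m_nonneg]) ?_).1
  have e : m = -v - 1 := by have := h.center_t; have := h.t_eq; omega
  rw [e]
  linear_combination -v * h.center_s + u * h.center_t

lemma exists_left (h : SwapConfig s t k l m v u S T) (hc : IsCoord s t v m I J) {x : ℤ}
    (hx : I x = -m) : ∃ j, x = u + s + t * j := by
  refine ⟨J x + u, ?_⟩
  have e : m = -v - 1 := by have := h.center_t; have := h.t_eq; omega
  have := hc.eq x
  rw [hx, e] at this
  linear_combination this + v * h.center_s - u * h.center_t

/-- The part 2 * x + 1 is given by the sizes. The potential is a function of I, hence t-periodic, so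
A may be replaced by T and only the two swapped pairs contribute; the boundary values of `potential`
make the total vanish. -/
lemma pair_weight (h : SwapConfig s t k l m v u S T) (hc : IsCoord s t v m I J)
    (hA : IsSolution s t S T
      (size (move T (u + s - t * l) (bar (u + s - t * l))) + s + t) A) :
    pair A S (fun x => 2 * x + 1 - potential s k m (I x)) = 0 := by
  have hk := h.hk
  have hkm := h.k_lt
  have e1 : pair A S (fun x => 2 * id x) = 2 * (size A - size S) := by
    unfold size
    rw [pair_mul hA.maya h.mS, pair_trans hA.maya h.mS maya_vac]; ring
  have e2 : pair A S (fun x => 2 * x + 1) = pair A S (fun x => 2 * id x) := by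
    rw [pair_add hA.maya h.mS (fun x => 2 * x), hA.equi_s (fun _ => 1) fun _ => rfl, add_zero]
    rfl
  have hd : I (u + s - t * l) = -m := by
    rw [sub_eq_add_neg, ← mul_neg]; exact h.coord_left hc _
  have p1 : potential s k m k = 2 * s * k := if_pos (by omega)
  have p2 : potential s k m (-k) = 2 * s * (-k) := if_pos (by omega)
  have p3 : potential s k m m = -s := by unfold potential; split_ifs <;> omega
  have p4 : potential s k m (-m) = s := by unfold potential; split_ifs <;> omega
  rw [pair_sub hA.maya h.mS (fun x => 2 * x + 1), e2, e1, hA.size_eq, h.size_mid,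
    pair_trans hA.maya h.mT h.mS (fun x => potential s k m (I x)),
    hA.equi_t (fun x => potential s k m (I x)) (fun x => by rw [(hc.add_t x).1]),
    pair_symm T S, h.pair_S_T, (hc.bar _).1, (hc.bar _).1, hd, h.coord_b hc, neg_neg, p1, p2, p3,
    p4]
  linear_combination 2 * h.center_t

lemma step_of_notMem_S (h : SwapConfig s t k l m v u S T) (hc : IsCoord s t v m I J)
    (hA : IsSolution s t S T
      (size (move T (u + s - t * l) (bar (u + s - t * l))) + s + t) A) {x : ℤ} (hxA : x ∈ A)
    (hxS : x ∉ S) {j : ℤ} (hj : j < 0) (hj' : x + s * (j + 1) ∉ S) :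
    (-k ≤ I (x + s * j) ∧ I (x + s * j) < k) ∨ I (x + s * j) = m := by
  have hs : 0 < s := by linarith [h.hs]
  have := (eq_of_pair_eq_zero hs hA.maya h.mS h.cS hA.equi_s
    (fun x => (hc.weight_step hs h.hk h.k_lt x).1) (h.pair_weight hc hA) x).1 hxA hxS j hj hj'
  rw [show x + s * (j + 1) = x + s * j + s by ring] at this
  exact (hc.weight_step hs h.hk h.k_lt _).2 this

lemma step_of_mem_S (h : SwapConfig s t k l m v u S T) (hc : IsCoord s t v m I J)
    (hA : IsSolution s t S T
      (size (move T (u + s - t * l) (bar (u + s - t * l))) + s + t) A) {x : ℤ} (hxS : x ∈ S)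
    (hxA : x ∉ A) {j : ℤ} (hj : 0 ≤ j) (hj' : x + s * j ∈ S) :
    (-k ≤ I (x + s * j) ∧ I (x + s * j) < k) ∨ I (x + s * j) = m := by
  have hs : 0 < s := by linarith [h.hs]
  have := (eq_of_pair_eq_zero hs hA.maya h.mS h.cS hA.equi_s
    (fun x => (hc.weight_step hs h.hk h.k_lt x).1) (h.pair_weight hc hA) x).2 hxS hxA j hj hj'
  rw [show x + s * (j + 1) = x + s * j + s by ring] at this
  exact (hc.weight_step hs h.hk h.k_lt _).2 this

lemma coord_of_notMem_S (h : SwapConfig s t k l m v u S T) (hc : IsCoord s t v m I J)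
    (hA : IsSolution s t S T
      (size (move T (u + s - t * l) (bar (u + s - t * l))) + s + t) A) {x : ℤ} (hxA : x ∈ A)
    (hxS : x ∉ S) : (-k < I x ∧ I x ≤ k) ∨ I x = -m := by
  have := h.k_lt
  have h1 := h.step_of_notMem_S hc hA hxA hxS (j := -1) (by norm_num) (by simpa using hxS)
  have e : x + s * -1 + s = x := by ring
  rcases h1 with h1 | h1
  · have h2 := (hc.add_s (by omega : I (x + s * -1) < m)).1
    rw [e] at h2
    omega
  · have h2 := hc.add_s_of_eq h1
    rw [e] at h2
    exact Or.inr h2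

lemma coord_of_mem_S (h : SwapConfig s t k l m v u S T) (hc : IsCoord s t v m I J)
    (hA : IsSolution s t S T
      (size (move T (u + s - t * l) (bar (u + s - t * l))) + s + t) A) {x : ℤ} (hxS : x ∈ S)
    (hxA : x ∉ A) : (-k ≤ I x ∧ I x < k) ∨ I x = m := by
  have := h.step_of_mem_S hc hA hxS hxA le_rfl (by simpa using hxS)
  simpa using this

lemma inner_mem_S (h : SwapConfig s t k l m v u S T) {i j : ℤ} (hi : i ≤ k) (hj : j ≤ -1) :
    v + s * i + t * j ∈ S := by
  have := h.hs; have := h.ht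
  refine h.cS.mul _ (show 0 ≤ k - i by omega) (h.cS'.mul _ (show 0 ≤ -1 - j by omega) ?_)
  rw [show v + s * i + t * j + s * (k - i) + t * (-1 - j) = v + s * k - t by ring]
  refine h.mem_of_mem_T (h.cT' _ ?_) (by omega) h.d_ne_b_sub_t.symm
  rw [sub_add_cancel]
  exact h.bT

lemma inner_notMem_S (h : SwapConfig s t k l m v u S T) {i j : ℤ} (hi : -k ≤ i) (hj : 2 ≤ j) :
    v + s * i + t * j ∉ S := by
  rw [← h.aS, show bar (v + s * i + t * j) = v + s * (-i) + t * (1 - j) by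
    unfold bar; linear_combination -h.center_t]
  exact h.inner_mem_S (by omega) (by omega)

lemma inner_mem_T (h : SwapConfig s t k l m v u S T) {i j : ℤ} (hi : i ≤ k) (hj : j ≤ 0) :
    v + s * i + t * j ∈ T := by
  refine h.cT.mul _ (show 0 ≤ k - i by omega) (h.cT'.mul _ (show 0 ≤ -j by omega) ?_)
  rw [show v + s * i + t * j + s * (k - i) + t * (-j) = v + s * k by ring]
  exact h.bT

lemma inner_notMem_T (h : SwapConfig s t k l m v u S T) {i j : ℤ} (hi : -k ≤ i) (hj : 1 ≤ j) :
    v + s * i + t * j ∉ T := by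
  rw [← h.aT, show bar (v + s * i + t * j) = v + s * (-i) + t * (1 - j) by
    unfold bar; linear_combination -h.center_t]
  exact h.inner_mem_T (by omega) (by omega)

lemma center_row_mem_S (h : SwapConfig s t k l m v u S T) (i : ℤ) : v + s * i ∈ S ↔ i < k := by
  constructor
  · intro hi
    by_contra hc
    refine h.bS (h.cS.mul _ (show 0 ≤ i - k by omega) ?_)
    rwa [show v + s * k + s * (i - k) = v + s * i by ring]
  · intro hi
    refine h.cS.mul _ (show 0 ≤ k - 1 - i by omega) ?_
    rw [show v + s * i + s * (k - 1 - i) = v + s * k - s by ring]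
    have := h.hs
    refine h.mem_of_mem_T (h.cT _ ?_) (by omega) h.d_ne_b_sub_s.symm
    rw [sub_add_cancel]
    exact h.bT

/-- An element of the inner columns outside the core lies in one of the two central lines. -/
lemma line_of_notMem_S (h : SwapConfig s t k l m v u S T) (hc : IsCoord s t v m I J)
    (hA : IsSolution s t S T
      (size (move T (u + s - t * l) (bar (u + s - t * l))) + s + t) A) {x : ℤ} (hxA : x ∈ A)
    (hxS : x ∉ S) (h1 : -k ≤ I x) (h2 : I x ≤ k) : J x = 0 ∨ J x = 1 := by
  have hkm := h.k_lt
  by_contra hcon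
  have hJ : 2 ≤ J x := by
    by_contra hJ
    refine hxS ?_
    rw [hc.eq x]
    exact h.inner_mem_S h2 (by omega)
  have key : ∀ n : ℕ, I (x + s * (-(n : ℤ))) = I x - n ∧ J (x + s * (-(n : ℤ))) = J x ∧
      -k ≤ I x - n := by
    intro n
    induction n with
    | zero => simpa using h1
    | succ n ih =>
      obtain ⟨ih1, ih2, ih3⟩ := ih
      have hn : x + s * (-(n : ℤ)) ∉ S := by
        rw [hc.eq (x + s * (-(n : ℤ))), ih1, ih2]
        exact h.inner_notMem_S ih3 hJ
      have h3 := h.step_of_notMem_S hc hA hxA hxS (j := -((n : ℤ) + 1)) (by omega) (by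
        rwa [show -((n : ℤ) + 1) + 1 = -n by ring])
      have e : x + s * (-(n : ℤ)) = x + s * (-((n : ℤ) + 1)) + s := by ring
      push_cast
      rcases h3 with h3 | h3
      · have h4 := hc.add_s (by omega : I (x + s * (-((n : ℤ) + 1))) < m)
        rw [← e] at h4
        omega
      · have h4 := hc.add_s_of_eq h3
        rw [← e] at h4
        omega
  have := (key (2 * k + 1).toNat).2.2
  have := h.hk
  omega

lemma line_of_mem_S (h : SwapConfig s t k l m v u S T) (hc : IsCoord s t v m I J)
    (hA : IsSolution s t S T
      (size (move T (u + s - t * l) (bar (u + s - t * l))) + s + t) A) {x : ℤ} (hxS : x ∈ S)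
    (hxA : x ∉ A) (h1 : -k ≤ I x) (h2 : I x ≤ k) : J x = 0 ∨ J x = 1 := by
  have hb := hc.bar x
  have := h.line_of_notMem_S hc hA (hA.anti.bar_mem hxA) (h.aS.bar_notMem hxS) (by omega)
    (by omega)
  omega

/-- In each inner column a solution contains exactly one of the two central nodes. -/
lemma inner_flip (h : SwapConfig s t k l m v u S T) (hc : IsCoord s t v m I J)
    (hA : IsSolution s t S T
      (size (move T (u + s - t * l) (bar (u + s - t * l))) + s + t) A) {i : ℤ} (h1 : -k ≤ i)
    (h2 : i ≤ k) : v + s * i ∈ A ↔ v + s * i + t ∉ A := by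
  have hkm := h.k_lt
  have hco : ∀ j, I (v + s * i + t * j) = i ∧ J (v + s * i + t * j) = j := fun j =>
    hc.of_eq (by omega) (by omega) rfl
  have hlow : ∀ j ≤ -1, v + s * i + t * j ∈ A := by
    intro j hj
    by_contra hjA
    have := h.line_of_mem_S hc hA (h.inner_mem_S h2 hj) hjA (by rw [(hco j).1]; exact h1)
      (by rw [(hco j).1]; exact h2)
    rw [(hco j).2] at this
    omega
  have hhigh : ∀ j ≥ 2, v + s * i + t * j ∉ A := by
    intro j hj hjA
    have := h.line_of_notMem_S hc hA hjA (h.inner_notMem_S h1 hj) (by rw [(hco j).1]; exact h1)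
      (by rw [(hco j).1]; exact h2)
    rw [(hco j).2] at this
    omega
  have e0 : v + s * i + t * 0 = v + s * i := by ring
  have e1 : v + s * i + t * 1 = v + s * i + t := by ring
  constructor
  · intro h3 h4
    obtain ⟨y, hyT, hyA, d, hd⟩ := hA.equi_t.exists_mem hA.maya h.mT h4
      (e1 ▸ h.inner_notMem_T h1 le_rfl)
    obtain rfl : y = v + s * i + t * (d + 1) := by linear_combination hd
    have h5 : ¬ 1 ≤ d + 1 := fun h5 => h.inner_notMem_T h1 h5 hyT
    have h6 : ¬ d + 1 ≤ -1 := fun h6 => hyA (hlow _ h6)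
    rw [show d + 1 = 0 by omega, e0] at hyA
    exact hyA h3
  · intro h3
    by_contra h4
    obtain ⟨y, hyA, hyT, d, hd⟩ := hA.equi_t.symm.exists_mem h.mT hA.maya
      (e0 ▸ h.inner_mem_T h2 le_rfl) h4
    obtain rfl : y = v + s * i + t * d := by linear_combination hd
    have h5 : ¬ d ≤ 0 := fun h5 => hyT (h.inner_mem_T h2 h5)
    have h6 : ¬ 2 ≤ d := fun h6 => hhigh _ h6 hyA
    rw [show d = 1 by omega, e1] at hyA
    exact h3 hyA

lemma inner_symm (h : SwapConfig s t k l m v u S T) (hc : IsCoord s t v m I J)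
    (hA : IsSolution s t S T
      (size (move T (u + s - t * l) (bar (u + s - t * l))) + s + t) A) {i : ℤ} (h1 : -k ≤ i)
    (h2 : i ≤ k) : v + s * i ∈ A ↔ v + s * (-i) ∈ A := by
  rw [h.inner_flip hc hA h1 h2, ← hA.anti, show bar (v + s * i + t) = v + s * (-i) by
    unfold bar; linear_combination -h.center_t]

end SwapConfig

namespace SwapConfig

variable {s t k l m v u : ℤ} {S T : Set ℤ} {I J : ℤ → ℤ} {A : Set ℤ}

lemma center_row_eq (h : SwapConfig s t k l m v u S T) (hc : IsCoord s t v m I J)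
    (hA : IsSolution s t S T
      (size (move T (u + s - t * l) (bar (u + s - t * l))) + s + t) A) {i : ℤ}
    (hiA : v + s * i ∈ A) (hiS : v + s * i ∉ S) : i = k := by
  have hkm := h.k_lt
  have hk := h.hk
  rw [h.center_row_mem_S] at hiS
  by_contra hne
  have := h.step_of_notMem_S hc hA hiA (by rwa [h.center_row_mem_S]) (j := k - i) (by omega) (by
    rw [show v + s * i + s * (k - i + 1) = v + s * (k + 1) by ring, h.center_row_mem_S]; omega)
  rw [show v + s * i + s * (k - i) = v + s * k by ring, h.coord_b hc] at this
  omega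

lemma center_row_ge (h : SwapConfig s t k l m v u S T) (hc : IsCoord s t v m I J)
    (hA : IsSolution s t S T
      (size (move T (u + s - t * l) (bar (u + s - t * l))) + s + t) A) {i : ℤ}
    (hiS : v + s * i ∈ S) (hiA : v + s * i ∉ A) : -k ≤ i := by
  have hkm := h.k_lt
  have hk := h.hk
  by_contra hlt
  have e : v + s * i + s * (-k - 1 - i) = v + s * (-k - 1) + t * 0 := by ring
  have := h.step_of_mem_S hc hA hiS hiA (j := -k - 1 - i) (by omega) (by
    rw [e, mul_zero, add_zero, h.center_row_mem_S]; omega)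
  rw [e, (hc.of_eq (by omega) (by omega) rfl).1] at this
  omega

/-- If this bead were missing, so would be the one at index -k, which belongs to S. Equal s-charges
require an extra bead in the central row, and index k is the only place for it. -/
lemma b_mem (h : SwapConfig s t k l m v u S T) (hc : IsCoord s t v m I J)
    (hA : IsSolution s t S T
      (size (move T (u + s - t * l) (bar (u + s - t * l))) + s + t) A) : v + s * k ∈ A := by
  have hk := h.hk
  by_contra hb
  rw [h.inner_symm hc hA (by omega) le_rfl] at hb
  obtain ⟨y, hyA, hyS, d, hd⟩ := hA.equi_s.symm.exists_mem h.mS hA.maya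
    ((h.center_row_mem_S (-k)).2 (by omega)) hb
  obtain rfl : y = v + s * (d - k) := by linear_combination hd
  rw [h.center_row_eq hc hA hyA hyS, h.inner_symm hc hA (by omega) le_rfl] at hyA
  exact hb hyA

/-- Relative to S the central row has exactly one extra bead, so exactly one bead of S is missing.
The missing positions are symmetric under i ↦ -i, so the gap is at 0. -/
lemma center_row_mem (h : SwapConfig s t k l m v u S T) (hc : IsCoord s t v m I J)
    (hA : IsSolution s t S T
      (size (move T (u + s - t * l) (bar (u + s - t * l))) + s + t) A) {i : ℤ} (h1 : -k ≤ i)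
    (h2 : i ≤ k) : v + s * i ∈ A ↔ i ≠ 0 := by
  have hs := h.hs
  have hbA := h.b_mem hc hA
  have hole : ∀ i, -k ≤ i → i ≤ k → v + s * i ∉ A → i = 0 := by
    intro i h1 h2 hi
    by_contra hi0
    have hi' := (h.inner_symm hc hA h1 h2).not.1 hi
    have h3 : i ≠ k := by rintro rfl; exact hi hbA
    have h4 : -i ≠ k := by intro he; rw [he] at hi'; exact hi' hbA
    have hiS := (h.center_row_mem_S i).2 (by omega)
    have hiS' := (h.center_row_mem_S (-i)).2 (by omega)
    have hM := hA.maya.move (v + s * k) (v + s * i)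
    have hE : Equicharged s (move A (v + s * k) (v + s * i)) S :=
      (equicharged_move hbA hi ⟨i - k, by ring⟩).trans hM hA.maya h.mS hA.equi_s
    obtain ⟨y, hyA, hyS, d, hd⟩ := hE.symm.exists_mem h.mS hM hiS' (by
      rw [mem_move, not_or]
      refine ⟨fun hc => hi' hc.1, fun he => hi0 ?_⟩
      have : s * i = 0 := by linarith
      rcases mul_eq_zero.1 this with h | h <;> omega)
    obtain rfl : y = v + s * (d - i) := by linear_combination hd
    rw [mem_move] at hyA
    rcases hyA with ⟨hy1, hy2⟩ | hy
    · rw [h.center_row_eq hc hA hy1 hyS] at hy2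
      exact hy2 rfl
    · rw [hy] at hyS
      exact hyS hiS
  refine ⟨?_, fun hi => by_contra fun hc => hi (hole i h1 h2 hc)⟩
  rintro hi rfl
  obtain ⟨y, hyS, hyA, d, hd⟩ := hA.equi_s.exists_mem hA.maya h.mS hbA h.bS
  obtain rfl : y = v + s * (k + d) := by linear_combination hd
  have h3 := h.center_row_ge hc hA hyS hyA
  have h4 := (h.center_row_mem_S _).1 hyS
  rw [hole _ h3 h4.le hyA] at hyA
  exact hyA hi

lemma mem_inner_iff (h : SwapConfig s t k l m v u S T) (hc : IsCoord s t v m I J)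
    (hA : IsSolution s t S T
      (size (move T (u + s - t * l) (bar (u + s - t * l))) + s + t) A) {x : ℤ} (h1 : -k ≤ I x)
    (h2 : I x ≤ k) : x ∈ A ↔ J x ≤ -1 ∨ (J x = 0 ∧ I x ≠ 0) ∨ (J x = 1 ∧ I x = 0) := by
  have hx := hc.eq x
  rcases (by omega : J x ≤ -1 ∨ J x = 0 ∨ J x = 1 ∨ 2 ≤ J x) with hJ | hJ | hJ | hJ
  · have : x ∈ A := by
      by_contra hxA
      have := h.line_of_mem_S hc hA (by rw [hx]; exact h.inner_mem_S h2 hJ) hxA h1 h2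
      omega
    simp [this, hJ]
  · rw [hJ, mul_zero, add_zero] at hx
    have := h.center_row_mem hc hA h1 h2
    rw [← hx] at this
    rw [this]
    omega
  · rw [hJ, mul_one] at hx
    have h3 := h.center_row_mem hc hA h1 h2
    have h4 := h.inner_flip hc hA h1 h2
    rw [← hx] at h4
    have : x ∈ A ↔ I x = 0 := by tauto
    rw [this]
    omega
  · have : x ∉ A := by
      intro hxA
      have := h.line_of_notMem_S hc hA hxA (by rw [hx]; exact h.inner_notMem_S h1 hJ) h1 h2
      omega
    simp only [this, false_iff]
    omega

lemma left_mem_of_mem_S (h : SwapConfig s t k l m v u S T) (hc : IsCoord s t v m I J)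
    (hA : IsSolution s t S T
      (size (move T (u + s - t * l) (bar (u + s - t * l))) + s + t) A) {x : ℤ} (hx : I x = -m)
    (hxS : x ∈ S) : x ∈ A := by
  by_contra hxA
  have := h.coord_of_mem_S hc hA hxS hxA
  have := h.k_lt
  have := h.hk
  omega

lemma left_eq (h : SwapConfig s t k l m v u S T) (hc : IsCoord s t v m I J) {x : ℤ}
    (hx : I x = -m) (hxT : x ∈ T) (hxS : x ∉ S) : x = u + s - t * l := by
  by_contra hne
  refine hxS (h.mem_of_mem_T hxT (fun hb => ?_) hne)
  have hI := h.coord_b hc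
  have := h.k_lt
  have := h.hk
  rw [← hb] at hI
  omega

/-- In the column of `u + s` a solution has at most one element more than the core. -/
lemma left_unique (h : SwapConfig s t k l m v u S T) (hc : IsCoord s t v m I J)
    (hA : IsSolution s t S T
      (size (move T (u + s - t * l) (bar (u + s - t * l))) + s + t) A) {x y : ℤ}
    (hx : I x = -m) (hy : I y = -m) (hxA : x ∈ A) (hxS : x ∉ S) (hyA : y ∈ A) (hyS : y ∉ S) :
    x = y := by
  wlog hxd : x ≠ u + s - t * l generalizing x y
  · by_contra hne
    exact hne (this hy hx hyA hyS hxA hxS fun hyd => hne ((not_not.1 hxd).trans hyd.symm)).symm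
  by_contra hne
  have hxT : x ∉ T := fun hxT => hxd (h.left_eq hc hx hxT hxS)
  obtain ⟨z, hzT, hzA, hz⟩ := hA.equi_t.exists_mem hA.maya h.mT hxA hxT
  have hIz : I z = -m := (hc.of_dvd hz).trans hx
  obtain rfl := h.left_eq hc hIz hzT fun hzS => hzA (h.left_mem_of_mem_S hc hA hIz hzS)
  have hM := hA.maya.move x (u + s - t * l)
  have hE : Equicharged t (move A x (u + s - t * l)) T :=
    (equicharged_move hxA hzA hz).trans hM hA.maya h.mT hA.equi_t
  have hyT : y ∉ T := fun hyT => hzA (h.left_eq hc hy hyT hyS ▸ hyA)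
  obtain ⟨w, hwT, hwA, hw⟩ := hE.exists_mem hM h.mT (mem_move.2 (Or.inl ⟨hyA, Ne.symm hne⟩)) hyT
  have hIw : I w = -m := (hc.of_dvd hw).trans hy
  rw [mem_move, not_or] at hwA
  refine hwA.1 ⟨?_, fun hwx => hxT (hwx ▸ hwT)⟩
  by_contra hwA'
  exact hwA.2 (h.left_eq hc hIw hwT fun hwS => hwA' (h.left_mem_of_mem_S hc hA hIw hwS))

lemma left_reflect (h : SwapConfig s t k l m v u S T) (hc : IsCoord s t v m I J)
    (hA : IsSolution s t S T
      (size (move T (u + s - t * l) (bar (u + s - t * l))) + s + t) A) {x : ℤ} (hx : I x = -m)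
    (hxA : x ∈ A) (hxS : x ∉ S) : x - s ∈ S ∧ x - s ∉ A := by
  have hk := h.hk
  have hkm := h.k_lt
  have hs := h.hs
  have hI : I (x - s) = m := by
    have h1 := hc.hi (x - s)
    by_contra hne
    have h2 := (hc.add_s (by omega : I (x - s) < m)).1
    rw [sub_add_cancel] at h2
    have := hc.lo (x - s)
    omega
  have hno : ¬ ((-k ≤ I (x - 2 * s) ∧ I (x - 2 * s) < k) ∨ I (x - 2 * s) = m) := by
    have e : x - 2 * s + s = x - s := by ring
    have h1 := hc.hi (x - 2 * s)
    by_cases h2 : I (x - 2 * s) = m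
    · have h3 := hc.add_s_of_eq h2
      rw [e] at h3
      omega
    · have h3 := (hc.add_s (by omega : I (x - 2 * s) < m)).1
      rw [e] at h3
      omega
  have hxs : x - s ∈ S := by
    by_contra hc'
    have := h.step_of_notMem_S hc hA hxA hxS (j := -2) (by norm_num) (by
      rwa [show x + s * (-2 + 1) = x - s by ring])
    rw [show x + s * -2 = x - 2 * s by ring] at this
    exact hno this
  refine ⟨hxs, ?_⟩
  obtain ⟨y, hyS, hyA, d, hd⟩ := hA.equi_s.exists_mem hA.maya h.mS hxA hxS
  have hd0 : d < 0 := by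
    by_contra hd0
    exact hxS (h.cS.mul _ (not_lt.1 hd0) (by rwa [← hd, add_sub_cancel]))
  by_cases hd1 : d = -1
  · rwa [show x - s = y by rw [hd1] at hd; linear_combination -hd]
  · have e : y + s * (-2 - d) = x - 2 * s := by linear_combination hd
    have := h.step_of_mem_S hc hA hyS hyA (j := -2 - d) (by omega) (by
      rw [e]; exact h.cS _ (by rwa [show x - 2 * s + s = x - s by ring]))
    rw [e] at this
    exact absurd this hno

/-- An extra bead x forces x - s to be missing, and the mirror image of x - s is then an extra bead
in the same column. There is at most one, so x is fixed by this reflection. -/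
lemma left_central (h : SwapConfig s t k l m v u S T) (hc : IsCoord s t v m I J)
    (hA : IsSolution s t S T
      (size (move T (u + s - t * l) (bar (u + s - t * l))) + s + t) A) {x : ℤ} (hx : I x = -m)
    (hxA : x ∈ A) (hxS : x ∉ S) : x = u + s := by
  have ht := h.ht
  obtain ⟨h1, h2⟩ := h.left_reflect hc hA hx hxA hxS
  obtain ⟨j, rfl⟩ := h.exists_left hc hx
  have e : bar (u + s + t * j - s) = u + s + t * (-j) := by
    unfold bar; linear_combination -h.center_s
  have h3 := h.left_unique hc hA hx (h.coord_left hc (-j)) hxA hxS (e ▸ hA.anti.bar_mem h2)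
    (e ▸ h.aS.bar_notMem h1)
  have : t * j = 0 := by linarith
  rw [this, add_zero]

lemma center_s_add_mem (h : SwapConfig s t k l m v u S T) (hc : IsCoord s t v m I J)
    (hA : IsSolution s t S T
      (size (move T (u + s - t * l) (bar (u + s - t * l))) + s + t) A) : u + s ∈ A := by
  have hk := h.hk
  have hkm := h.k_lt
  have hd : I (u + s - t * l) = -m := by
    rw [sub_eq_add_neg, ← mul_neg]; exact h.coord_left hc _
  by_cases hdA : u + s - t * l ∈ A
  · rwa [← h.left_central hc hA hd hdA h.dS]
  · obtain ⟨y, hyA, hyT, hy⟩ := hA.equi_t.symm.exists_mem h.mT hA.maya h.dT hdA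
    have hIy := (hc.of_dvd hy).trans hd
    have hyS : y ∉ S := by
      refine fun hyS => hyT (h.mem_T_of_mem hyS ?_ ?_) <;> rintro rfl
      · rw [(hc.bar _).1, h.coord_b hc] at hIy
        omega
      · rw [(hc.bar _).1, hd] at hIy
        omega
    rwa [← h.left_central hc hA hIy hyA hyS]

lemma mem_left_iff (h : SwapConfig s t k l m v u S T) (hc : IsCoord s t v m I J)
    (hA : IsSolution s t S T
      (size (move T (u + s - t * l) (bar (u + s - t * l))) + s + t) A) {x : ℤ} (hx : I x = -m) :
    x ∈ A ↔ x ∈ S ∨ x = u + s := by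
  constructor
  · intro hxA
    by_contra hcon
    rw [not_or] at hcon
    exact hcon.2 (h.left_central hc hA hx hxA hcon.1)
  · rintro (hxS | rfl)
    · exact h.left_mem_of_mem_S hc hA hx hxS
    · exact h.center_s_add_mem hc hA

/-- Every solution is determined column by column: the inner columns by `mem_inner_iff`, column -m
by `mem_left_iff`, column m by reflection. All other columns agree with S. -/
lemma solution_unique (h : SwapConfig s t k l m v u S T) {A B : Set ℤ}
    (hA : IsSolution s t S T
      (size (move T (u + s - t * l) (bar (u + s - t * l))) + s + t) A)
    (hB : IsSolution s t S T
      (size (move T (u + s - t * l) (bar (u + s - t * l))) + s + t) B) : A = B := by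
  have hk := h.hk
  have hkm := h.k_lt
  obtain ⟨I, J, hc⟩ := exists_isCoord h.cop (by omega) h.t_eq h.center_t
  ext x
  by_cases h1 : -k ≤ I x ∧ I x ≤ k
  · rw [h.mem_inner_iff hc hA h1.1 h1.2, h.mem_inner_iff hc hB h1.1 h1.2]
  by_cases h2 : I x = -m
  · rw [h.mem_left_iff hc hA h2, h.mem_left_iff hc hB h2]
  by_cases h3 : I x = m
  · have h4 : I (bar x) = -m := by rw [(hc.bar x).1, h3]
    rw [← not_iff_not, ← hA.anti, ← hB.anti, h.mem_left_iff hc hA h4, h.mem_left_iff hc hB h4]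
  · have key : ∀ C, IsSolution s t S T
        (size (move T (u + s - t * l) (bar (u + s - t * l))) + s + t) C → (x ∈ C ↔ x ∈ S) := by
      intro C hC
      constructor <;> intro hx <;> by_contra hx'
      · have := h.coord_of_notMem_S hc hC hx hx'
        omega
      · have := h.coord_of_mem_S hc hC hx hx'
        omega
    rw [key A hA, key B hB]

/-- The intermediate set is closed under both s and t. Exchanging its central pair at distance s
restores the t-charges of T and leaves the s-charges alone, and the pair at distance t does the same
for S. -/
lemma isSolution (h : SwapConfig s t k l m v u S T) :
    IsSolution s t S T (size (move T (u + s - t * l) (bar (u + s - t * l))) + s + t)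
      (move (move (move T (u + s - t * l) (bar (u + s - t * l))) u (u + s)) v (v + t)) := by
  have hs := h.hs
  have ht := h.ht
  have c1 := h.mid_closed h.cS h.cT h.d_ne_b_sub_s
  have c2 := h.mid_closed h.cS' h.cT' h.d_ne_b_sub_t
  have aU := h.aT.move h.dT
  have mU := h.mT.move (u + s - t * l) (bar (u + s - t * l))
  have eT : ∀ w, pair (move T (u + s - t * l) (bar (u + s - t * l))) T w =
      w (u + t * l) - w (u + s - t * l) := fun w => by
    rw [pair_move h.dT h.bar_d_notMem, h.bar_d]
  have eS := pair_move (h.aS.bar_mem h.bS) h.bS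
  rw [← h.mid_eq] at eS
  rw [h.bar_b] at eS
  generalize move T (u + s - t * l) (bar (u + s - t * l)) = U at *
  have hst : s ≠ t := by
    rintro rfl
    have := Int.le_of_dvd one_pos (h.cop.dvd_of_dvd_mul_left (show s ∣ s * 1 from ⟨1, rfl⟩))
    omega
  have hu := h.center_s
  have hv := h.center_t
  have hu1 := center_mem aU c1 hu
  have hu2 := center_add_notMem aU c1 hu
  have hv1 := center_mem aU c2 hv
  have hv2 := center_add_notMem aU c2 hv
  have hv1' : v ∈ move U u (u + s) := by rw [mem_move]; left; exact ⟨hv1, by omega⟩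
  have hv2' : v + t ∉ move U u (u + s) := by
    rw [mem_move]; simp only [hv2, false_and, false_or]; omega
  have mU' := mU.move u (u + s)
  have mA := mU'.move v (v + t)
  refine ⟨mA, (aU.move_center hu hu1).move_center hv hv1', fun w hw => ?_, fun w hw => ?_, ?_⟩
  · rw [pair_trans mA mU' h.mS, pair_trans mU' mU h.mS, pair_move hv1' hv2', pair_move hu1 hu2,
      eS, hw, periodic_mul hw, periodic_mul hw]
    ring
  · rw [pair_trans mA mU' h.mT, pair_trans mU' mU h.mT, pair_move hv1' hv2', pair_move hu1 hu2,
      eT, hw, periodic_mul hw, sub_eq_add_neg (u + s), ← mul_neg, periodic_mul hw]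
    ring
  · rw [size_move mU' hv1' hv2', size_move mU hu1 hu2]
    ring

end SwapConfig

lemma exists_swapConfig {s t : ℤ} (hs : 1 < s) (ht : 1 < t) (hst : IsCoprime s t) (hos : Odd s)
    (hot : Odd t) {S T : Set ℤ} (mS : Maya S) (mT : Maya T) (aS : Anti S) (aT : Anti T)
    (cS : Closed s S) (cS' : Closed t S) (cT : Closed s T) (cT' : Closed t T) {b c : ℤ}
    (h : SetDoubleSwapAt s t S T b c) :
    ∃ k l m v u, SwapConfig s t k l m v u S T ∧ c = u + s - t * l := by
  obtain ⟨hbc, ⟨hbT, hbS⟩, ⟨hcT, hcS⟩, hb, hc, hST⟩ := h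
  obtain ⟨m, hm⟩ := hot
  obtain ⟨v, hv⟩ := exists_center_of_odd ⟨m, hm⟩
  obtain ⟨u, hu⟩ := exists_center_of_odd hos
  obtain ⟨k, rfl⟩ := eq_add_of_modEq hv hb
  obtain ⟨e, he⟩ := hc.dvd
  have hce : c = u + s - t * (-e) := by
    unfold bar at he
    have : 2 * (c - (u + s - t * (-e))) = 0 := by linear_combination he - hu
    omega
  refine ⟨k, -e, m, v, u, ?_, hce⟩
  subst hce
  refine ⟨hs, ht, hst, hm, hv, hu, ?_, ?_, mS, mT, aS, aT, cS, cS', cT, cT', hbT, hbS, hcT, hcS, ?_⟩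
  -- A self-conjugate t-core contains v, so if k ≤ 0 then S, being s-closed, would contain v + s *
  -- k. The bound on l comes in the same way from u + s not being in T.
  · by_contra hk
    refine hbS (cS.mul _ (show 0 ≤ -k by omega) ?_)
    rw [show v + s * k + s * -k = v by ring]
    exact center_mem aS cS' hv
  · by_contra hl
    refine center_add_notMem aT cT hu (cT'.mul _ (show 0 ≤ e by omega) ?_)
    rwa [show u + s + t * e = u + s - t * -e by ring]
  · ext x
    rw [hST, mem_move, mem_move]
    have h1 := aT.bar_notMem hcT
    have h2 : bar (u + s - t * -e) ≠ v + s * k := fun h => h1 (h ▸ hbT)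
    simp only [Set.mem_union, Set.mem_sdiff, Set.mem_insert_iff, Set.mem_singleton_iff]
    by_cases h3 : x = bar (u + s - t * -e)
    · have h4 : x ≠ v + s * k := h3 ▸ h2
      tauto
    · tauto

lemma backward_double {s t : ℤ} (hs : 1 < s) (ht : 1 < t) (hst : IsCoprime s t) (hos : Odd s)
    (hot : Odd t) {S T : Set ℤ} (mS : Maya S) (mT : Maya T) (aS : Anti S) (aT : Anti T)
    (cS : Closed s S) (cS' : Closed t S) (cT : Closed s T) (cT' : Closed t T) {b c : ℤ}
    (h : SetDoubleSwapAt s t S T b c) :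
    ∃! A, IsSolution s t S T (size ((T \ {c}) ∪ {bar c}) + s + t) A := by
  obtain ⟨k, l, m, v, u, hcfg, rfl⟩ :=
    exists_swapConfig hs ht hst hos hot mS mT aS aT cS cS' cT cT' h
  exact ⟨_, hcfg.isSolution, fun A hA => hcfg.solution_unique hA hcfg.isSolution⟩

/-! ### Back to partitions. -/

/-- The core with all columns cut at height 0 exists and strictly beats every other core, so a
largest core must coincide with it. -/
lemma isLargest_iff {s t : ℕ} (hs : 0 < s) (ht : 0 < t) (hst : IsCoprime (s : ℤ) t)
    (hodd : Odd (t : ℤ)) {σ : YoungDiagram} (hσ : IsSimultaneousCore s t σ) :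
    IsLargestSimultaneousCore s t σ ↔ IsKappa s t (betaSet σ) := by
  have hs' : (0 : ℤ) < s := by exact_mod_cast hs
  have ht' : (0 : ℤ) < t := by exact_mod_cast ht
  have key : ∀ κ ρ : YoungDiagram, IsSimultaneousCore s t κ → IsKappa s t (betaSet κ) →
      IsSimultaneousCore s t ρ → ρ ≠ κ → ρ.card < κ.card := by
    intro κ ρ hκ kκ hρ hne
    have h0 : pair (betaSet ρ) (betaSet κ) (fun _ => 1) = 0 := by
      rw [pair_trans (maya_betaSet ρ) maya_vac (maya_betaSet κ), pair_symm vac, charge_betaSet,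
        charge_betaSet]
      rfl
    have := kκ.size_lt hs' ht' hst (maya_betaSet κ) ((isCore_iff ht).1 hκ.2) (maya_betaSet ρ)
      ((isCore_iff hs).1 hρ.1) ((isCore_iff ht).1 hρ.2) h0 fun he => hne (betaSet_injective he)
    rw [size_betaSet, size_betaSet] at this
    exact_mod_cast this
  refine ⟨fun h => ?_, fun h => ⟨hσ, fun ρ => key σ ρ hσ h⟩⟩
  obtain ⟨K, mK, aK, cK, cK', kK⟩ := exists_isKappa hs' ht' hst hodd
  obtain ⟨κ, rfl⟩ := exists_betaSet_eq mK aK.charge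
  have hκ : IsSimultaneousCore s t κ := ⟨(isCore_iff hs).2 cK, (isCore_iff ht).2 cK'⟩
  by_cases he : σ = κ
  · rwa [he]
  · exact absurd (h.2 κ hκ (Ne.symm he)) (key κ σ hκ kK hσ he).not_gt

end CorePartitions

theorem theorem4p2 (s t : ℕ) (hs : 1 < s) (ht : 1 < t) (hst : Nat.Coprime s t)
    (σ τ : YoungDiagram)
    (hσ : CorePartitions.IsSimultaneousCore s t σ)
    (hτ : CorePartitions.IsSimultaneousCore s t τ) (n : ℕ) :
    (∃! μ : YoungDiagram,
        μ ∈ CorePartitions.partitionsWithCores s t n σ τ ∧ CorePartitions.IsSelfConjugate μ) ↔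
      CorePartitions.IsSelfConjugate σ ∧ CorePartitions.IsSelfConjugate τ ∧
        ((σ = τ ∧ n = σ.card) ∨
          (Odd t ∧ CorePartitions.SingleSwap s t σ τ ∧ n = τ.card + t) ∨
          (Odd s ∧ CorePartitions.SingleSwap t s τ σ ∧ n = σ.card + s) ∨
          (Odd s ∧ Odd t ∧ CorePartitions.DoubleSwap s t σ τ ∧
            ∃ υ : YoungDiagram, CorePartitions.IsStar s t σ τ υ ∧ n = υ.card + s + t) ∨
          (Odd s ∧ Odd t ∧ σ = τ ∧ CorePartitions.IsLargestSimultaneousCore s t σ ∧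
            n = σ.card + s * t)) := by
  open CorePartitions in
  have hs0 : 0 < s := by omega
  have ht0 : 0 < t := by omega
  have hs' : (1 : ℤ) < s := by exact_mod_cast hs
  have ht' : (1 : ℤ) < t := by exact_mod_cast ht
  have hst' : IsCoprime (s : ℤ) t := Nat.isCoprime_iff_coprime.2 hst
  have cS := (isCore_iff hs0).1 hσ.1
  have cS' := (isCore_iff ht0).1 hσ.2
  have cT := (isCore_iff hs0).1 hτ.1
  have cT' := (isCore_iff ht0).1 hτ.2
  have mS := maya_betaSet σ
  have mT := maya_betaSet τ
  rw [existsUnique_iff hs0 ht0 hσ.1 hτ.2, isSelfConjugate_iff, isSelfConjugate_iff,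
    ← Int.odd_coe_nat s, ← Int.odd_coe_nat t]
  constructor
  · rintro ⟨A, hA, huniq⟩
    have aS := cS.anti hA.maya hA.anti mS hA.equi_s
    have aT := cT'.anti hA.maya hA.anti mT hA.equi_t
    refine ⟨aS, aT, ?_⟩
    rcases forward hs' ht' hst' hA mS mT cS cS' cT' cT huniq with
      ⟨h1, h2⟩ | ⟨h1, h2, h3⟩ | ⟨h1, h2, h3⟩ | ⟨h1, h2, b, c, h3, h4⟩ | ⟨h1, h2, h3, h4, h5⟩
    · rw [size_betaSet] at h2
      exact Or.inl ⟨betaSet_injective h1, by exact_mod_cast h2⟩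
    · rw [size_betaSet] at h3
      exact Or.inr (Or.inl ⟨h1, h2, by exact_mod_cast h3⟩)
    · rw [size_betaSet] at h3
      exact Or.inr (Or.inr (Or.inl ⟨h1, h2, by exact_mod_cast h3⟩))
    · obtain ⟨υ, hυ⟩ := exists_betaSet_eq (mT.move c (bar c)) (aT.move h3.2.2.1.1).charge
      refine Or.inr (Or.inr (Or.inr (Or.inl ⟨h1, h2, ⟨b, c, h3⟩, υ, ⟨b, c, h3, hυ⟩, ?_⟩)))
      change _ = size (move (betaSet τ) c (bar c)) + _ + _ at h4
      rw [← hυ, size_betaSet] at h4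
      exact_mod_cast h4
    · rw [size_betaSet] at h5
      exact Or.inr (Or.inr (Or.inr (Or.inr ⟨h1, h2, betaSet_injective h3,
        (isLargest_iff hs0 ht0 hst' h2 hσ).2 h4, by exact_mod_cast h5⟩)))
  · rintro ⟨aS, aT, ⟨rfl, rfl⟩ | ⟨h1, h2, rfl⟩ | ⟨h1, h2, rfl⟩ | ⟨h1, h2, -, υ, ⟨b, c, h3, h4⟩, rfl⟩ |
      ⟨h1, h2, rfl, h4, rfl⟩⟩
    · rw [← size_betaSet]
      exact backward_trivial (by omega) mS aS cS
    · push_cast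
      rw [← size_betaSet]
      exact backward_single (by omega) h1 mT aT cT' h2
    · push_cast
      rw [← size_betaSet]
      obtain ⟨A, hA, huniq⟩ := backward_single (by omega) h1 mS aS cS h2
      exact ⟨A, hA.swap, fun B hB => huniq B hB.swap⟩
    · push_cast
      rw [← size_betaSet, h4]
      exact backward_double hs' ht' hst' h1 h2 mS mT aS aT cS cS' cT cT' h3
    · push_cast
      rw [← size_betaSet]
      exact backward_kappa (by omega) (by omega) hst' h1 h2 mS aS cS
        ((isLargest_iff hs0 ht0 hst' h2 hσ).1 h4)
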